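/- Let $n\ge 2$ and $k\ge 1$ be integers. Let $d\mu(t)=\gamma_n(1-t^2)^{(n-3)/2}\,dt$ on $[-1,1]$, with $\gamma_n=\Gamma(n/2)/(\sqrt\pi\,\Gamma((n-1)/2))$, let $P_i^{(n)}$ be the Gegenbauer polynomials with $P_i^{(n)}(1)=1$, and write $f_i$ for the coefficients in $f=\sum_i f_iP_i^{(n)}$, so that $f_0=\int f\,d\mu$. Let $\mathcal F_{\ge}$ be the class of functions $f=\sum_i f_iP_i^{(n)}$ on $[-1,1]$ with all $f_i\ge0$ and $\sum_i f_i<\infty$. A polynomial $f\in\mathcal F_{\ge}$ belongs to $\mathcal F_{>}$ if $f_i>0$ for all $i\le\deg f$. Let $P_i^{1,0}$ be the Jacobi polynomial $P_i^{((n-1)/2,(n-3)/2)}$ normalized by $P_i^{1,0}(1)=1$, with zeros $t_{i,1}^{1,0}<\dots<t_{i,i}^{1,0}$. For a real number $\ell$ let $d\nu_\ell(t)=(t-\ell)(1-t)\,d\mu(t)$, and let $P_i^{1,\ell}$ ($0\le i\le k$) be the polynomials, with $\deg P_i^{1,\ell}=i$, orthogonal with respect to $\nu_\ell$ and normalized by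 $P_i^{1,\ell}(1)=1$ (they are obtained by the Gram–Schmidt process); $t_{k,k}^{1,\ell}$ is the largest zero of $P_k^{1,\ell}$. The $\ell$-strengthened Krein condition says that $(t-\ell)P_i^{1,\ell}(t)P_j^{1,\ell}(t)\in\mathcal F_{>}$ for all $i,j\in\{0,\dots,k\}$ except $i=j=k$. Put $R_{k-1}(t,s;\ell)=\sum_{j=0}^{k-1} r_jP_j^{1,\ell}(t)P_j^{1,\ell}(s)$ with $r_j=\bigl(\int (P_j^{1,\ell})^2d\nu_\ell\bigr)^{-1}$, $P_{k-1}^{1,\ell,s}(t)=R_{k-1}(t,s;\ell)/R_{k-1}(1,s;\ell)$, and $$f_{2k}^{(n,\ell,s)}(t)=(t-\ell)(t-s)\bigl(P_{k-1}^{1,\ell,s}(t)\bigr)^2 .$$ A spherical code is a nonempty finite set $C\subset\mathbb S^{n-1}$. Let $\mathcal A(n;[\ell,s])$ be the largest cardinality of a spherical code with $\ell\le\langle x,y\rangle\le s$ for all distinct $x,y\in C$, and let $\mathcal E(n,M,\ell;h)$ be the infimum of $\sum_{x,y\in C,\,x\ne y}h(\langle x,y\rangle)$ over the spherical codes $C$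 with $|C|=M$ and $\ell\le\langle x,y\rangle<1$ for distinct $x,y\in C$ (it is $+\infty$ if there is no such code). **Theorem.** Assume that $\ell\in[-1,t_{k,1}^{1,0})$, that $s\in(t_{k,k}^{1,0},t_{k,k}^{1,\ell})$, and that the $\ell$-strengthened Krein condition holds. Let $f_0$ be the zeroth Gegenbauer coefficient of $f_{2k}^{(n,\ell,s)}$. Then there are nodes $\ell=\beta_0<\beta_1<\dots<\beta_{k-1}<\beta_k=s<\beta_{k+1}=1$, where $\beta_1,\dots,\beta_{k-1}$ are exactly the zeros of $P_{k-1}^{1,\ell,s}$, and weights $\rho_0,\dots,\rho_{k+1}>0$ such that $\int f\,d\mu=\sum_{i=0}^{k+1}\rho_if(\beta_i)$ for all polynomials $f$ of degree at most $2k$, and such that $$\mathcal A(n;[\ell,s])\le\frac{f_{2k}^{(n,\ell,s)}(1)}{f_0}=\frac1{\rho_{k+1}} .$$ Moreover, let $h$ be absolutely monotone, that is, smooth on $[-1,1)$ with $h^{(m)}(t)\ge0$ for all $m\ge0$ and $t\in[-1,1)$, let $M$ be defined by $f_{2k}^{(n,\ell,s)}(1)=Mf_0$, and let $g=H((t-s)f_{2k}^{(n,\ell,s)};h)$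 be the Hermite interpolant, that is, the unique polynomial of degree less than $\deg\bigl((t-s)f_{2k}^{(n,\ell,s)}\bigr)$ which interpolates $h$ at the zeros of $(t-s)f_{2k}^{(n,\ell,s)}(t)$, taken with their multiplicities. If $h$ is not identically zero on $[-1,1)$, then $g$ belongs to $$\mathcal G_{n,\ell;h}=\{g\in\mathcal F_{\ge}:\ g(t)\le h(t)\text{ for }t\in[\ell,1),\ g_0>0\}.$$ In all cases $$\mathcal E(n,M,\ell;h)\ \ge\ M(Mg_0-g(1))=M^2\sum_{i=0}^{k}\rho_ih(\beta_i).$$ -/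

import Mathlib

open Polynomial MeasureTheory
open scoped ENNReal

noncomputable section

namespace SphericalLP

/-- The classical Jacobi polynomial `P_k^{(α,β)}`, expanded in powers of `(t - 1) / 2`:
`∑_l (k+α+β+1)_l (α+l+1)_{k-l} / (l! (k-l)!) ((t-1)/2)^l`, with `(x)_l` the rising factorial. -/
def jacobi (α β : ℝ) (k : ℕ) : ℝ[X] :=
  ∑ l ∈ Finset.range (k + 1),
    C ((ascPochhammer ℝ l).eval ((k : ℝ) + α + β + 1)
        * (ascPochhammer ℝ (k - l)).eval (α + (l : ℝ) + 1)
        / ((l.factorial : ℝ) * ((k - l).factorial : ℝ)))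
      * (C (1 / 2) * (X - 1)) ^ l

/-- Rescaling of a polynomial so that its value at `1` is `1`. -/
def normalizeAtOne (p : ℝ[X]) : ℝ[X] := C (p.eval 1)⁻¹ * p

/-- The Gegenbauer polynomial `P_k^{(n)}` with `P_k^{(n)}(1) = 1`. -/
def gegenbauer (n k : ℕ) : ℝ[X] :=
  normalizeAtOne (jacobi (((n : ℝ) - 3) / 2) (((n : ℝ) - 3) / 2) k)

/-- The adjacent polynomial `P_k^{1,0}` with `P_k^{1,0}(1) = 1`. -/
def adjacent (n k : ℕ) : ℝ[X] :=
  normalizeAtOne (jacobi (((n : ℝ) - 1) / 2) (((n : ℝ) - 3) / 2) k)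

/-- The normalizing constant `γ_n = Γ(n/2) / (√π Γ((n-1)/2))`. -/
def gammaConst (n : ℕ) : ℝ :=
  Real.Gamma ((n : ℝ) / 2) / (Real.sqrt Real.pi * Real.Gamma (((n : ℝ) - 1) / 2))

/-- The probability measure `dμ(t) = γ_n (1 - t²)^{(n-3)/2} dt` on `[-1,1]`. -/
def mu (n : ℕ) : Measure ℝ :=
  (volume.restrict (Set.Icc (-1 : ℝ) 1)).withDensity
    (fun t => ENNReal.ofReal (gammaConst n * (1 - t ^ 2) ^ (((n : ℝ) - 3) / 2)))

/-- The Gegenbauer coefficient `f_k` of `f`; in particular `f_0 = ∫ f dμ`. -/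
def gegenbauerCoeff (n : ℕ) (f : ℝ → ℝ) (k : ℕ) : ℝ :=
  (∫ t, f t * (gegenbauer n k).eval t ∂(mu n)) / ∫ t, ((gegenbauer n k).eval t) ^ 2 ∂(mu n)

/-- The class `F_≥`: `f(t) = ∑ f_k P_k^{(n)}(t)` on `[-1,1]` with `f_k ≥ 0` and `∑ f_k < ∞`. -/
def PosDef (n : ℕ) (f : ℝ → ℝ) : Prop :=
  (∀ k, 0 ≤ gegenbauerCoeff n f k) ∧ Summable (gegenbauerCoeff n f) ∧
    ∀ t ∈ Set.Icc (-1 : ℝ) 1,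
      HasSum (fun k => gegenbauerCoeff n f k * (gegenbauer n k).eval t) (f t)

/-- Polynomials in the class `F_>`: the coefficients `f_k` with `k ≤ deg f` are positive. -/
def StrictPosDef (n : ℕ) (p : ℝ[X]) : Prop :=
  PosDef n (fun t => p.eval t) ∧
    ∀ k ≤ p.natDegree, 0 < gegenbauerCoeff n (fun t => p.eval t) k

/-- Gram-Schmidt: the monic orthogonal polynomials of the bilinear form `(p, q) ↦ L (p * q)`. -/
def monicOrthogonal (L : ℝ[X] → ℝ) (i : ℕ) : ℝ[X] :=
  X ^ i - ∑ j : Fin i,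
    C (L (X ^ i * monicOrthogonal L j) / L (monicOrthogonal L j ^ 2)) * monicOrthogonal L j
termination_by i
decreasing_by all_goals exact j.isLt

/-- Integration against the signed measure
`dν_ℓ(t) = (t - ℓ) dχ(t) = (t - ℓ) (1 - t) dμ(t)`. -/
def nuIntegral (n : ℕ) (ℓ : ℝ) (p : ℝ[X]) : ℝ :=
  ∫ t, p.eval t * ((t - ℓ) * (1 - t)) ∂(mu n)

/-- The polynomial `P_i^{1,ℓ}`: orthogonal with respect to `ν_ℓ`, with value `1` at `1`. -/
def ellPoly (n : ℕ) (ℓ : ℝ) (i : ℕ) : ℝ[X] :=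
  normalizeAtOne (monicOrthogonal (nuIntegral n ℓ) i)

/-- The kernel `R_{k-1}(t, s; ℓ) = ∑_{j<k} r_j P_j^{1,ℓ}(t) P_j^{1,ℓ}(s)` as a polynomial in `t`,
where `r_j = (∫ (P_j^{1,ℓ})² dν_ℓ)⁻¹`. -/
def ellKernel (n k : ℕ) (ℓ s : ℝ) : ℝ[X] :=
  ∑ j ∈ Finset.range k,
    C ((nuIntegral n ℓ (ellPoly n ℓ j ^ 2))⁻¹ * (ellPoly n ℓ j).eval s) * ellPoly n ℓ j

/-- The polynomial `P_{k-1}^{1,ℓ,s}(t) = R_{k-1}(t, s; ℓ) / R_{k-1}(1, s; ℓ)`. -/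
def ellSPoly (n k : ℕ) (ℓ s : ℝ) : ℝ[X] := normalizeAtOne (ellKernel n k ℓ s)

/-- The Levenshtein-type polynomial `f_{2k}(t) = (t - ℓ) (t - s) (P_{k-1}^{1,ℓ,s}(t))²`. -/
def levPoly (n k : ℕ) (ℓ s : ℝ) : ℝ[X] :=
  (X - C ℓ) * (X - C s) * ellSPoly n k ℓ s ^ 2

/-- The smallest real zero of a polynomial. -/
def smallestZero (p : ℝ[X]) : ℝ := sInf {x : ℝ | p.IsRoot x}

/-- The largest real zero of a polynomial. -/
def largestZero (p : ℝ[X]) : ℝ := sSup {x : ℝ | p.IsRoot x}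

/-- The `ℓ`-strengthened Krein condition for `P_0^{1,ℓ}, …, P_k^{1,ℓ}`. -/
def StrengthenedKrein (n k : ℕ) (ℓ : ℝ) : Prop :=
  ∀ i ≤ k, ∀ j ≤ k, ¬(i = k ∧ j = k) →
    StrictPosDef n ((X - C ℓ) * ellPoly n ℓ i * ellPoly n ℓ j)

/-- The spherical codes in `S^{n-1}` all of whose inner products of distinct points lie in
`[ℓ, s]`. -/
def codes (n : ℕ) (ℓ s : ℝ) : Set (Finset (EuclideanSpace ℝ (Fin n))) :=
  {D | D.Nonempty ∧ (∀ x ∈ D, ‖x‖ = 1) ∧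
    ∀ x ∈ D, ∀ y ∈ D, x ≠ y → ℓ ≤ inner ℝ x y ∧ inner ℝ x y ≤ s}

/-- `A(n; [ℓ, s])`, the largest cardinality of a code with inner products in `[ℓ, s]`. -/
def maxCodeSize (n : ℕ) (ℓ s : ℝ) : ℕ∞ := ⨆ D ∈ codes n ℓ s, (D.card : ℕ∞)

/-- The potential energy `E(D; h)`, the sum of `h(⟨x,y⟩)` over ordered pairs of distinct points. -/
def energy {n : ℕ} (D : Finset (EuclideanSpace ℝ (Fin n))) (h : ℝ → ℝ) : ℝ :=
  ∑ x ∈ D, ∑ y ∈ D with x ≠ y, h (inner ℝ x y)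

/-- `E(n, M, ℓ; h)`, the infimum of the energies of the codes of cardinality `M` with inner
products in `[ℓ, 1)`; it is `+∞` if there is no such code. -/
def minEnergy (n : ℕ) (M ℓ : ℝ) (h : ℝ → ℝ) : EReal :=
  ⨅ D ∈ {D | D ∈ codes n ℓ 1 ∧ (D.card : ℝ) = M}, (energy D h : EReal)

/-- The class `G_{n,ℓ;h}` of admissible functions of the Delsarte-Yudin linear program. -/
def yudinClass (n : ℕ) (ℓ : ℝ) (h : ℝ → ℝ) : Set (ℝ → ℝ) :=
  {g | PosDef n g ∧ (∀ t ∈ Set.Ico ℓ 1, g t ≤ h t) ∧ 0 < gegenbauerCoeff n g 0}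

/-- `g = H(f; h)`: `g` has degree less than `deg f` and interpolates `h` (a function on `[-1, 1)`)
at the zeros of `f`, to the order given by their multiplicities. -/
def IsHermiteInterpolant (f : ℝ[X]) (h : ℝ → ℝ) (g : ℝ[X]) : Prop :=
  g.degree < f.degree ∧ ∀ x : ℝ, ∀ j < f.rootMultiplicity x,
    (derivative^[j] g).eval x = iteratedDerivWithin j h (Set.Ico (-1) 1) x

/-- The Radau quadrature with nodes `ℓ = β_0 < β_1 < … < β_{k-1} < β_k = s < β_{k+1} = 1`, where
`β_1, …, β_{k-1}` are the zeros of `P_{k-1}^{1,ℓ,s}`, and positive weights `ρ_0, …, ρ_{k+1}`, exact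
for all polynomials of degree at most `2k`. Only the values at indices `≤ k + 1` matter. -/
structure IsRadauQuadrature (n k : ℕ) (ℓ s : ℝ) (β ρ : ℕ → ℝ) : Prop where
  strictMono : StrictMonoOn β (Set.Iic (k + 1))
  first : β 0 = ℓ
  node_s : β k = s
  last : β (k + 1) = 1
  zeros : ∀ x : ℝ, (ellSPoly n k ℓ s).IsRoot x ↔ ∃ i, 1 ≤ i ∧ i ≤ k - 1 ∧ β i = x
  pos : ∀ i ≤ k + 1, 0 < ρ i
  exact_of_degree : ∀ p : ℝ[X], p.natDegree ≤ 2 * k →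
    ∫ t, p.eval t ∂(mu n) = ∑ i ∈ Finset.range (k + 2), ρ i * p.eval (β i)

end SphericalLP

end

/-!
Both bounds come from linear programming. If a polynomial `g` has nonnegative Gegenbauer
coefficients, then `∑_{x,y ∈ C} g(⟨x,y⟩) ≥ |C|² g₀` for every code `C`, because the Gegenbauer
polynomials are positive definite on the sphere. Comparing the two sides for `g = f_{2k}`, which is
nonpositive on `[ℓ, s]`, bounds `|C|`; comparing them for a `g ≤ h` bounds the energy. So it must be
shown that `f_{2k}` and the Hermite interpolant have nonnegative Gegenbauer coefficients, and that
a quadrature at the interpolation nodes evaluates their means.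

*Positive definiteness* (`gegenbauer_sum_nonneg`). The homogenization of `P_k^{(n)}(⟨x, ·⟩)` is a
harmonic polynomial, by the differential equation of the Gegenbauer polynomials. For the Fischer
inner product, where multiplication by a variable is adjoint to differentiation, these zonal
harmonics have the Gram matrix `P_k^{(n)}(⟨x, y⟩)`, up to a positive factor.

*The signed measure `ν_ℓ`*. Its density changes sign at `ℓ`, but by Gauss quadrature at the zeros of
`P_k^{1,0}` (`exists_isGaussRule`) it acts on polynomials of low degree as a positive discrete
measure, all nodes being to the right of `ℓ`. Hence the `P_i^{1,ℓ}` with `i < k` have their zeros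
between the extreme nodes. The Krein condition for `(i, j) = (k, 0)` makes the leading coefficient of
`P_k^{1,ℓ}` positive, which forces its largest zero to be less than `1`, so that `P_k^{1,ℓ}(s) < 0`
(`IsGaussRule.monicEll_last`). By orthogonality, `(t - s) R_{k-1}(t, s; ℓ)` is then a positive
combination of `P_k^{1,ℓ}` and `P_{k-1}^{1,ℓ}`. This gives the nodes `β_i` and the quadrature, with
weights that are positive by a choice of test polynomials (`IsGaussRule.exists_radau`).

*Nonnegative coefficients* (`IsGaussRule.posDef_nodeProd_mul`). The products
`∏_{1 ≤ i ≤ m} (X - β_i)` are nonnegative combinations of the `P_j^{1,ℓ}`, by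
`discreteFunctional_mul_prod_nonneg`. So `(X - ℓ)` times a product of two of them is a nonnegative
combination of the polynomials in the Krein condition. Among these are `f_{2k}` and, for the nodes
`β₀, β₁, β₁, …, β_k, β_k`, the Newton products, up to positive factors.

*Interpolation* (`exists_hermite`). By Bernstein's theorem, an absolutely monotone `h` is a power
series in `t + 1` with nonnegative coefficients. This property passes to difference quotients, so
all coefficients of the Newton interpolation of `h` are nonnegative, and the error `h - g` is the
nodal polynomial, which is nonnegative on `[ℓ, 1)`, times a nonnegative function.
-/

noncomputable section

namespace SphericalLP

/-! ### The measure `μ` and its moments -/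

lemma integrableOn_beta {a b : ℝ} (ha : 0 < a) (hb : 0 < b) :
    IntervalIntegrable (fun x : ℝ => x ^ (b - 1) * (1 - x) ^ (a - 1)) volume 0 1 ∧
      ∫ x in (0 : ℝ)..1, x ^ (b - 1) * (1 - x) ^ (a - 1) = ProbabilityTheory.beta b a := by
  have hc := Complex.betaIntegral_convergent (u := (b : ℂ)) (v := (a : ℂ)) (by simpa) (by simpa)
  have hcongr : ∀ x ∈ Set.Ioc (0 : ℝ) 1, x ^ (b - 1) * (1 - x) ^ (a - 1)
      = RCLike.re ((x : ℂ) ^ ((b : ℂ) - 1) * (1 - (x : ℂ)) ^ ((a : ℂ) - 1)) := by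
    intro x hx
    norm_cast
    rw [← Complex.ofReal_cpow, ← Complex.ofReal_cpow, RCLike.re_to_complex,
      Complex.re_mul_ofReal, Complex.ofReal_re]
    all_goals linarith [hx.1, hx.2]
  rw [intervalIntegrable_iff_integrableOn_Ioc_of_le (by simp)] at hc
  constructor
  · rw [intervalIntegrable_iff_integrableOn_Ioc_of_le (by simp)]
    exact (integrableOn_congr_fun hcongr measurableSet_Ioc).2 hc.re
  · rw [ProbabilityTheory.beta_eq_betaIntegralReal b a hb ha, Complex.betaIntegral,
      intervalIntegral.integral_of_le (by norm_num), intervalIntegral.integral_of_le (by norm_num),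
      ← RCLike.re_to_complex, ← integral_re hc]
    exact setIntegral_congr_fun measurableSet_Ioc hcongr

lemma integrableOn_jacobiWeight {a b : ℝ} (ha : 0 < a) (hb : 0 < b) :
    IntegrableOn (fun t : ℝ => (1 - t) ^ (a - 1) * (1 + t) ^ (b - 1)) (Set.Icc (-1) 1) ∧
      ∫ t in Set.Icc (-1 : ℝ) 1, (1 - t) ^ (a - 1) * (1 + t) ^ (b - 1)
        = 2 ^ (a + b - 1) * ProbabilityTheory.beta b a := by
  obtain ⟨hi, he⟩ := integrableOn_beta ha hb
  have hcongr : ∀ t ∈ Set.Ioc (-1 : ℝ) 1, (1 - t) ^ (a - 1) * (1 + t) ^ (b - 1)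
      = 2 ^ (a + b - 2) * ((t / 2 + 1 / 2) ^ (b - 1) * (1 - (t / 2 + 1 / 2)) ^ (a - 1)) := by
    intro t ht
    have h1 : 1 - t = 2 * (1 - (t / 2 + 1 / 2)) := by ring
    have h2 : 1 + t = 2 * (t / 2 + 1 / 2) := by ring
    rw [h1, h2, Real.mul_rpow (by norm_num) (by linarith [ht.2]),
      Real.mul_rpow (by norm_num) (by linarith [ht.1]),
      show a + b - 2 = (a - 1) + (b - 1) by ring, Real.rpow_add (by norm_num)]
    ring
  constructor
  · rw [integrableOn_Icc_iff_integrableOn_Ioc, integrableOn_congr_fun hcongr measurableSet_Ioc,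
      ← intervalIntegrable_iff_integrableOn_Ioc_of_le (by norm_num)]
    apply IntervalIntegrable.const_mul
    have := (hi.comp_add_right (1 / 2)).comp_mul_left (c := 1 / 2)
    norm_num at this
    refine this.congr fun t _ => ?_
    rw [show t / 2 = 1 / 2 * t by ring]
  · rw [integral_Icc_eq_integral_Ioc, setIntegral_congr_fun measurableSet_Ioc hcongr,
      ← intervalIntegral.integral_of_le (by norm_num), intervalIntegral.integral_const_mul,
      intervalIntegral.integral_comp_div_add (fun x : ℝ => x ^ (b - 1) * (1 - x) ^ (a - 1))
        two_ne_zero (1 / 2)]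
    norm_num at he ⊢
    rw [he, show a + b - 1 = (a + b - 2) + 1 by ring, Real.rpow_add_one (by norm_num)]
    ring

lemma gammaConst_pos {n : ℕ} (hn : 2 ≤ n) : 0 < gammaConst n := by
  have : (2 : ℝ) ≤ n := by exact_mod_cast hn
  have h1 := Real.Gamma_pos_of_pos (s := (n : ℝ) / 2) (by linarith)
  have h2 := Real.Gamma_pos_of_pos (s := ((n : ℝ) - 1) / 2) (by linarith)
  have := Real.pi_pos
  unfold gammaConst
  positivity

lemma measurable_muDensity (n : ℕ) : Measurable
    (fun t : ℝ => ENNReal.ofReal (gammaConst n * (1 - t ^ 2) ^ (((n : ℝ) - 3) / 2))) := by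
  fun_prop

lemma jacobiWeight_mul_pow {n : ℕ} (i j : ℕ) {t : ℝ} (ht : t ∈ Set.Ioo (-1 : ℝ) 1) :
    (1 - t ^ 2) ^ (((n : ℝ) - 3) / 2) * ((1 - t) ^ i * (1 + t) ^ j)
      = (1 - t) ^ ((((n : ℝ) - 1) / 2 + i) - 1) * (1 + t) ^ ((((n : ℝ) - 1) / 2 + j) - 1) := by
  have h1 : 0 < 1 - t := by linarith [ht.2]
  have h2 : 0 < 1 + t := by linarith [ht.1]
  rw [show 1 - t ^ 2 = (1 - t) * (1 + t) by ring, Real.mul_rpow h1.le h2.le,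
    ← Real.rpow_natCast (1 - t) i, ← Real.rpow_natCast (1 + t) j,
    mul_mul_mul_comm, ← Real.rpow_add h1, ← Real.rpow_add h2]
  congr 2 <;> ring

/-- The moments of `μ` in the basis `(1 - t)^i (1 + t)^j`, a beta integral. -/
lemma integral_mu_pow_mul_pow {n : ℕ} (hn : 2 ≤ n) (i j : ℕ) :
    Integrable (fun t : ℝ => (1 - t) ^ i * (1 + t) ^ j) (mu n) ∧
      ∫ t, (1 - t) ^ i * (1 + t) ^ j ∂(mu n)
        = gammaConst n * (2 ^ ((n : ℝ) - 2 + i + j) *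
          (Real.Gamma (((n : ℝ) - 1) / 2 + j) * Real.Gamma (((n : ℝ) - 1) / 2 + i) /
            Real.Gamma ((n : ℝ) - 1 + i + j))) := by
  have hn' : (2 : ℝ) ≤ n := by exact_mod_cast hn
  have hγ := gammaConst_pos hn
  obtain ⟨hi, he⟩ := integrableOn_jacobiWeight (a := ((n : ℝ) - 1) / 2 + i)
    (b := ((n : ℝ) - 1) / 2 + j) (by have := i.cast_nonneg (α := ℝ); linarith)
    (by have := j.cast_nonneg (α := ℝ); linarith)
  have hcongr : ∀ t ∈ Set.Ioo (-1 : ℝ) 1,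
      (ENNReal.ofReal (gammaConst n * (1 - t ^ 2) ^ (((n : ℝ) - 3) / 2))).toReal •
        ((1 - t) ^ i * (1 + t) ^ j)
      = gammaConst n * ((1 - t) ^ ((((n : ℝ) - 1) / 2 + i) - 1)
        * (1 + t) ^ ((((n : ℝ) - 1) / 2 + j) - 1)) := by
    intro t ht
    have : 0 < 1 - t ^ 2 := by nlinarith [ht.1, ht.2]
    rw [ENNReal.toReal_ofReal (by positivity), smul_eq_mul, mul_assoc, jacobiWeight_mul_pow i j ht]
  constructor
  · rw [mu, integrable_withDensity_iff_integrable_smul' (measurable_muDensity n) (by simp)]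
    change IntegrableOn _ _ _
    rw [integrableOn_Icc_iff_integrableOn_Ioo, integrableOn_congr_fun hcongr measurableSet_Ioo,
      ← integrableOn_Icc_iff_integrableOn_Ioo]
    exact hi.const_mul _
  · rw [mu, integral_withDensity_eq_integral_toReal_smul (measurable_muDensity n) (by simp),
      integral_Icc_eq_integral_Ioo, setIntegral_congr_fun measurableSet_Ioo hcongr,
      ← integral_Icc_eq_integral_Ioo, integral_const_mul, he, ProbabilityTheory.beta]
    congr 3 <;> [skip; congr 1] <;> ring

lemma isProbabilityMeasure_mu {n : ℕ} (hn : 2 ≤ n) : IsProbabilityMeasure (mu n) := by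
  have hn' : (2 : ℝ) ≤ n := by exact_mod_cast hn
  obtain ⟨hi, he⟩ := integral_mu_pow_mul_pow hn 0 0
  simp only [pow_zero, mul_one, Nat.cast_zero, add_zero, gammaConst] at hi he
  have hfin : IsFiniteMeasure (mu n) := by
    rw [integrable_const_iff] at hi
    simpa using hi
  -- the duplication formula for `Γ`
  have hdup := Real.Gamma_mul_Gamma_add_half (((n : ℝ) - 1) / 2)
  rw [show ((n : ℝ) - 1) / 2 + 1 / 2 = n / 2 by ring, show 2 * (((n : ℝ) - 1) / 2) = n - 1 by ring,
    show 1 - ((n : ℝ) - 1) = -(n - 2) by ring, Real.rpow_neg (by norm_num)] at hdup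
  have h1 := Real.Gamma_pos_of_pos (s := (n : ℝ) / 2) (by linarith)
  have h2 := Real.Gamma_pos_of_pos (s := ((n : ℝ) - 1) / 2) (by linarith)
  have h3 := Real.Gamma_pos_of_pos (s := (n : ℝ) - 1) (by linarith)
  have h4 : (0 : ℝ) < 2 ^ ((n : ℝ) - 2) := by positivity
  have h5 : 0 < √Real.pi := Real.sqrt_pos.2 Real.pi_pos
  refine ⟨?_⟩
  rw [integral_const, smul_eq_mul, mul_one] at he
  have : (mu n).real Set.univ = 1 := by
    rw [he]
    field_simp at hdup ⊢
    linarith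
  rw [← ENNReal.toReal_eq_one_iff]
  exact this

lemma ae_mu_mem_Icc (n : ℕ) : ∀ᵐ t ∂(mu n), t ∈ Set.Icc (-1 : ℝ) 1 :=
  (withDensity_absolutelyContinuous _ _).ae_le (ae_restrict_mem measurableSet_Icc)

lemma integrable_eval_mu {n : ℕ} (hn : 2 ≤ n) (p : ℝ[X]) :
    Integrable (fun t => p.eval t) (mu n) := by
  have := isProbabilityMeasure_mu hn
  obtain ⟨c, hc⟩ := isCompact_Icc.exists_bound_of_continuousOn
    (p.continuous.continuousOn (s := Set.Icc (-1 : ℝ) 1))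
  exact Integrable.of_bound (by fun_prop) c ((ae_mu_mem_Icc n).mono fun t ht => hc t ht)

/-- Integration of polynomials against `μ`, as a linear functional. -/
def mean {n : ℕ} (hn : 2 ≤ n) : ℝ[X] →ₗ[ℝ] ℝ where
  toFun p := ∫ t, p.eval t ∂(mu n)
  map_add' p q := by
    simp only [eval_add]
    exact integral_add (integrable_eval_mu hn p) (integrable_eval_mu hn q)
  map_smul' c p := by
    simp only [eval_smul, smul_eq_mul, RingHom.id_apply]
    exact integral_const_mul _ _

lemma mean_apply {n : ℕ} (hn : 2 ≤ n) (p : ℝ[X]) : mean hn p = ∫ t, p.eval t ∂(mu n) := rfl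

lemma mean_one {n : ℕ} (hn : 2 ≤ n) : mean hn 1 = 1 := by
  have := isProbabilityMeasure_mu hn
  simp [mean_apply]

lemma mean_pos {n : ℕ} (hn : 2 ≤ n) {p : ℝ[X]} (hp : p ≠ 0)
    (h : ∀ t ∈ Set.Icc (-1 : ℝ) 1, 0 ≤ p.eval t) : 0 < mean hn p := by
  have := isProbabilityMeasure_mu hn
  have hae : 0 ≤ᵐ[mu n] fun t => p.eval t := (ae_mu_mem_Icc n).mono fun t ht => h t ht
  refine lt_of_le_of_ne (integral_nonneg_of_ae hae) fun h0 => ?_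
  have hz := (integral_eq_zero_iff_of_nonneg_ae hae (integrable_eval_mu hn p)).1 h0.symm
  have hnull : mu n {t | p.IsRoot t} = 0 := by
    have hfin : {t | p.IsRoot t}.Finite := finite_setOfPred_isRoot hp
    exact withDensity_absolutelyContinuous _ _
      (Measure.restrict_le_self.absolutelyContinuous (hfin.measure_zero volume))
  have huniv : mu n Set.univ = 0 := by
    refine measure_mono_null (t := {t | p.IsRoot t} ∪ {t | ¬ p.eval t = 0}) ?_
      (measure_union_null hnull ?_)
    · intro t _
      exact em _
    · exact hz
  simp at huniv

/-! ### Jacobi polynomials: degree, normalization and orthogonality -/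

lemma ascPochhammer_eval_mul_Gamma {x : ℝ} (hx : 0 < x) (r : ℕ) :
    (ascPochhammer ℝ r).eval x * Real.Gamma x = Real.Gamma (x + r) := by
  induction r with
  | zero => simp
  | succ r ih =>
    rw [ascPochhammer_succ_eval, mul_right_comm, ih, Nat.cast_succ, ← add_assoc,
      Real.Gamma_add_one (by positivity)]
    ring

/-- The coefficient of `((t - 1) / 2)^l` in the Jacobi polynomial `P_k^{(α,β)}`. -/
def jacobiCoeff (α β : ℝ) (k l : ℕ) : ℝ :=
  (ascPochhammer ℝ l).eval ((k : ℝ) + α + β + 1) * (ascPochhammer ℝ (k - l)).eval (α + (l : ℝ) + 1)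
    / ((l.factorial : ℝ) * ((k - l).factorial : ℝ))

lemma jacobi_eq_sum (α β : ℝ) (k : ℕ) :
    jacobi α β k = ∑ l ∈ Finset.range (k + 1),
      C (jacobiCoeff α β k l) * (C (1 / 2) * (X - 1)) ^ l := rfl

lemma jacobiCoeff_pos {α β : ℝ} (hα : -1 < α) (hβ : -1 < β) {k : ℕ} (hk : k ≠ 0) (l : ℕ) :
    0 < jacobiCoeff α β k l := by
  have hk1 : (1 : ℝ) ≤ k := by exact_mod_cast Nat.one_le_iff_ne_zero.2 hk
  have h1 := ascPochhammer_pos l ((k : ℝ) + α + β + 1) (by linarith)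
  have h2 := ascPochhammer_pos (k - l) (α + (l : ℝ) + 1) (by
    have := l.cast_nonneg (α := ℝ); linarith)
  unfold jacobiCoeff
  positivity

lemma jacobi_zero (α β : ℝ) : jacobi α β 0 = 1 := by
  simp [jacobi]

lemma jacobi_eval_one_pos {α β : ℝ} (hα : -1 < α) (k : ℕ) : 0 < (jacobi α β k).eval 1 := by
  have h : (jacobi α β k).eval 1 = jacobiCoeff α β k 0 := by
    rw [jacobi_eq_sum, eval_finsetSum, Finset.sum_range_succ']
    simp
  have h2 := ascPochhammer_pos k (α + 1) (by linarith)
  rw [h, jacobiCoeff]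
  simp only [ascPochhammer_zero, eval_one, Nat.cast_zero, add_zero, tsub_zero, one_mul,
    Nat.factorial_zero, Nat.cast_one]
  positivity

lemma jacobi_natDegree_le (α β : ℝ) (k : ℕ) : (jacobi α β k).natDegree ≤ k := by
  rw [jacobi_eq_sum]
  refine natDegree_sum_le_of_forall_le _ _ fun l hl => ?_
  refine (natDegree_C_mul_le _ _).trans ((natDegree_pow_le_of_le l (m := 1) ?_).trans ?_)
  · exact (natDegree_C_mul_le _ _).trans (natDegree_X_sub_C_le 1)
  · have := Finset.mem_range.1 hl
    omega

lemma jacobi_coeff_self_pos {α β : ℝ} (hα : -1 < α) (hβ : -1 < β) (k : ℕ) :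
    0 < (jacobi α β k).coeff k := by
  rcases eq_or_ne k 0 with rfl | hk
  · simp [jacobi_zero]
  have hmonic : ∀ l, ((X - 1 : ℝ[X]) ^ l).Monic := fun l => (monic_X_sub_C (1 : ℝ)).pow l
  have hdeg : ∀ l, ((X - 1 : ℝ[X]) ^ l).natDegree = l := fun l => by
    have := (monic_X_sub_C (1 : ℝ)).natDegree_pow l
    rwa [natDegree_X_sub_C, mul_one, map_one] at this
  have h : (jacobi α β k).coeff k = jacobiCoeff α β k k * (1 / 2) ^ k := by
    rw [jacobi_eq_sum, finsetSum_coeff, Finset.sum_range_succ, Finset.sum_eq_zero, zero_add]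
    · rw [mul_pow, ← C_pow, coeff_C_mul, coeff_C_mul]
      have := (hmonic k).coeff_natDegree
      rw [hdeg] at this
      rw [this, mul_one]
    · intro l hl
      rw [mul_pow, ← C_pow, coeff_C_mul, coeff_C_mul,
        coeff_eq_zero_of_natDegree_lt (by rw [hdeg]; exact Finset.mem_range.1 hl)]
      simp
  rw [h]
  have := jacobiCoeff_pos hα hβ hk k
  positivity

/-- The `k`-th finite difference of a polynomial of degree less than `k` vanishes. -/
lemma sum_alternating_div_factorial_eq_zero {P : ℝ[X]} {k : ℕ} (hP : P.natDegree < k) :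
    ∑ l ∈ Finset.range (k + 1),
      (-1 : ℝ) ^ l / ((l.factorial : ℝ) * ((k - l).factorial : ℝ)) * P.eval (l : ℝ) = 0 := by
  have h := congrFun (Polynomial.fwdDiff_iter_eq_zero_of_degree_lt hP) 0
  rw [fwdDiff_iter_eq_sum_shift] at h
  have h2 : ((-1 : ℝ) ^ k / k.factorial) * ∑ l ∈ Finset.range (k + 1),
      (((-1 : ℤ) ^ (k - l) * (k.choose l : ℤ)) • P.eval (0 + l • (1 : ℝ))) = 0 := by
    rw [h]; simp
  rw [Finset.mul_sum] at h2
  rw [← h2]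
  refine Finset.sum_congr rfl fun l hl => ?_
  have hl' : l ≤ k := Nat.lt_succ_iff.1 (Finset.mem_range.1 hl)
  have hsign : (-1 : ℝ) ^ k * (-1) ^ (k - l) = (-1) ^ l := by
    obtain ⟨m, rfl⟩ := Nat.exists_eq_add_of_le hl'
    rw [Nat.add_sub_cancel_left, pow_add, mul_assoc, ← mul_pow]
    simp
  rw [zsmul_eq_mul, ← hsign]
  push_cast
  rw [Nat.cast_choose ℝ hl']
  simp only [zero_add, nsmul_eq_mul, mul_one]
  have := k.factorial_ne_zero
  field_simp

/-- Orthogonality of the Jacobi polynomials, for any functional with the moments of the Jacobi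
weight. Tested against `(1 + t)^m`, it says that a `k`-th finite difference of a polynomial of
degree `k - 1 - m` is zero. -/
lemma jacobi_orthogonal {α β K : ℝ} (hα : -1 < α) (hβ : -1 < β) (L : ℝ[X] →ₗ[ℝ] ℝ)
    (hL : ∀ i j : ℕ, L ((1 - X) ^ i * (1 + X) ^ j) = K * (2 ^ (i + j) *
      (Real.Gamma (β + 1 + j) * Real.Gamma (α + 1 + i) / Real.Gamma (α + β + 2 + i + j))))
    {k : ℕ} {q : ℝ[X]} (hq : q.natDegree < k) : L (jacobi α β k * q) = 0 := by
  have key : ∀ m < k, L (jacobi α β k * (1 + X) ^ m) = 0 := by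
    intro m hm
    have hk1 : (1 : ℝ) ≤ k := by exact_mod_cast (by omega : 1 ≤ k)
    have hm0 := m.cast_nonneg (α := ℝ)
    set P : ℝ[X] := (ascPochhammer ℝ (k - 1 - m)).comp (X + C (α + β + 2 + m)) with hP
    have hPdeg : P.natDegree < k := by
      rw [hP, natDegree_comp, ascPochhammer_natDegree, natDegree_X_add_C]
      omega
    have hΓ := Real.Gamma_pos_of_pos (s := (k : ℝ) + α + β + 1) (by linarith)
    rw [jacobi_eq_sum, Finset.sum_mul, map_sum]
    rw [← mul_zero (K * 2 ^ m * Real.Gamma (β + 1 + m) * Real.Gamma (α + k + 1)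
        / Real.Gamma ((k : ℝ) + α + β + 1)),
      ← sum_alternating_div_factorial_eq_zero hPdeg, Finset.mul_sum]
    refine Finset.sum_congr rfl fun l hl => ?_
    have hl' : l ≤ k := Nat.lt_succ_iff.1 (Finset.mem_range.1 hl)
    have hl0 := l.cast_nonneg (α := ℝ)
    have e1 : C (jacobiCoeff α β k l) * (C (1 / 2) * (X - 1)) ^ l * (1 + X) ^ m
        = (jacobiCoeff α β k l * (-1 / 2) ^ l) • ((1 - X) ^ l * (1 + X) ^ m) := by
      rw [smul_eq_C_mul, C_mul, C_pow, show (C (1 / 2) * (X - 1) : ℝ[X]) = C (-1 / 2) * (1 - X) by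
        rw [neg_div, C_neg]; ring, mul_pow]
      ring
    rw [e1, map_smul, smul_eq_mul, hL]
    have g1 := ascPochhammer_eval_mul_Gamma (x := α + l + 1) (by linarith) (k - l)
    rw [show α + l + 1 + ((k - l : ℕ) : ℝ) = α + k + 1 by rw [Nat.cast_sub hl']; ring] at g1
    have g2 := ascPochhammer_eval_mul_Gamma (x := (k : ℝ) + α + β + 1) (by linarith) l
    have g3 := ascPochhammer_eval_mul_Gamma (x := α + β + 2 + l + m) (by linarith) (k - 1 - m)
    rw [show α + β + 2 + l + m + ((k - 1 - m : ℕ) : ℝ) = k + α + β + 1 + l by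
      rw [Nat.cast_sub (by omega), Nat.cast_sub (by omega)]; push_cast; ring] at g3
    have hPe : P.eval (l : ℝ) = (ascPochhammer ℝ (k - 1 - m)).eval (α + β + 2 + l + m) := by
      rw [hP, eval_comp]; congr 1; simp; ring
    have hΓ2 := Real.Gamma_pos_of_pos (s := α + β + 2 + l + m) (by linarith)
    have hΓ1 := Real.Gamma_pos_of_pos (s := α + l + 1) (by linarith)
    rw [hPe, ← g1, jacobiCoeff, show α + 1 + (l : ℝ) = α + l + 1 by ring,
      eq_div_of_mul_eq hΓ2.ne' g3, ← g2, pow_add, div_pow]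
    field_simp
  have hsum : q = ∑ m ∈ Finset.range k, C ((q.comp (X - 1)).coeff m) * (1 + X) ^ m := by
    have h1 : q = (q.comp (X - 1)).comp (1 + X) := by
      rw [comp_assoc]; simp
    have h2 : (q.comp (X - 1)).natDegree < k := by
      rw [natDegree_comp, show (X - 1 : ℝ[X]) = X - C 1 by simp, natDegree_X_sub_C, mul_one]
      exact hq
    conv_lhs => rw [h1, as_sum_range_C_mul_X_pow' (q.comp (X - 1)) h2]
    simp
  rw [hsum, Finset.mul_sum, map_sum]
  refine Finset.sum_eq_zero fun m hm => ?_
  rw [mul_left_comm, ← smul_eq_C_mul, map_smul, key m (Finset.mem_range.1 hm), smul_zero]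

lemma normalizeAtOne_eval_one {p : ℝ[X]} (hp : p.eval 1 ≠ 0) : (normalizeAtOne p).eval 1 = 1 := by
  simp [normalizeAtOne, hp]

lemma gegenbauer_zero (n : ℕ) : gegenbauer n 0 = 1 := by
  simp [gegenbauer, jacobi_zero, normalizeAtOne]

lemma gegenbauer_eq {n : ℕ} (k : ℕ) (hn : 2 ≤ n) : ∃ c : ℝ, 0 < c ∧
    gegenbauer n k = C c * jacobi (((n : ℝ) - 3) / 2) (((n : ℝ) - 3) / 2) k := by
  have hn' : (2 : ℝ) ≤ n := by exact_mod_cast hn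
  exact ⟨_, inv_pos.2 (jacobi_eval_one_pos (by linarith) k), rfl⟩

lemma gegenbauer_natDegree_le (n k : ℕ) : (gegenbauer n k).natDegree ≤ k :=
  (natDegree_C_mul_le _ _).trans (jacobi_natDegree_le _ _ _)

lemma gegenbauer_coeff_self_pos {n : ℕ} (hn : 2 ≤ n) (k : ℕ) : 0 < (gegenbauer n k).coeff k := by
  have hn' : (2 : ℝ) ≤ n := by exact_mod_cast hn
  obtain ⟨c, hc, h⟩ := gegenbauer_eq k hn
  rw [h, coeff_C_mul]
  exact mul_pos hc (jacobi_coeff_self_pos (by linarith) (by linarith) k)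

lemma gegenbauer_eval_one {n : ℕ} (hn : 2 ≤ n) (k : ℕ) : (gegenbauer n k).eval 1 = 1 := by
  have hn' : (2 : ℝ) ≤ n := by exact_mod_cast hn
  exact normalizeAtOne_eval_one (jacobi_eval_one_pos (by linarith) k).ne'

lemma mean_moment {n : ℕ} (hn : 2 ≤ n) (i j : ℕ) :
    mean hn ((1 - X) ^ i * (1 + X) ^ j) = gammaConst n * 2 ^ ((n : ℝ) - 2) * (2 ^ (i + j) *
      (Real.Gamma (((n : ℝ) - 1) / 2 + j) * Real.Gamma (((n : ℝ) - 1) / 2 + i) /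
            Real.Gamma ((n : ℝ) - 1 + i + j))) := by
  rw [mean_apply]
  simp only [eval_mul, eval_pow, eval_sub, eval_add, eval_one, eval_X]
  rw [(integral_mu_pow_mul_pow hn i j).2, Real.rpow_add (by norm_num), Real.rpow_add (by norm_num),
    Real.rpow_natCast, Real.rpow_natCast, pow_add]
  ring

lemma gegenbauer_orthogonal {n : ℕ} (hn : 2 ≤ n) {k : ℕ} {q : ℝ[X]} (hq : q.natDegree < k) :
    mean hn (gegenbauer n k * q) = 0 := by
  have hn' : (2 : ℝ) ≤ n := by exact_mod_cast hn
  rw [gegenbauer, normalizeAtOne, mul_assoc, ← smul_eq_C_mul, map_smul,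
    jacobi_orthogonal (K := gammaConst n * 2 ^ ((n : ℝ) - 2)) (by linarith) (by linarith)
      (mean hn) (fun i j => ?_) hq, smul_zero]
  rw [mean_moment]
  congr 3 <;> [congr 1; skip] <;> congr 1 <;> ring

lemma adjacent_orthogonal {n : ℕ} (hn : 2 ≤ n) {k : ℕ} {q : ℝ[X]} (hq : q.natDegree < k) :
    mean hn ((1 - X) * (adjacent n k * q)) = 0 := by
  have hn' : (2 : ℝ) ≤ n := by exact_mod_cast hn
  rw [adjacent, normalizeAtOne, mul_assoc, ← smul_eq_C_mul, mul_smul_comm, map_smul]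
  have := jacobi_orthogonal (K := 2 * (gammaConst n * 2 ^ ((n : ℝ) - 2)))
    (α := ((n : ℝ) - 1) / 2) (β := ((n : ℝ) - 3) / 2) (by linarith) (by linarith)
    ((mean hn).comp (LinearMap.mulLeft ℝ (1 - X))) (fun i j => ?_) hq
  · rw [LinearMap.comp_apply, LinearMap.mulLeft_apply] at this
    rw [this, smul_zero]
  · rw [LinearMap.comp_apply, LinearMap.mulLeft_apply, ← mul_assoc, ← pow_succ', mean_moment,
      Nat.cast_succ, show ((n : ℝ) - 3) / 2 + 1 + j = ((n : ℝ) - 1) / 2 + j by ring,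
      show ((n : ℝ) - 1) / 2 + 1 + i = ((n : ℝ) - 1) / 2 + (i + 1) by ring,
      show ((n : ℝ) - 1) / 2 + ((n : ℝ) - 3) / 2 + 2 + i + j = (n : ℝ) - 1 + (i + 1) + j by ring,
      show i + 1 + j = i + j + 1 by ring, pow_succ]
    ring

lemma adjacent_eval_one {n : ℕ} (hn : 2 ≤ n) (k : ℕ) : (adjacent n k).eval 1 = 1 := by
  have hn' : (2 : ℝ) ≤ n := by exact_mod_cast hn
  exact normalizeAtOne_eval_one (jacobi_eval_one_pos (by linarith) k).ne'

lemma adjacent_natDegree_le (n k : ℕ) : (adjacent n k).natDegree ≤ k :=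
  (natDegree_C_mul_le _ _).trans (jacobi_natDegree_le _ _ _)

/-! ### The differential equation of the Gegenbauer polynomials -/

/-- The hypergeometric differential equation behind `jacobi α α k`, in the variable
`y = (t - 1) / 2`. -/
lemma jacobiCoeff_ode (α : ℝ) (k : ℕ) :
    let p : ℝ[X] := ∑ l ∈ Finset.range (k + 1), C (jacobiCoeff α α k l) * X ^ l
    X * (1 + X) * derivative (derivative p) + C (α + 1) * (1 + 2 * X) * derivative p
      = C ((k : ℝ) * (k + 2 * α + 1)) * p := by
  intro p
  have hc : ∀ l, p.coeff l = if l ≤ k then jacobiCoeff α α k l else 0 := by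
    intro l
    simp only [p, finsetSum_coeff, coeff_C_mul, coeff_X_pow, mul_ite, mul_one, mul_zero,
      Finset.sum_ite_eq, Finset.mem_range, Nat.lt_succ_iff]
  -- the two-term recursion of the hypergeometric coefficients
  have hrec : ∀ l : ℕ, ((l : ℝ) + 1) * (l + α + 1) * p.coeff (l + 1)
      = ((k : ℝ) - l) * (k + l + 2 * α + 1) * p.coeff l := by
    intro l
    rw [hc, hc]
    rcases lt_trichotomy l k with h | rfl | h
    · rw [if_pos (by omega : l + 1 ≤ k), if_pos h.le, jacobiCoeff, jacobiCoeff]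
      obtain ⟨d, rfl⟩ := Nat.exists_eq_add_of_lt h
      rw [show l + d + 1 - (l + 1) = d by omega, show l + d + 1 - l = d + 1 by omega,
        ascPochhammer_succ_eval, ascPochhammer_succ_left, eval_mul, eval_comp,
        Nat.factorial_succ, Nat.factorial_succ]
      have h1 := l.factorial_pos
      have h2 := d.factorial_pos
      simp only [eval_X, eval_add, eval_one]
      push_cast
      field_simp
      rw [show α + ((l : ℝ) + 1) + 1 = α + l + 1 + 1 by ring]
      ring
    · simp
    · rw [if_neg (by omega), if_neg (by omega)]; simp
  have hX : X * (1 + X) * derivative (derivative p) + C (α + 1) * (1 + 2 * X) * derivative p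
      = X * derivative (derivative p) + X ^ 2 * derivative (derivative p)
        + C (α + 1) * derivative p + C (2 * (α + 1)) * (X * derivative p) := by
    rw [C_mul]; simp only [map_ofNat]; ring
  rw [hX]
  ext l
  simp only [coeff_add, coeff_C_mul]
  rcases l with _ | _ | l
  · have := hrec 0
    simp only [coeff_derivative, mul_coeff_zero, coeff_X_zero, pow_two] at this ⊢
    push_cast at this ⊢
    linarith
  · have := hrec 1
    simp only [pow_two, mul_assoc, coeff_X_mul, mul_coeff_zero, coeff_X_zero, coeff_derivative]
      at this ⊢
    push_cast at this ⊢
    linarith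
  · have := hrec (l + 2)
    simp only [pow_two, mul_assoc, coeff_X_mul, coeff_derivative] at this ⊢
    push_cast at this ⊢
    linarith

lemma jacobi_ode (α : ℝ) (k : ℕ) :
    (1 - X ^ 2) * derivative (derivative (jacobi α α k))
        + C ((k : ℝ) * (k + 2 * α + 1)) * jacobi α α k
      = C (2 * α + 2) * X * derivative (jacobi α α k) := by
  have h := jacobiCoeff_ode α k
  set p : ℝ[X] := ∑ l ∈ Finset.range (k + 1), C (jacobiCoeff α α k l) * X ^ l with hp
  have hJ : jacobi α α k = p.comp (C (1 / 2) * (X - 1)) := by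
    rw [jacobi_eq_sum, hp]; simp
  have h' := congrArg (fun q => q.comp (C (1 / 2) * (X - 1))) h
  have hY : derivative (C (1 / 2) * (X - 1) : ℝ[X]) = C (1 / 2) := by simp
  simp only [mul_comp, add_comp, X_comp, C_comp, one_comp, ofNat_comp] at h'
  rw [hJ, derivative_comp, hY, derivative_mul, derivative_C, derivative_comp, hY]
  have h2 : (C (1 / 2) : ℝ[X]) * 2 = 1 := by
    rw [show (2 : ℝ[X]) = C 2 from rfl, ← C_mul]; norm_num
  have h3 : (C (2 * α + 2) : ℝ[X]) = 2 * C (α + 1) := by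
    rw [show (2 : ℝ[X]) = C 2 from rfl, ← C_mul]; ring_nf
  rw [h3]
  set D2 := (derivative (derivative p)).comp (C (1 / 2) * (X - 1))
  set D1 := (derivative p).comp (C (1 / 2) * (X - 1))
  rw [← h']
  linear_combination
    (C (1 / 2) * D2 - X * C (1 / 2) * D2 - D1 * C (α + 1)) * h2

/-- Comparison of coefficients in the Gegenbauer differential equation. -/
lemma gegenbauer_coeff_rec {n : ℕ} (hn : 2 ≤ n) (k i : ℕ) :
    ((i : ℝ) + 2) * (i + 1) * (gegenbauer n k).coeff (i + 2)
      = ((i : ℝ) * (i + n - 2) - k * (k + n - 2)) * (gegenbauer n k).coeff i := by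
  have hn' : (2 : ℝ) ≤ n := by exact_mod_cast hn
  obtain ⟨c, -, hG⟩ := gegenbauer_eq k hn
  have hode := jacobi_ode (((n : ℝ) - 3) / 2) k
  set J := jacobi (((n : ℝ) - 3) / 2) (((n : ℝ) - 3) / 2) k
  have h : derivative (derivative J) - X ^ 2 * derivative (derivative J)
      + C ((k : ℝ) * (k + 2 * (((n : ℝ) - 3) / 2) + 1)) * J
      = C (2 * (((n : ℝ) - 3) / 2) + 2) * (X * derivative J) := by
    rw [← mul_assoc, ← hode]; ring
  have hi := congrArg (fun q => coeff q i) h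
  have key : ((i : ℝ) + 2) * (i + 1) * J.coeff (i + 2)
      = ((i : ℝ) * (i + n - 2) - k * (k + n - 2)) * J.coeff i := by
    simp only [coeff_add, coeff_sub, coeff_C_mul] at hi
    rcases i with _ | _ | i
    · simp only [coeff_derivative, mul_coeff_zero, coeff_X_zero, pow_two] at hi ⊢
      push_cast at hi ⊢
      linarith
    · simp only [pow_two, mul_assoc, coeff_X_mul, mul_coeff_zero, coeff_X_zero, coeff_derivative]
        at hi ⊢
      push_cast at hi ⊢
      linarith
    · simp only [pow_two, mul_assoc, coeff_X_mul, coeff_derivative] at hi ⊢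
      push_cast at hi ⊢
      linarith
  rw [hG, coeff_C_mul, coeff_C_mul]
  linear_combination c * key

/-- Gegenbauer polynomials are even or odd, according to the parity of the degree. -/
lemma gegenbauer_coeff_eq_zero_of_odd {n : ℕ} (hn : 2 ≤ n) (k : ℕ) :
    ∀ d ≤ k, Odd d → (gegenbauer n k).coeff (k - d) = 0 := by
  have hn' : (2 : ℝ) ≤ n := by exact_mod_cast hn
  intro d
  induction d using Nat.strong_induction_on with
  | _ d ih =>
    intro hd hodd
    have hd1 : 1 ≤ d := hodd.pos
    have hrec := gegenbauer_coeff_rec hn k (k - d)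
    have h0 : (gegenbauer n k).coeff (k - d + 2) = 0 := by
      rcases Nat.lt_or_ge d 2 with h | h
      · exact coeff_eq_zero_of_natDegree_lt
          ((gegenbauer_natDegree_le n k).trans_lt (by omega))
      · have := ih (d - 2) (by omega) (by omega) (Nat.Odd.sub_even h hodd even_two)
        rwa [show k - (d - 2) = k - d + 2 by omega] at this
    rw [h0, mul_zero] at hrec
    refine (mul_eq_zero.1 hrec.symm).resolve_left ?_
    obtain ⟨i, rfl⟩ := Nat.exists_eq_add_of_le hd
    rw [Nat.add_sub_cancel_left]
    push_cast
    have h1 : (1 : ℝ) ≤ d := by exact_mod_cast hd1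
    have h2 := i.cast_nonneg (α := ℝ)
    have : 0 < (d : ℝ) * (d + 2 * i + (n - 2)) := by
      apply mul_pos <;> linarith
    intro hcontra
    linarith

lemma gegenbauer_eval_eq_sum {n : ℕ} (hn : 2 ≤ n) (k : ℕ) (t : ℝ) :
    (gegenbauer n k).eval t
      = ∑ j ∈ Finset.range (k / 2 + 1), (gegenbauer n k).coeff (k - 2 * j) * t ^ (k - 2 * j) := by
  rw [eval_eq_sum_range' (Nat.lt_succ_of_le (gegenbauer_natDegree_le n k)),
    ← Finset.sum_range_reflect, eq_comm]
  refine Finset.sum_of_injOn (fun j => 2 * j) (fun a _ b _ h => by simpa using h) ?_ ?_ ?_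
  · intro j hj
    simp only [Finset.coe_range, Set.mem_Iio] at hj ⊢
    omega
  · intro d hd hnot
    simp only [Finset.mem_range] at hd
    rcases Nat.even_or_odd d with h | h
    · obtain ⟨j, rfl⟩ := h
      exact absurd ⟨j, by simp; omega, by simp; ring⟩ hnot
    · rw [Nat.succ_eq_add_one, Nat.add_sub_cancel,
        gegenbauer_coeff_eq_zero_of_odd hn k d (by omega) h, zero_mul]
  · intro j _
    simp

/-! ### Positive definiteness of Gegenbauer polynomials on the sphere -/

section Fischer

open MvPolynomial

variable {ι : Type*}

/-- The Fischer (apolar) inner product of multivariate polynomials, for which the monomials are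
orthogonal and `X^m` has squared norm `m!`. -/
def fischer : MvPolynomial ι ℝ →ₗ[ℝ] MvPolynomial ι ℝ →ₗ[ℝ] ℝ :=
  (basisMonomials ι ℝ).constr ℝ
    fun m => (m.prod fun _ e => (e.factorial : ℝ)) • MvPolynomial.lcoeff ℝ m

lemma fischer_monomial (m : ι →₀ ℕ) (a : ℝ) (q : MvPolynomial ι ℝ) :
    fischer (MvPolynomial.monomial m a) q
      = a * ((m.prod fun _ e => (e.factorial : ℝ)) * q.coeff m) := by
  have h : MvPolynomial.monomial m a = a • basisMonomials ι ℝ m := by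
    simp [MvPolynomial.smul_monomial]
  rw [h, map_smul, fischer, Module.Basis.constr_basis]
  simp

lemma fischer_self_nonneg (p : MvPolynomial ι ℝ) : 0 ≤ fischer p p := by
  have h : fischer p p = ∑ m ∈ p.support, fischer (MvPolynomial.monomial m (p.coeff m)) p := by
    rw [← LinearMap.sum_apply, ← map_sum, ← p.as_sum]
  rw [h]
  refine Finset.sum_nonneg fun m _ => ?_
  rw [fischer_monomial, mul_left_comm]
  refine mul_nonneg ?_ (mul_self_nonneg _)
  exact Finset.prod_nonneg fun i _ => Nat.cast_nonneg _

/-- Multiplication by a variable is adjoint to the partial derivative. -/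
lemma fischer_X_mul (i : ι) (p q : MvPolynomial ι ℝ) :
    fischer (MvPolynomial.X i * p) q = fischer p (pderiv i q) := by
  classical
  induction p using MvPolynomial.induction_on' with
  | add p₁ p₂ h₁ h₂ => rw [mul_add, map_add, map_add, LinearMap.add_apply, h₁, h₂]; rfl
  | monomial m a =>
    rw [MvPolynomial.X, MvPolynomial.monomial_mul, one_mul, fischer_monomial, fischer_monomial,
      coeff_pderiv,
      add_comm (Finsupp.single i 1)]
    have : ((m + Finsupp.single i 1).prod fun _ e => (e.factorial : ℝ))
        = (m.prod fun _ e => (e.factorial : ℝ)) * ((m i : ℝ) + 1) := by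
      rw [← Finsupp.mul_prod_erase' m i _ (by simp),
        ← Finsupp.mul_prod_erase' (m + Finsupp.single i 1) i _ (by simp)]
      have : (m + Finsupp.single i 1).erase i = m.erase i := by
        ext j
        by_cases hj : j = i
        · subst hj; simp
        · simp [Finsupp.erase_ne hj]
      rw [this]
      simp only [Finsupp.add_apply, Finsupp.single_eq_same, Nat.factorial_succ]
      push_cast
      ring
    rw [this]
    ring

variable [Fintype ι]

/-- The linear form `z ↦ ⟨x, z⟩`. -/
def linForm (x : ι → ℝ) : MvPolynomial ι ℝ := ∑ i, MvPolynomial.C (x i) * MvPolynomial.X i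

/-- The quadratic form `z ↦ |z|²`. -/
def normSqForm (ι : Type*) [Fintype ι] : MvPolynomial ι ℝ :=
  ∑ i, MvPolynomial.X i * MvPolynomial.X i

/-- The Laplacian. -/
def laplacian : MvPolynomial ι ℝ →ₗ[ℝ] MvPolynomial ι ℝ :=
  ∑ i, (pderiv i).toLinearMap ∘ₗ (pderiv i).toLinearMap

lemma laplacian_apply (p : MvPolynomial ι ℝ) : laplacian p = ∑ i, pderiv i (pderiv i p) := by
  simp [laplacian]

lemma fischer_normSqForm_mul (p q : MvPolynomial ι ℝ) :
    fischer (normSqForm ι * p) q = fischer p (laplacian q) := by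
  rw [normSqForm, Finset.sum_mul, map_sum, LinearMap.sum_apply, laplacian_apply, map_sum]
  refine Finset.sum_congr rfl fun i _ => ?_
  rw [mul_assoc, fischer_X_mul, fischer_X_mul]

/-- The powers of linear forms reproduce the values of homogeneous polynomials. -/
lemma fischer_linForm_pow (x : ι → ℝ) (k : ℕ) {q : MvPolynomial ι ℝ} (hq : q.IsHomogeneous k) :
    fischer (linForm x ^ k) q = k.factorial * MvPolynomial.eval x q := by
  induction k generalizing q with
  | zero =>
    rw [← totalDegree_zero_iff_isHomogeneous, MvPolynomial.totalDegree_eq_zero_iff_eq_C] at hq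
    rw [pow_zero, ← MvPolynomial.C_1, MvPolynomial.C_apply, fischer_monomial, hq]
    simp
  | succ k ih =>
    have heul := congrArg (MvPolynomial.eval x) hq.sum_X_mul_pderiv
    rw [map_sum] at heul
    simp only [map_mul, MvPolynomial.eval_X, map_nsmul] at heul
    rw [pow_succ', linForm, Finset.sum_mul, map_sum, LinearMap.sum_apply]
    have : ∀ i, fischer (MvPolynomial.C (x i) * MvPolynomial.X i * linForm x ^ k) q
        = k.factorial * (x i * MvPolynomial.eval x (pderiv i q)) := by
      intro i
      rw [mul_assoc, MvPolynomial.C_mul', map_smul, LinearMap.smul_apply, fischer_X_mul,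
        ih (hq.pderiv), smul_eq_mul]
      ring
    change ∑ i, fischer (MvPolynomial.C (x i) * MvPolynomial.X i * linForm x ^ k) q = _
    rw [Finset.sum_congr rfl fun i _ => this i, ← Finset.mul_sum, heul, Nat.factorial_succ,
      nsmul_eq_mul]
    push_cast
    ring

lemma pderiv_linForm (x : ι → ℝ) (i : ι) : pderiv i (linForm x) = MvPolynomial.C (x i) := by
  classical
  rw [linForm, map_sum, Finset.sum_eq_single i]
  · rw [pderiv_C_mul, pderiv_X_self, mul_one]
  · intro j _ hj
    rw [pderiv_C_mul, pderiv_X_of_ne hj, mul_zero]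
  · simp

lemma pderiv_normSqForm (i : ι) : pderiv i (normSqForm ι) = 2 * MvPolynomial.X i := by
  classical
  rw [normSqForm, map_sum, Finset.sum_eq_single i]
  · rw [pderiv_mul, pderiv_X_self]; ring
  · intro j _ hj
    rw [pderiv_mul, pderiv_X_of_ne hj]; ring
  · simp

lemma laplacian_linForm_pow_mul (x : ι → ℝ) (hx : ∑ i, x i * x i = 1) (a b : ℕ) :
    laplacian (linForm x ^ a * normSqForm ι ^ b)
      = MvPolynomial.C ((a : ℝ) * (a - 1)) * (linForm x ^ (a - 2) * normSqForm ι ^ b)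
        + MvPolynomial.C ((2 * b : ℝ) * (2 * a + Fintype.card ι + 2 * b - 2))
          * (linForm x ^ a * normSqForm ι ^ (b - 1)) := by
  have hx' : ∑ i, (MvPolynomial.C (x i) * MvPolynomial.C (x i) : MvPolynomial ι ℝ) = 1 := by
    simp only [← MvPolynomial.C_mul, ← map_sum, hx, MvPolynomial.C_1]
  have hterm : ∀ i, pderiv i (pderiv i (linForm x ^ a * normSqForm ι ^ b))
      = MvPolynomial.C ((a : ℝ) * (a - 1)) * (linForm x ^ (a - 2) * normSqForm ι ^ b)
          * (MvPolynomial.C (x i) * MvPolynomial.C (x i))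
        + MvPolynomial.C (4 * a * b : ℝ) * linForm x ^ (a - 1) * normSqForm ι ^ (b - 1)
          * (MvPolynomial.C (x i) * MvPolynomial.X i)
        + MvPolynomial.C (2 * b : ℝ) * (linForm x ^ a * normSqForm ι ^ (b - 1))
        + MvPolynomial.C (4 * b * (b - 1) : ℝ) * (linForm x ^ a * normSqForm ι ^ (b - 2))
          * (MvPolynomial.X i * MvPolynomial.X i) := by
    intro i
    have ha : (a : MvPolynomial ι ℝ) * ((a - 1 : ℕ) : MvPolynomial ι ℝ)
        = MvPolynomial.C ((a : ℝ) * (a - 1)) := by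
      rcases a with _ | a <;> simp
    have hb : (b : MvPolynomial ι ℝ) * ((b - 1 : ℕ) : MvPolynomial ι ℝ)
        = MvPolynomial.C ((b : ℝ) * (b - 1)) := by
      rcases b with _ | b <;> simp
    have e0 : ∀ c : ℕ, [c.AtLeastTwo] → (MvPolynomial.C (OfNat.ofNat c : ℝ) : MvPolynomial ι ℝ)
        = OfNat.ofNat c := fun c _ => map_ofNat _ c
    have e1 : MvPolynomial.C (4 * a * b : ℝ) = (4 * a * b : MvPolynomial ι ℝ) := by simp [e0]
    have e2 : MvPolynomial.C (2 * b : ℝ) = (2 * b : MvPolynomial ι ℝ) := by simp [e0]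
    have e3 : MvPolynomial.C (4 * b * (b - 1) : ℝ)
        = (4 * MvPolynomial.C ((b : ℝ) * (b - 1)) : MvPolynomial ι ℝ) := by
      rw [mul_assoc, MvPolynomial.C_mul, e0]
    have h2 : pderiv i (2 : MvPolynomial ι ℝ) = 0 := by
      rw [show (2 : MvPolynomial ι ℝ) = MvPolynomial.C 2 from (e0 2).symm, MvPolynomial.pderiv_C]
    have hna : ∀ c : ℕ, pderiv i (c : MvPolynomial ι ℝ) = 0 := fun c => by
      rw [← MvPolynomial.C_eq_coe_nat, MvPolynomial.pderiv_C]
    simp only [pderiv_mul, pderiv_pow, map_add, pderiv_linForm, pderiv_normSqForm,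
      MvPolynomial.pderiv_C, pderiv_X_self, h2, hna]
    rw [e1, e2, e3, ← ha, ← hb, Nat.sub_sub, Nat.sub_sub]
    ring
  have hL : ∑ i, (MvPolynomial.C (x i) * MvPolynomial.X i : MvPolynomial ι ℝ) = linForm x := rfl
  have hN : ∑ i, (MvPolynomial.X i * MvPolynomial.X i : MvPolynomial ι ℝ) = normSqForm ι := rfl
  rw [laplacian_apply, Finset.sum_congr rfl fun i _ => hterm i]
  simp only [Finset.sum_add_distrib, ← Finset.mul_sum, hx', hL, hN, Finset.sum_const,
    Finset.card_univ]
  have hA : MvPolynomial.C (4 * a * b : ℝ) * linForm x ^ (a - 1) * normSqForm ι ^ (b - 1)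
        * linForm x
      = MvPolynomial.C (4 * a * b : ℝ) * (linForm x ^ a * normSqForm ι ^ (b - 1)) := by
    rcases a with _ | a
    · simp
    · rw [Nat.add_sub_cancel, pow_succ]; ring
  have hB : MvPolynomial.C (4 * b * (b - 1) : ℝ) * (linForm x ^ a * normSqForm ι ^ (b - 2))
        * normSqForm ι
      = MvPolynomial.C (4 * b * (b - 1) : ℝ) * (linForm x ^ a * normSqForm ι ^ (b - 1)) := by
    rcases b with _ | _ | b
    · simp
    · simp
    · rw [show b + 1 + 1 - 2 = b by omega, show b + 1 + 1 - 1 = b + 1 by omega, pow_succ]; ring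
  rw [hA, hB, ← mul_assoc, nsmul_eq_mul, ← MvPolynomial.C_eq_coe_nat]
  have hC : MvPolynomial.C ((2 * b : ℝ) * (2 * a + Fintype.card ι + 2 * b - 2))
      = (MvPolynomial.C (4 * a * b : ℝ)
        + MvPolynomial.C ((Fintype.card ι : ℕ) : ℝ) * MvPolynomial.C (2 * b : ℝ)
        + MvPolynomial.C (4 * b * (b - 1) : ℝ)
        : MvPolynomial ι ℝ) := by
    rw [← MvPolynomial.C_mul, ← MvPolynomial.C_add, ← MvPolynomial.C_add]; congr 1; ring
  rw [hC]
  ring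

/-- The zonal harmonic with pole `x`: the homogenization `|z|^k P_k^{(n)}(⟨x, z⟩ / |z|)`. -/
def zonal (n k : ℕ) (x : Fin n → ℝ) : MvPolynomial (Fin n) ℝ :=
  ∑ j ∈ Finset.range (k / 2 + 1),
    MvPolynomial.C ((gegenbauer n k).coeff (k - 2 * j))
      * (linForm x ^ (k - 2 * j) * normSqForm (Fin n) ^ j)

lemma linForm_isHomogeneous (x : ι → ℝ) : (linForm x).IsHomogeneous 1 :=
  IsHomogeneous.sum _ _ _ fun i _ => by
    simpa using (isHomogeneous_C ι (x i)).mul (isHomogeneous_X ℝ i)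

lemma normSqForm_isHomogeneous : (normSqForm ι).IsHomogeneous 2 :=
  IsHomogeneous.sum _ _ _ fun i _ => (isHomogeneous_X ℝ i).mul (isHomogeneous_X ℝ i)

lemma zonal_isHomogeneous (n k : ℕ) (x : Fin n → ℝ) : (zonal n k x).IsHomogeneous k := by
  refine IsHomogeneous.sum _ _ _ fun j hj => ?_
  have hj' := Finset.mem_range.1 hj
  have := (isHomogeneous_C (Fin n) ((gegenbauer n k).coeff (k - 2 * j))).mul
    (((linForm_isHomogeneous x).pow (k - 2 * j)).mul (normSqForm_isHomogeneous.pow j))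
  convert this using 1
  omega

lemma laplacian_zonal {n : ℕ} (hn : 2 ≤ n) (k : ℕ) {x : Fin n → ℝ} (hx : ∑ i, x i * x i = 1) :
    laplacian (zonal n k x) = 0 := by
  have hterm : ∀ j ∈ Finset.range (k / 2 + 1), laplacian
      (MvPolynomial.C ((gegenbauer n k).coeff (k - 2 * j))
        * (linForm x ^ (k - 2 * j) * normSqForm (Fin n) ^ j))
      = MvPolynomial.C ((gegenbauer n k).coeff (k - 2 * j)
            * (((k - 2 * j : ℕ) : ℝ) * ((k - 2 * j : ℕ) - 1)))
          * (linForm x ^ (k - 2 * j - 2) * normSqForm (Fin n) ^ j)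
        + MvPolynomial.C ((gegenbauer n k).coeff (k - 2 * j)
            * ((2 * j : ℝ) * (2 * (k - 2 * j : ℕ) + n + 2 * j - 2)))
          * (linForm x ^ (k - 2 * j) * normSqForm (Fin n) ^ (j - 1)) := by
    intro j _
    rw [MvPolynomial.C_mul', map_smul, laplacian_linForm_pow_mul x hx, MvPolynomial.smul_eq_C_mul,
      Fintype.card_fin, mul_add]
    simp only [MvPolynomial.C_mul]
    ring
  rw [zonal, map_sum, Finset.sum_congr rfl hterm, Finset.sum_add_distrib, Finset.sum_range_succ,
    Finset.sum_range_succ']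
  have hlast : (((k - 2 * (k / 2) : ℕ) : ℝ) * ((k - 2 * (k / 2) : ℕ) - 1)) = 0 := by
    rcases Nat.mod_two_eq_zero_or_one k with h | h
    · rw [show k - 2 * (k / 2) = 0 by omega]; simp
    · rw [show k - 2 * (k / 2) = 1 by omega]; simp
  rw [hlast]
  simp only [mul_zero, MvPolynomial.C_0, zero_mul, add_zero, Nat.cast_zero]
  rw [← Finset.sum_add_distrib]
  refine Finset.sum_eq_zero fun j hj => ?_
  have hj' := Finset.mem_range.1 hj
  -- consecutive terms cancel by the coefficient recursion
  have hrec := gegenbauer_coeff_rec hn k (k - 2 * (j + 1))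
  obtain ⟨i, hi⟩ : ∃ i, k = i + 2 * (j + 1) := ⟨k - 2 * (j + 1), by omega⟩
  have e1 : k - 2 * (j + 1) = i := by omega
  have e2 : k - 2 * j = i + 2 := by omega
  rw [e1] at hrec
  rw [e1, e2, Nat.add_sub_cancel, Nat.add_sub_cancel, ← add_mul, ← MvPolynomial.C_add]
  have hk : (k : ℝ) = i + 2 * (j + 1) := by rw [hi]; push_cast; ring
  rw [hk] at hrec
  convert zero_mul _
  rw [← MvPolynomial.C_0]
  congr 1
  push_cast
  linear_combination hrec

lemma eval_zonal {n : ℕ} (hn : 2 ≤ n) (k : ℕ) (x : Fin n → ℝ) {y : Fin n → ℝ}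
    (hy : ∑ i, y i * y i = 1) :
    MvPolynomial.eval y (zonal n k x) = (gegenbauer n k).eval (∑ i, x i * y i) := by
  rw [gegenbauer_eval_eq_sum hn, zonal, map_sum]
  refine Finset.sum_congr rfl fun j _ => ?_
  simp [linForm, normSqForm, hy]

/-- Zonal harmonics are reproducing: `|z|²`-multiples are Fischer-orthogonal to harmonic
polynomials, so that only the leading term of the first zonal contributes. -/
lemma fischer_zonal {n : ℕ} (hn : 2 ≤ n) (k : ℕ) {x y : Fin n → ℝ} (hx : ∑ i, x i * x i = 1)
    (hy : ∑ i, y i * y i = 1) :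
    fischer (zonal n k y) (zonal n k x)
      = (gegenbauer n k).coeff k * k.factorial * (gegenbauer n k).eval (∑ i, x i * y i) := by
  conv_lhs => rw [zonal]
  rw [map_sum, LinearMap.sum_apply, Finset.sum_range_succ', Finset.sum_eq_zero, zero_add]
  · simp only [mul_zero, tsub_zero, pow_zero, mul_one]
    rw [MvPolynomial.C_mul', map_smul, LinearMap.smul_apply,
      fischer_linForm_pow y k (zonal_isHomogeneous n k x), eval_zonal hn k x hy, smul_eq_mul,
      mul_assoc]
  · intro j _
    rw [MvPolynomial.C_mul', map_smul, LinearMap.smul_apply, pow_succ', mul_left_comm,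
      fischer_normSqForm_mul, laplacian_zonal hn k hx, map_zero, smul_zero]

end Fischer

/-- **Positive definiteness** of the Gegenbauer polynomials on the unit sphere. -/
lemma gegenbauer_sum_nonneg {n : ℕ} (hn : 2 ≤ n) (k : ℕ)
    {D : Finset (EuclideanSpace ℝ (Fin n))} (hD : ∀ x ∈ D, ‖x‖ = 1) :
    0 ≤ ∑ x ∈ D, ∑ y ∈ D, (gegenbauer n k).eval (inner ℝ x y) := by
  have hsq : ∀ x ∈ D, ∑ i, x i * x i = 1 := by
    intro x hx
    have := EuclideanSpace.real_norm_sq_eq x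
    rw [hD x hx] at this
    simp only [← pow_two]
    linarith
  have h := fischer_self_nonneg (∑ x ∈ D, zonal n k (fun i => x i))
  rw [map_sum fischer, LinearMap.sum_apply] at h
  have h2 : ∀ x ∈ D, fischer (zonal n k (fun i => x i)) (∑ y ∈ D, zonal n k (fun i => y i))
      = (gegenbauer n k).coeff k * k.factorial *
          ∑ y ∈ D, (gegenbauer n k).eval (inner ℝ x y) := by
    intro x hx
    rw [map_sum, Finset.mul_sum]
    refine Finset.sum_congr rfl fun y hy => ?_
    rw [fischer_zonal hn k (hsq y hy) (hsq x hx)]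
    rfl
  rw [Finset.sum_congr rfl h2, ← Finset.mul_sum] at h
  have hc := gegenbauer_coeff_self_pos hn k
  have hf : (0 : ℝ) < k.factorial := by exact_mod_cast k.factorial_pos
  exact nonneg_of_mul_nonneg_right h (mul_pos hc hf)

/-! ### Orthogonality with respect to a linear functional -/

/-- Up to simple linear factors at some of its zeros in an interval, a polynomial has constant sign
there. -/
lemma exists_signChanges (a b : ℝ) {P : ℝ[X]} (hP : P ≠ 0) : ∃ Z : Finset ℝ,
    (∀ z ∈ Z, z ∈ Set.Ioo a b ∧ P.IsRoot z) ∧ ∃ c : ℝ, c ≠ 0 ∧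
      ∀ t ∈ Set.Ioo a b, 0 ≤ c * (P * ∏ z ∈ Z, (X - C z)).eval t := by
  classical
  induction hd : P.natDegree using Nat.strong_induction_on generalizing P with
  | _ d ih =>
    by_cases hroot : ∃ z ∈ Set.Ioo a b, P.IsRoot z
    · obtain ⟨z, hz, hPz⟩ := hroot
      obtain ⟨P', rfl⟩ := dvd_iff_isRoot.2 hPz
      have hP' : P' ≠ 0 := right_ne_zero_of_mul hP
      have hdeg : P'.natDegree < d := by
        rw [← hd, natDegree_mul (X_sub_C_ne_zero z) hP', natDegree_X_sub_C]
        omega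
      obtain ⟨Z, hZ, c, hc, hsgn⟩ := ih _ hdeg hP' rfl
      have hroot' : ∀ y, P'.IsRoot y → ((X - C z) * P').IsRoot y := fun y hy => by
        rw [IsRoot.def, eval_mul, hy.eq_zero, mul_zero]
      by_cases hmem : z ∈ Z
      · refine ⟨Z.erase z, fun y hy => ?_, c, hc, fun t ht => ?_⟩
        · have := hZ y (Finset.mem_of_mem_erase hy)
          exact ⟨this.1, hroot' y this.2⟩
        · have := hsgn t ht
          rwa [← Finset.mul_prod_erase Z _ hmem, ← mul_assoc, mul_comm P'] at this
      · refine ⟨insert z Z, fun y hy => ?_, c, hc, fun t ht => ?_⟩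
        · rcases Finset.mem_insert.1 hy with rfl | hy
          · exact ⟨hz, hPz⟩
          · exact ⟨(hZ y hy).1, hroot' y (hZ y hy).2⟩
        · have := mul_nonneg (hsgn t ht) (sq_nonneg (t - z))
          rw [Finset.prod_insert hmem]
          simp only [eval_mul, eval_sub, eval_X, eval_C] at this ⊢
          linarith
    · push Not at hroot
      rcases (Set.Ioo a b).eq_empty_or_nonempty with he | ⟨t₀, ht₀⟩
      · exact ⟨∅, by simp, 1, one_ne_zero, by simp [he]⟩
      refine ⟨∅, by simp, P.eval t₀, hroot t₀ ht₀, fun t ht => ?_⟩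
      simp only [Finset.prod_empty, mul_one]
      by_contra! hneg
      have hcont : ContinuousOn (fun t => P.eval t) (Set.Ioo a b) := P.continuous.continuousOn
      have himg := isPreconnected_Ioo.image _ hcont
      have h0 : (0 : ℝ) ∈ (fun t => P.eval t) '' Set.Ioo a b := by
        rcases mul_neg_iff.1 hneg with ⟨h1, h2⟩ | ⟨h1, h2⟩
        · exact himg.Icc_subset ⟨t, ht, rfl⟩ ⟨t₀, ht₀, rfl⟩ ⟨h2.le, h1.le⟩
        · exact himg.Icc_subset ⟨t₀, ht₀, rfl⟩ ⟨t, ht, rfl⟩ ⟨h1.le, h2.le⟩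
      obtain ⟨z, hz, hz0⟩ := h0
      exact hroot z hz hz0

/-- A polynomial orthogonal to all polynomials of degree less than `m` has `m` distinct zeros in
the interval on which the functional is positive. -/
lemma exists_zeros_of_orthogonal {a b : ℝ} (hab : a < b) (L : ℝ[X] →ₗ[ℝ] ℝ) {P : ℝ[X]}
    (hP : P ≠ 0) {m : ℕ} (horth : ∀ q : ℝ[X], q.degree < m → L (P * q) = 0)
    (hpos : ∀ (Z : Finset ℝ) (c : ℝ), c ≠ 0 → (∀ z ∈ Z, P.IsRoot z) →
      (∀ t ∈ Set.Icc a b, 0 ≤ c * (P * ∏ z ∈ Z, (X - C z)).eval t) →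
      0 < c * L (P * ∏ z ∈ Z, (X - C z))) :
    ∃ Z : Finset ℝ, Z.card = m ∧ ∀ z ∈ Z, z ∈ Set.Ioo a b ∧ P.IsRoot z := by
  obtain ⟨Z, hZ, c, hc, hsgn⟩ := exists_signChanges a b hP
  have hm : m ≤ Z.card := by
    by_contra! hlt
    have h1 := hpos Z c hc (fun z hz => (hZ z hz).2) (fun t ht => by
      rw [← closure_Ioo hab.ne] at ht
      exact closure_minimal (s := Set.Ioo a b)
        (t := {t | 0 ≤ c * (P * ∏ z ∈ Z, (X - C z)).eval t}) hsgn
        (isClosed_le continuous_const (by fun_prop)) ht)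
    rw [horth _ (by rw [degree_prod]; simpa using hlt), mul_zero] at h1
    exact lt_irrefl _ h1
  obtain ⟨Z', hZ', hcard⟩ := Finset.exists_subset_card_eq hm
  exact ⟨Z', hcard, fun z hz => hZ z (hZ' hz)⟩

/-- Interpolatory quadrature gains in exactness what the nodal polynomial has in orthogonality. -/
lemma quadrature_of_nodal_orthogonal {ι : Type*} [DecidableEq ι] (L : ℝ[X] →ₗ[ℝ] ℝ)
    (S : Finset ι) (v : ι → ℝ) (hv : Set.InjOn v S) {d : ℕ}
    (horth : ∀ q : ℝ[X], q.degree < d → L (Lagrange.nodal S v * q) = 0)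
    {p : ℝ[X]} (hp : p.degree < (S.card + d : ℕ)) :
    L p = ∑ i ∈ S, L (Lagrange.basis S v i) * p.eval (v i) := by
  have hmonic : (Lagrange.nodal S v).Monic := Lagrange.nodal_monic
  have hr : (p %ₘ Lagrange.nodal S v).degree < S.card := by
    rw [← Lagrange.degree_nodal (s := S) (v := v)]
    exact degree_modByMonic_lt p hmonic
  have hq : (p /ₘ Lagrange.nodal S v).degree < d := by
    by_cases h0 : p /ₘ Lagrange.nodal S v = 0
    · rw [h0, degree_zero]; exact WithBot.bot_lt_coe d
    · have h1 := degree_add_divByMonic (p := p) hmonic (by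
        by_contra! hlt
        exact h0 ((divByMonic_eq_zero_iff hmonic).2 hlt))
      rw [← h1, Lagrange.degree_nodal, degree_eq_natDegree h0] at hp
      rw [degree_eq_natDegree h0]
      norm_cast at hp ⊢
      omega
  have heval : ∀ i ∈ S, (p %ₘ Lagrange.nodal S v).eval (v i) = p.eval (v i) := by
    intro i hi
    conv_rhs => rw [← modByMonic_add_div p (Lagrange.nodal S v)]
    rw [eval_add, eval_mul, Lagrange.eval_nodal_at_node hi, zero_mul, add_zero]
  conv_lhs => rw [← modByMonic_add_div p (Lagrange.nodal S v)]
  rw [map_add, horth _ hq, add_zero, Lagrange.eq_interpolate hv hr, Lagrange.interpolate_apply,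
    map_sum]
  refine Finset.sum_congr rfl fun i hi => ?_
  rw [← smul_eq_C_mul, map_smul, heval i hi, smul_eq_mul, mul_comm]

/-- The functional `p ↦ ∑ w_i p(v_i)`. -/
def discreteFunctional {ι : Type*} (S : Finset ι) (v w : ι → ℝ) : ℝ[X] →ₗ[ℝ] ℝ :=
  ∑ i ∈ S, w i • leval (v i)

lemma discreteFunctional_apply {ι : Type*} (S : Finset ι) (v w : ι → ℝ) (p : ℝ[X]) :
    discreteFunctional S v w p = ∑ i ∈ S, w i * p.eval (v i) := by
  simp [discreteFunctional, leval_apply]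

lemma discreteFunctional_mul_self_pos {ι : Type*} {S : Finset ι} {v w : ι → ℝ}
    (hv : Set.InjOn v S) (hw : ∀ i ∈ S, 0 < w i) {q : ℝ[X]} (hq0 : q ≠ 0)
    (hq : q.degree < S.card) : 0 < discreteFunctional S v w (q * q) := by
  rw [discreteFunctional_apply]
  have hnn : ∀ i ∈ S, 0 ≤ w i * (q * q).eval (v i) := fun i hi => by
    rw [eval_mul]; exact mul_nonneg (hw i hi).le (mul_self_nonneg _)
  refine lt_of_le_of_ne (Finset.sum_nonneg hnn) fun h => hq0 ?_
  have hz := (Finset.sum_eq_zero_iff_of_nonneg hnn).1 h.symm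
  refine eq_zero_of_degree_lt_of_eval_index_eq_zero S hv hq fun i hi => ?_
  have := (mul_eq_zero.1 (hz i hi)).resolve_left (hw i hi).ne'
  rw [eval_mul] at this
  exact mul_self_eq_zero.1 this

lemma monicOrthogonal_eq (L : ℝ[X] → ℝ) (i : ℕ) : monicOrthogonal L i
    = X ^ i - ∑ j : Fin i, C (L (X ^ i * monicOrthogonal L j) / L (monicOrthogonal L j ^ 2))
        * monicOrthogonal L j := by
  rw [monicOrthogonal]

lemma monicOrthogonal_degree (L : ℝ[X] → ℝ) (i : ℕ) :
    (monicOrthogonal L i).Monic ∧ (monicOrthogonal L i).degree = i := by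
  induction i using Nat.strong_induction_on with
  | _ i ih =>
    have hlt : (∑ j : Fin i, C (L (X ^ i * monicOrthogonal L j) / L (monicOrthogonal L j ^ 2))
        * monicOrthogonal L j).degree < (X ^ i : ℝ[X]).degree := by
      rw [degree_X_pow]
      refine (degree_sum_le _ _).trans_lt ((Finset.sup_lt_iff (WithBot.bot_lt_coe i)).2 ?_)
      intro j _
      rw [← smul_eq_C_mul]
      refine (degree_smul_le _ _).trans_lt ?_
      rw [(ih j j.isLt).2]
      exact Nat.cast_lt.2 j.isLt
    rw [monicOrthogonal_eq]
    exact ⟨(monic_X_pow i).sub_of_left hlt, by rw [degree_sub_eq_left_of_degree_lt hlt,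
      degree_X_pow]⟩

lemma degree_sub_C_mul_lt {p d : ℝ[X]} {m : ℕ} (hp : p.Monic) (hpd : p.degree = m)
    (hd : d.degree < (m + 1 : ℕ)) : (d - C (d.coeff m) * p).degree < m := by
  rw [degree_lt_iff_coeff_zero] at hd ⊢
  intro i hi
  have hpm : p.natDegree = m := natDegree_eq_of_degree_eq_some hpd
  rw [coeff_sub, coeff_C_mul]
  rcases hi.eq_or_lt with rfl | h
  · have := hp.coeff_natDegree
    rw [hpm] at this
    rw [this]; ring
  · rw [hd i h, coeff_eq_zero_of_natDegree_lt (p := p) (by omega)]; ring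

/-- A functional vanishing on monic polynomials of degrees `0, …, m - 1` vanishes on all
polynomials of degree less than `m`. -/
lemma eq_zero_of_monic_basis (Λ : ℝ[X] →ₗ[ℝ] ℝ) (p : ℕ → ℝ[X])
    (hp : ∀ i, (p i).Monic ∧ (p i).degree = i) (m : ℕ) (h : ∀ j < m, Λ (p j) = 0) :
    ∀ q : ℝ[X], q.degree < m → Λ q = 0 := by
  induction m with
  | zero =>
    intro q hq
    have : q = 0 := by simpa using hq
    rw [this, map_zero]
  | succ m ih =>
    intro q hq
    have := ih (fun j hj => h j (by omega)) _ (degree_sub_C_mul_lt (hp m).1 (hp m).2 hq)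
    rwa [map_sub, ← smul_eq_C_mul, map_smul, h m (by omega), smul_zero, sub_zero] at this

lemma monicOrthogonal_orthogonal (L : ℝ[X] →ₗ[ℝ] ℝ) {i : ℕ}
    (hpos : ∀ j < i, L (monicOrthogonal L j * monicOrthogonal L j) ≠ 0) {q : ℝ[X]}
    (hq : q.degree < i) : L (monicOrthogonal L i * q) = 0 := by
  have key : ∀ j < i, L (monicOrthogonal L i * monicOrthogonal L j) = 0 := by
    clear hq q
    induction i using Nat.strong_induction_on with
    | _ i ih =>
      intro j hj
      have hne : ∀ j' < i, j' ≠ j → L (monicOrthogonal L j' * monicOrthogonal L j) = 0 := by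
        intro j' hj' hne
        rcases lt_or_gt_of_ne hne with h | h
        · rw [mul_comm]
          exact ih j hj (fun r hr => hpos r (hr.trans hj)) j' h
        · exact ih j' hj' (fun r hr => hpos r (hr.trans hj')) j h
      rw [monicOrthogonal_eq, sub_mul, map_sub, Finset.sum_mul, map_sum,
        Finset.sum_eq_single (⟨j, hj⟩ : Fin i)]
      · rw [mul_assoc, ← smul_eq_C_mul, map_smul, smul_eq_mul, pow_two,
          div_mul_cancel₀ _ (hpos j hj), sub_self]
      · intro j' _ hj'
        rw [mul_assoc, ← smul_eq_C_mul, map_smul,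
          hne j' j'.isLt (fun h => hj' (Fin.ext h)), smul_zero]
      · simp
  exact eq_zero_of_monic_basis (L.comp (LinearMap.mulLeft ℝ (monicOrthogonal L i)))
    (monicOrthogonal L) (monicOrthogonal_degree L) i key q hq

/-- Where the functional is definite, orthogonality to lower degrees determines a polynomial up to
a factor. -/
lemma eq_C_mul_of_orthogonal (L : ℝ[X] →ₗ[ℝ] ℝ) {p d : ℝ[X]} {m : ℕ}
    (hp : p.Monic) (hpd : p.degree = m) (hpo : ∀ q : ℝ[X], q.degree < m → L (p * q) = 0)
    (hd : d.degree < (m + 1 : ℕ)) (hdo : ∀ q : ℝ[X], q.degree < m → L (d * q) = 0)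
    (hdef : ∀ e : ℝ[X], e ≠ 0 → e.degree < m → 0 < L (e * e)) : d = C (d.coeff m) * p := by
  by_contra hne
  have he := degree_sub_C_mul_lt hp hpd hd
  have := hdef _ (sub_ne_zero.2 hne) he
  rw [sub_mul, map_sub, hdo _ he, mul_assoc, ← smul_eq_C_mul, map_smul, hpo _ he] at this
  simp at this

/-! ### Gauss quadrature at the zeros of the adjacent polynomial -/

/-- The `k`-point Gauss quadrature of `(1 - t) dμ(t)`, with nodes `T` and weights `w`. -/
structure IsGaussRule {n : ℕ} (hn : 2 ≤ n) (k : ℕ) (T : Finset ℝ) (w : ℝ → ℝ) : Prop where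
  card : T.card = k
  mem : ∀ t ∈ T, t ∈ Set.Ioo (-1 : ℝ) 1
  pos : ∀ t ∈ T, 0 < w t
  exact_of_degree : ∀ p : ℝ[X], p.degree < (2 * k : ℕ) →
    mean hn ((1 - X) * p) = discreteFunctional T id w p

lemma degree_mul_lt_of_le_of_lt {p q : ℝ[X]} {a b c : ℕ} (hp : p.degree ≤ a) (hq : q.degree < b)
    (h : a + b ≤ c) : (p * q).degree < c := by
  by_cases hq0 : q = 0
  · rw [hq0, mul_zero, degree_zero]; exact WithBot.bot_lt_coe c
  by_cases hp0 : p = 0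
  · rw [hp0, zero_mul, degree_zero]; exact WithBot.bot_lt_coe c
  rw [degree_mul]
  rw [degree_eq_natDegree hp0] at hp ⊢
  rw [degree_eq_natDegree hq0] at hq ⊢
  norm_cast at hp hq ⊢
  omega

lemma one_sub_X_ne_zero : (1 - X : ℝ[X]) ≠ 0 := fun h => by
  have := congrArg (eval 0) h
  simp at this

lemma mean_one_sub_X_mul_pos {n : ℕ} (hn : 2 ≤ n) {p : ℝ[X]} (hp : p ≠ 0)
    (h : ∀ t ∈ Set.Icc (-1 : ℝ) 1, 0 ≤ p.eval t) : 0 < mean hn ((1 - X) * p) :=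
  mean_pos hn (mul_ne_zero one_sub_X_ne_zero hp) fun t ht => by
    rw [eval_mul, eval_sub, eval_one, eval_X]
    exact mul_nonneg (by linarith [ht.2]) (h t ht)

lemma exists_isGaussRule {n : ℕ} (hn : 2 ≤ n) {k : ℕ} (hk : 1 ≤ k) :
    ∃ (T : Finset ℝ) (w : ℝ → ℝ), IsGaussRule hn k T w ∧
      ∀ t, (adjacent n k).IsRoot t ↔ t ∈ T := by
  classical
  have hP0 : adjacent n k ≠ 0 := fun h => by
    have := adjacent_eval_one hn k
    rw [h] at this; simp at this
  have horth : ∀ q : ℝ[X], q.degree < k → mean hn ((1 - X) * (adjacent n k * q)) = 0 := by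
    intro q hq
    refine adjacent_orthogonal hn ?_
    rcases eq_or_ne q 0 with rfl | hq0
    · rw [natDegree_zero]; omega
    · exact (natDegree_lt_iff_degree_lt hq0).2 hq
  set L : ℝ[X] →ₗ[ℝ] ℝ := (mean hn).comp (LinearMap.mulLeft ℝ (1 - X)) with hL
  have hLa : ∀ p, L p = mean hn ((1 - X) * p) := fun p => rfl
  obtain ⟨T, hcard, hT⟩ := exists_zeros_of_orthogonal (a := -1) (b := 1) (by norm_num) L hP0
    (m := k) horth (fun Z c hc _ hnn => by
      rw [← smul_eq_mul, ← map_smul, hLa]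
      refine mean_one_sub_X_mul_pos hn ?_ fun t ht => ?_
      · rw [smul_ne_zero_iff]
        exact ⟨hc, mul_ne_zero hP0 (Finset.prod_ne_zero_iff.2 fun z _ => X_sub_C_ne_zero z)⟩
      · rw [eval_smul]; exact hnn t ht)
  have hsub : T.val ≤ (adjacent n k).roots :=
    (Multiset.le_iff_subset T.nodup).2 fun t ht =>
      (mem_roots hP0).2 (hT t ht).2
  have hroots : T.val = (adjacent n k).roots := by
    refine Multiset.eq_of_le_of_card_le hsub ?_
    refine (card_roots' _).trans ((adjacent_natDegree_le n k).trans ?_)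
    rw [Finset.card_val, hcard]
  have hdegP : (adjacent n k).natDegree = k := by
    refine le_antisymm (adjacent_natDegree_le n k) ?_
    have := card_roots' (adjacent n k)
    rwa [← hroots, Finset.card_val, hcard] at this
  have hfact : adjacent n k = C (adjacent n k).leadingCoeff * Lagrange.nodal T id := by
    conv_lhs => rw [← C_leadingCoeff_mul_prod_multiset_X_sub_C
      (p := adjacent n k) (by rw [← hroots, hdegP, Finset.card_val, hcard])]
    rw [← hroots, Lagrange.nodal]
    rfl
  have hnod : ∀ q : ℝ[X], q.degree < k → L (Lagrange.nodal T id * q) = 0 := by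
    intro q hq
    have h := horth q hq
    rw [hfact, mul_assoc, ← hLa, ← smul_eq_C_mul, map_smul, smul_eq_mul] at h
    exact (mul_eq_zero.1 h).resolve_left (leadingCoeff_ne_zero.2 hP0)
  have hquad : ∀ p : ℝ[X], p.degree < (2 * k : ℕ) →
      L p = ∑ t ∈ T, L (Lagrange.basis T id t) * p.eval t := fun p hp =>
    quadrature_of_nodal_orthogonal L T id (Set.injOn_id _) hnod (by rwa [hcard, ← two_mul])
  refine ⟨T, fun t => L (Lagrange.basis T id t), ⟨hcard, fun t ht => (hT t ht).1, ?_, ?_⟩, ?_⟩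
  · -- the square of the `t`-th Lagrange polynomial has integral equal to the `t`-th weight
    intro t ht
    have hb0 : Lagrange.basis T id t ≠ 0 := Lagrange.basis_ne_zero (Set.injOn_id _) ht
    have hbd : (Lagrange.basis T id t).degree = ((k - 1 : ℕ) : WithBot ℕ) := by
      rw [Lagrange.degree_basis (Set.injOn_id _) ht, hcard]
    have h1 := hquad (Lagrange.basis T id t * Lagrange.basis T id t)
      (degree_mul_lt_of_le_of_lt (a := k - 1) (b := k) hbd.le
        (by rw [hbd]; exact_mod_cast (by omega)) (by omega))
    rw [Finset.sum_eq_single t] at h1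
    · have h2 : (Lagrange.basis T id t).eval t = 1 :=
        Lagrange.eval_basis_self (v := id) (Set.injOn_id _) ht
      rw [eval_mul, h2, mul_one, mul_one] at h1
      rw [← h1]
      exact mean_one_sub_X_mul_pos hn (mul_ne_zero hb0 hb0) fun t _ => by
        rw [eval_mul]; exact mul_self_nonneg _
    · intro t' ht' hne
      have h2 : (Lagrange.basis T id t).eval t' = 0 :=
        Lagrange.eval_basis_of_ne (v := id) hne.symm ht'
      rw [eval_mul, h2]; ring
    · exact fun h => absurd ht h
  · intro p hp
    rw [discreteFunctional_apply]
    exact hquad p hp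
  · intro t
    rw [← mem_roots hP0, ← hroots, Finset.mem_val]

namespace IsGaussRule

variable {n : ℕ} {hn : 2 ≤ n} {k : ℕ} {T : Finset ℝ} {w : ℝ → ℝ}

/-- Gauss quadrature turns a weight that is positive at the nodes into a positive definite form on
polynomials of degree less than `k`. -/
lemma mean_pos (G : IsGaussRule hn k T w) {u q : ℝ[X]} (hu : ∀ t ∈ T, 0 < u.eval t) (hq0 : q ≠ 0)
    (hq : q.degree < k) (hdeg : (u * (q * q)).degree < (2 * k : ℕ)) :
    0 < mean hn ((1 - X) * (u * (q * q))) := by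
  have h := discreteFunctional_mul_self_pos (S := T) (v := id) (w := fun t => w t * u.eval t)
    (Set.injOn_id _) (fun t ht => mul_pos (G.pos t ht) (hu t ht)) hq0 (by rwa [G.card])
  rw [G.exact_of_degree _ hdeg, discreteFunctional_apply]
  rw [discreteFunctional_apply] at h
  simpa only [eval_mul, id, mul_assoc] using h

/-- Zeros of polynomials orthogonal with respect to `u(t) (1 - t) dμ(t)`, where `u` is positive at
the Gauss nodes but possibly not on the whole of `[-1, 1]`. -/
lemma exists_zeros (G : IsGaussRule hn k T w) {a b : ℝ}
    (hab : ∀ t ∈ T, t ∈ Set.Ioo a b) {u P : ℝ[X]} (hu : ∀ t ∈ T, 0 < u.eval t)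
    (hP : ∃ t ∈ T, P.eval t ≠ 0) {m : ℕ} (hdeg : ∀ q : ℝ[X], q.degree < m →
      (u * (P * q)).degree < (2 * k : ℕ))
    (horth : ∀ q : ℝ[X], q.degree < m → mean hn ((1 - X) * (u * (P * q))) = 0) :
    ∃ Z : Finset ℝ, Z.card = m ∧ ∀ z ∈ Z, z ∈ Set.Ioo a b ∧ P.IsRoot z := by
  obtain ⟨t₀, ht₀, hPt₀⟩ := hP
  have hP0 : P ≠ 0 := fun h => hPt₀ (by rw [h, eval_zero])
  have happ : ∀ q, discreteFunctional T id (fun t => w t * u.eval t) q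
      = discreteFunctional T id w (u * q) := fun q => by
    simp only [discreteFunctional_apply, eval_mul, id, mul_assoc]
  refine exists_zeros_of_orthogonal ((hab t₀ ht₀).1.trans (hab t₀ ht₀).2)
    (discreteFunctional T id (fun t => w t * u.eval t)) hP0 (fun q hq => ?_)
    (fun Z c hc hZ hnn => ?_)
  · rw [happ, ← G.exact_of_degree _ (hdeg q hq), horth q hq]
  · rw [← smul_eq_mul, ← map_smul, discreteFunctional_apply]
    refine Finset.sum_pos' (fun t ht => ?_) ⟨t₀, ht₀, ?_⟩
    · rw [eval_smul]
      exact mul_nonneg (mul_pos (G.pos t ht) (hu t ht)).le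
        (hnn t ⟨(hab t ht).1.le, (hab t ht).2.le⟩)
    · rw [eval_smul]
      refine mul_pos (mul_pos (G.pos _ ht₀) (hu _ ht₀))
        (lt_of_le_of_ne (hnn _ ⟨(hab _ ht₀).1.le, (hab _ ht₀).2.le⟩) (Ne.symm ?_))
      rw [eval_mul, eval_prod]
      refine mul_ne_zero hc (mul_ne_zero hPt₀ (Finset.prod_ne_zero_iff.2 fun z hz h0 => ?_))
      rw [eval_sub, eval_X, eval_C, sub_eq_zero] at h0
      simp only [id] at h0
      exact hPt₀ (by rw [h0]; exact hZ z hz)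

end IsGaussRule

/-! ### The class `F_≥` and the Krein condition -/

lemma gegenbauerCoeff_eq {n : ℕ} (hn : 2 ≤ n) (p : ℝ[X]) (i : ℕ) :
    gegenbauerCoeff n (fun t => p.eval t) i
      = mean hn (p * gegenbauer n i) / mean hn (gegenbauer n i * gegenbauer n i) := by
  simp only [gegenbauerCoeff, mean_apply, eval_mul, pow_two]

lemma gegenbauerCoeff_zero {n : ℕ} (hn : 2 ≤ n) (p : ℝ[X]) :
    gegenbauerCoeff n (fun t => p.eval t) 0 = mean hn p := by
  rw [gegenbauerCoeff_eq hn, gegenbauer_zero, mul_one, mul_one, mean_one, div_one]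

lemma PosDef.add {n : ℕ} (hn : 2 ≤ n) {p q : ℝ[X]} (hp : PosDef n fun t => p.eval t)
    (hq : PosDef n fun t => q.eval t) : PosDef n fun t => (p + q).eval t := by
  have h : gegenbauerCoeff n (fun t => (p + q).eval t) = fun i =>
      gegenbauerCoeff n (fun t => p.eval t) i + gegenbauerCoeff n (fun t => q.eval t) i := by
    funext i
    simp only [gegenbauerCoeff_eq hn, add_mul, map_add, add_div]
  refine ⟨fun i => ?_, ?_, fun t ht => ?_⟩
  · rw [h]; exact add_nonneg (hp.1 i) (hq.1 i)
  · rw [h]; exact hp.2.1.add hq.2.1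
  · rw [h]
    simpa only [eval_add, add_mul] using (hp.2.2 t ht).add (hq.2.2 t ht)

lemma PosDef.C_mul {n : ℕ} (hn : 2 ≤ n) {p : ℝ[X]} (hp : PosDef n fun t => p.eval t) {c : ℝ}
    (hc : 0 ≤ c) : PosDef n fun t => (C c * p).eval t := by
  have h : gegenbauerCoeff n (fun t => (C c * p).eval t) = fun i =>
      c * gegenbauerCoeff n (fun t => p.eval t) i := by
    funext i
    rw [gegenbauerCoeff_eq hn, gegenbauerCoeff_eq hn, mul_assoc, ← smul_eq_C_mul, map_smul,
      smul_eq_mul, mul_div_assoc]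
  refine ⟨fun i => ?_, ?_, fun t ht => ?_⟩
  · rw [h]; exact mul_nonneg hc (hp.1 i)
  · rw [h]; exact hp.2.1.mul_left c
  · rw [h]
    simpa only [eval_mul, eval_C, mul_assoc] using (hp.2.2 t ht).mul_left c

lemma PosDef.zero (n : ℕ) : PosDef n fun t => (0 : ℝ[X]).eval t := by
  have h : gegenbauerCoeff n (fun t => (0 : ℝ[X]).eval t) = fun _ => 0 := by
    funext i
    simp [gegenbauerCoeff]
  refine ⟨fun i => by rw [h], by rw [h]; exact summable_zero, fun t _ => ?_⟩
  rw [h]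
  simpa only [zero_mul, eval_zero] using hasSum_zero

lemma PosDef.sum {n : ℕ} (hn : 2 ≤ n) {ι : Type*} (S : Finset ι) {p : ι → ℝ[X]}
    (hp : ∀ i ∈ S, PosDef n fun t => (p i).eval t) : PosDef n fun t => (∑ i ∈ S, p i).eval t := by
  classical
  induction S using Finset.induction_on with
  | empty => simpa only [Finset.sum_empty] using PosDef.zero n
  | insert a S ha ih =>
    simp only [Finset.sum_insert ha]
    exact PosDef.add hn (hp a (Finset.mem_insert_self a S))
      (ih fun i hi => hp i (Finset.mem_insert_of_mem hi))

lemma PosDef.eval_one_nonneg {n : ℕ} (hn : 2 ≤ n) {f : ℝ → ℝ} (hf : PosDef n f) : 0 ≤ f 1 :=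
  (hf.2.2 1 (by simp)).nonneg fun i => by
    rw [gegenbauer_eval_one hn, mul_one]; exact hf.1 i

lemma mean_gegenbauer_sq_pos {n : ℕ} (hn : 2 ≤ n) (i : ℕ) :
    0 < mean hn (gegenbauer n i * gegenbauer n i) := by
  have h0 : gegenbauer n i ≠ 0 := fun h => by
    have := gegenbauer_eval_one hn i
    rw [h] at this; simp at this
  exact mean_pos hn (mul_ne_zero h0 h0) fun t _ => by
    rw [eval_mul]; exact mul_self_nonneg _

lemma PosDef.one {n : ℕ} (hn : 2 ≤ n) : PosDef n fun t => (1 : ℝ[X]).eval t := by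
  have h : ∀ i, gegenbauerCoeff n (fun t => (1 : ℝ[X]).eval t) i = if i = 0 then 1 else 0 := by
    intro i
    split_ifs with hi
    · rw [hi, gegenbauerCoeff_zero hn, mean_one]
    · rw [gegenbauerCoeff_eq hn, mul_comm (1 : ℝ[X]), gegenbauer_orthogonal hn
        (by rw [natDegree_one]; omega), zero_div]
  refine ⟨fun i => ?_, ?_, fun t _ => ?_⟩
  · rw [h]; split_ifs <;> norm_num
  · refine (hasSum_ite_eq (0 : ℕ) (1 : ℝ)).summable.congr fun i => ?_
    rw [h]
  · have : (fun i => gegenbauerCoeff n (fun t => (1 : ℝ[X]).eval t) i * (gegenbauer n i).eval t)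
        = fun i => if i = 0 then 1 else 0 := by
      funext i
      rw [h]
      split_ifs with hi
      · rw [hi, gegenbauer_zero]; simp
      · simp
    rw [this]
    simpa only [eval_one] using hasSum_ite_eq (0 : ℕ) (1 : ℝ)

/-- The top Gegenbauer coefficient of a polynomial has the sign of the leading coefficient. -/
lemma StrictPosDef.leadingCoeff_pos {n : ℕ} (hn : 2 ≤ n) {p : ℝ[X]} (hp : StrictPosDef n p) :
    0 < p.leadingCoeff := by
  have h := hp.2 p.natDegree le_rfl
  set d := p.natDegree with hd
  have hlc := gegenbauer_coeff_self_pos hn d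
  have hsq := mean_gegenbauer_sq_pos hn d
  set c := p.coeff d / (gegenbauer n d).coeff d with hc
  have hlow : mean hn (gegenbauer n d * (p - C c * gegenbauer n d)) = 0 := by
    rcases eq_or_ne (p - C c * gegenbauer n d) 0 with h0 | h0
    · rw [h0, mul_zero, map_zero]
    refine gegenbauer_orthogonal hn ?_
    rw [natDegree_lt_iff_degree_lt h0, degree_lt_iff_coeff_zero]
    intro i hi
    rw [coeff_sub, coeff_C_mul]
    rcases hi.eq_or_lt with rfl | hi
    · rw [hc, div_mul_cancel₀ _ hlc.ne', sub_self]
    · rw [coeff_eq_zero_of_natDegree_lt (p := p) hi, coeff_eq_zero_of_natDegree_lt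
        (p := gegenbauer n d) ((gegenbauer_natDegree_le n d).trans_lt hi)]
      ring
  rw [mul_sub, map_sub, sub_eq_zero, mul_left_comm, ← smul_eq_C_mul, map_smul, smul_eq_mul,
    mul_comm _ p] at hlow
  rw [gegenbauerCoeff_eq hn, hlow, mul_div_cancel_right₀ _ hsq.ne', hc] at h
  exact (div_pos_iff_of_pos_right hlc).1 h

/-! ### The polynomials `P_i^{1,ℓ}` -/

/-- Integration of polynomials against `ν_ℓ`, as a linear functional. -/
def nuFunctional {n : ℕ} (hn : 2 ≤ n) (ℓ : ℝ) : ℝ[X] →ₗ[ℝ] ℝ :=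
  (mean hn).comp (LinearMap.mulLeft ℝ ((1 - X) * (X - C ℓ)))

lemma nuFunctional_apply {n : ℕ} (hn : 2 ≤ n) (ℓ : ℝ) (p : ℝ[X]) :
    nuFunctional hn ℓ p = mean hn ((1 - X) * ((X - C ℓ) * p)) := by
  rw [nuFunctional, LinearMap.comp_apply, LinearMap.mulLeft_apply, mul_assoc]

lemma nuIntegral_eq {n : ℕ} (hn : 2 ≤ n) (ℓ : ℝ) : nuIntegral n ℓ = nuFunctional hn ℓ := by
  funext p
  rw [nuFunctional_apply, mean_apply, nuIntegral]
  congr 1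
  funext t
  simp only [eval_mul, eval_sub, eval_one, eval_X, eval_C]
  ring

/-- The monic multiple of `P_i^{1,ℓ}`. -/
def monicEll {n : ℕ} (hn : 2 ≤ n) (ℓ : ℝ) (i : ℕ) : ℝ[X] := monicOrthogonal (nuFunctional hn ℓ) i

lemma monicEll_monic {n : ℕ} (hn : 2 ≤ n) (ℓ : ℝ) (i : ℕ) : (monicEll hn ℓ i).Monic :=
  (monicOrthogonal_degree _ i).1

lemma monicEll_degree {n : ℕ} (hn : 2 ≤ n) (ℓ : ℝ) (i : ℕ) : (monicEll hn ℓ i).degree = i :=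
  (monicOrthogonal_degree _ i).2

lemma monicEll_natDegree {n : ℕ} (hn : 2 ≤ n) (ℓ : ℝ) (i : ℕ) : (monicEll hn ℓ i).natDegree = i :=
  natDegree_eq_of_degree_eq_some (monicEll_degree hn ℓ i)

lemma ellPoly_eq {n : ℕ} (hn : 2 ≤ n) (ℓ : ℝ) (i : ℕ) :
    ellPoly n ℓ i = C ((monicEll hn ℓ i).eval 1)⁻¹ * monicEll hn ℓ i := by
  rw [ellPoly, nuIntegral_eq hn, monicEll, normalizeAtOne]

lemma ellPoly_zero {n : ℕ} (hn : 2 ≤ n) (ℓ : ℝ) : ellPoly n ℓ 0 = 1 := by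
  rw [ellPoly_eq hn, monicEll, monicOrthogonal_eq]
  simp

section

variable {n : ℕ} {hn : 2 ≤ n} {k : ℕ} {T : Finset ℝ} {w : ℝ → ℝ} {ℓ s : ℝ}

lemma degree_X_sub_C_le' (c : ℝ) : (X - C c : ℝ[X]).degree ≤ (1 : ℕ) := (degree_X_sub_C c).le

namespace IsGaussRule

/-- `ν_ℓ` is positive definite on polynomials of degree less than `k`, although its density changes
sign at `ℓ`: all Gauss nodes are to the right of `ℓ`. -/
lemma nuFunctional_pos (G : IsGaussRule hn k T w) (hℓ : ∀ t ∈ T, ℓ < t) {q : ℝ[X]} (hq0 : q ≠ 0)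
    (hq : q.degree < k) : 0 < nuFunctional hn ℓ (q * q) := by
  have hk : 1 ≤ k := by
    by_contra! h
    obtain rfl : k = 0 := by omega
    exact hq0 (by simpa using hq)
  rw [nuFunctional_apply]
  refine G.mean_pos (fun t ht => ?_) hq0 hq ?_
  · simpa using hℓ t ht
  · have h1 : q.degree ≤ (k - 1 : ℕ) := by
      rw [degree_eq_natDegree hq0] at hq ⊢
      norm_cast at hq ⊢
      omega
    exact degree_mul_lt_of_le_of_lt (degree_X_sub_C_le' ℓ)
      (degree_mul_lt_of_le_of_lt h1 hq le_rfl) (by omega)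

lemma monicEll_sq_pos (G : IsGaussRule hn k T w) (hℓ : ∀ t ∈ T, ℓ < t) {i : ℕ} (hi : i < k) :
    0 < nuFunctional hn ℓ (monicEll hn ℓ i * monicEll hn ℓ i) :=
  G.nuFunctional_pos hℓ (monicEll_monic hn ℓ i).ne_zero (by
    rw [monicEll_degree]; exact Nat.cast_lt.2 hi)

lemma monicEll_orthogonal (G : IsGaussRule hn k T w) (hℓ : ∀ t ∈ T, ℓ < t) {i : ℕ} (hi : i ≤ k)
    {q : ℝ[X]} (hq : q.degree < i) : nuFunctional hn ℓ (monicEll hn ℓ i * q) = 0 :=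
  monicOrthogonal_orthogonal _ (fun _ hj => (G.monicEll_sq_pos hℓ (hj.trans_le hi)).ne') hq

/-- A polynomial of degree less than `k` does not vanish at all Gauss nodes. -/
lemma exists_eval_ne_zero (G : IsGaussRule hn k T w) {P : ℝ[X]} (hP0 : P ≠ 0)
    (hP : P.degree < k) : ∃ t ∈ T, P.eval t ≠ 0 := by
  by_contra! h
  exact hP0 (eq_zero_of_degree_lt_of_eval_finset_eq_zero T (by rwa [G.card]) h)

/-- For `i < k` all zeros of `P_i^{1,ℓ}` are in every interval containing the Gauss nodes. -/
lemma monicEll_eq_prod (G : IsGaussRule hn k T w) {a b : ℝ} (hab : ∀ t ∈ T, t ∈ Set.Ioo a b)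
    (hℓ : ∀ t ∈ T, ℓ < t) {i : ℕ} (hi : i < k) :
    ∃ Z : Finset ℝ, (∀ z ∈ Z, z ∈ Set.Ioo a b) ∧ monicEll hn ℓ i = ∏ z ∈ Z, (X - C z) := by
  have hne := (monicEll_monic hn ℓ i).ne_zero
  obtain ⟨Z, hcard, hZ⟩ := G.exists_zeros hab (u := X - C ℓ) (P := monicEll hn ℓ i) (m := i)
    (fun t ht => by simpa using hℓ t ht)
    (G.exists_eval_ne_zero hne (by rw [monicEll_degree]; exact Nat.cast_lt.2 hi))
    (fun q hq => degree_mul_lt_of_le_of_lt (degree_X_sub_C_le' ℓ)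
      (degree_mul_lt_of_le_of_lt (monicEll_degree hn ℓ i).le hq le_rfl) (by omega))
    (fun q hq => by
      rw [← nuFunctional_apply]; exact G.monicEll_orthogonal hℓ hi.le hq)
  refine ⟨Z, fun z hz => (hZ z hz).1, ?_⟩
  have hdvd : ∏ z ∈ Z, (X - C z) ∣ monicEll hn ℓ i := by
    refine (Multiset.prod_X_sub_C_dvd_iff_le_roots hne Z.val).2 ?_
    exact (Multiset.le_iff_subset Z.nodup).2 fun z hz => (mem_roots hne).2 (hZ z hz).2
  refine eq_of_monic_of_dvd_of_natDegree_le (monic_prod_of_monic _ _ fun z _ => monic_X_sub_C z)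
    (monicEll_monic hn ℓ i) hdvd ?_
  rw [monicEll_natDegree, natDegree_prod _ _ fun z _ => X_sub_C_ne_zero z]
  simp [hcard]

lemma monicEll_eval_pos (G : IsGaussRule hn k T w) (hℓ : ∀ t ∈ T, ℓ < t) {x : ℝ}
    (hx : ∀ t ∈ T, t < x) {i : ℕ} (hi : i < k) : 0 < (monicEll hn ℓ i).eval x := by
  obtain ⟨Z, hZ, h⟩ := G.monicEll_eq_prod (fun t ht => ⟨hℓ t ht, hx t ht⟩) hℓ hi
  rw [h, eval_prod]
  refine Finset.prod_pos fun z hz => ?_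
  simpa using (hZ z hz).2

/-- The Krein condition places all zeros of `P_k^{1,ℓ}` to the left of `1`, and only one of them is
to the right of the Gauss nodes. -/
lemma monicEll_last (G : IsGaussRule hn k T w) (hk : 1 ≤ k) (hℓ : ∀ t ∈ T, ℓ < t)
    (hs : ∀ t ∈ T, t < s) (hs' : s < largestZero (ellPoly n ℓ k))
    (hKrein : StrengthenedKrein n k ℓ) :
    s < 1 ∧ 0 < (monicEll hn ℓ k).eval 1 ∧ (monicEll hn ℓ k).eval s < 0 := by
  have hne := (monicEll_monic hn ℓ k).ne_zero
  have hlc := (hKrein k le_rfl 0 (by omega) (by omega)).leadingCoeff_pos hn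
  rw [ellPoly_zero hn, mul_one, leadingCoeff_mul, leadingCoeff_X_sub_C, one_mul, ellPoly_eq hn,
    leadingCoeff_mul, leadingCoeff_C, (monicEll_monic hn ℓ k).leadingCoeff, mul_one, inv_pos] at hlc
  have hroot : ∀ x, (ellPoly n ℓ k).IsRoot x ↔ (monicEll hn ℓ k).IsRoot x := by
    intro x
    rw [ellPoly_eq hn, IsRoot.def, eval_mul, eval_C, mul_eq_zero, or_iff_right (inv_pos.2 hlc).ne',
      IsRoot.def]
  have hbig : ∀ x, (monicEll hn ℓ k).IsRoot x → ∃ z, (monicEll hn ℓ k).IsRoot z ∧ s < z := by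
    intro x hx
    obtain ⟨z, hz, hsz⟩ := exists_lt_of_lt_csSup ⟨x, (hroot x).2 hx⟩ hs'
    exact ⟨z, (hroot z).1 hz, hsz⟩
  have hab : ∀ t ∈ T, t ∈ Set.Ioo ℓ (min s 1) := fun t ht =>
    ⟨hℓ t ht, lt_min (hs t ht) (G.mem t ht).2⟩
  -- a polynomial with `k` zeros at the Gauss nodes has no zero beyond `s`
  have hnodes : ∃ t ∈ T, (monicEll hn ℓ k).eval t ≠ 0 := by
    by_contra! hall
    have hTne : T.Nonempty := by
      rw [← Finset.card_pos, G.card]; omega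
    obtain ⟨t₀, ht₀⟩ := hTne
    obtain ⟨z, hz, hsz⟩ := hbig t₀ (hall t₀ ht₀)
    have hz' : z ∉ T := fun h => absurd (hs z h) (by linarith)
    refine hne (eq_zero_of_degree_lt_of_eval_finset_eq_zero (insert z T) ?_ ?_)
    · rw [monicEll_degree, Finset.card_insert_of_notMem hz', G.card]
      exact Nat.cast_lt.2 (by omega)
    · intro t ht
      rcases Finset.mem_insert.1 ht with rfl | ht
      · exact hz
      · exact hall t ht
  obtain ⟨Z, hcard, hZ⟩ := G.exists_zeros hab (u := X - C ℓ) (P := monicEll hn ℓ k) (m := k - 1)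
    (fun t ht => by simpa using hℓ t ht) hnodes
    (fun q hq => degree_mul_lt_of_le_of_lt (degree_X_sub_C_le' ℓ)
      (degree_mul_lt_of_le_of_lt (monicEll_degree hn ℓ k).le hq le_rfl) (by omega))
    (fun q hq => by
      rw [← nuFunctional_apply]
      exact G.monicEll_orthogonal hℓ le_rfl (hq.trans_le (Nat.cast_le.2 (by omega))))
  obtain ⟨q, hq⟩ : ∏ z ∈ Z, (X - C z) ∣ monicEll hn ℓ k := by
    refine (Multiset.prod_X_sub_C_dvd_iff_le_roots hne Z.val).2 ?_
    exact (Multiset.le_iff_subset Z.nodup).2 fun z hz => (mem_roots hne).2 (hZ z hz).2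
  have hprod : (∏ z ∈ Z, (X - C z)).Monic := monic_prod_of_monic _ _ fun z _ => monic_X_sub_C z
  have hqm : q.Monic := hprod.of_mul_monic_left (hq ▸ monicEll_monic hn ℓ k)
  have hqd : q.natDegree = 1 := by
    have h1 := hprod.natDegree_mul hqm
    rw [← hq, monicEll_natDegree, natDegree_prod _ _ fun z _ => X_sub_C_ne_zero z] at h1
    simp [hcard] at h1
    omega
  obtain ⟨z₀, rfl⟩ : ∃ z₀, q = X - C z₀ :=
    ⟨-q.coeff 0, by rw [hqm.eq_X_add_C hqd]; simp⟩
  obtain ⟨z, hz, hsz⟩ := hbig z₀ (by rw [hq, IsRoot.def, eval_mul]; simp)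
  have hzz : z = z₀ := by
    rw [hq, IsRoot.def, eval_mul, mul_eq_zero, eval_prod] at hz
    rcases hz with hz | hz
    · obtain ⟨y, hy, hy0⟩ := Finset.prod_eq_zero_iff.1 hz
      have := (lt_min_iff.1 (hZ y hy).1.2).1
      simp only [eval_sub, eval_X, eval_C] at hy0
      linarith
    · simp only [eval_sub, eval_X, eval_C] at hz
      linarith
  subst hzz
  have hpos : ∀ x, min s 1 ≤ x → 0 < (∏ z ∈ Z, (X - C z)).eval x := fun x hx => by
    rw [eval_prod]
    refine Finset.prod_pos fun y hy => ?_
    have := (hZ y hy).1.2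
    simp only [eval_sub, eval_X, eval_C]
    linarith
  have hz1 : z < 1 := by
    have h1 := hlc
    rw [hq, eval_mul] at h1
    have := (pos_iff_pos_of_mul_pos h1).1 (hpos 1 (min_le_right _ _))
    simp only [eval_sub, eval_X, eval_C] at this
    linarith
  refine ⟨hsz.trans hz1, hlc, ?_⟩
  rw [hq, eval_mul]
  refine mul_neg_of_pos_of_neg (hpos s (min_le_left _ _)) ?_
  simp only [eval_sub, eval_X, eval_C]
  linarith

end IsGaussRule

end

section

variable {n : ℕ} {hn : 2 ≤ n} {k : ℕ} {T : Finset ℝ} {w : ℝ → ℝ} {ℓ s : ℝ}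

/-! ### The kernel and the Radau quadrature -/

lemma StrengthenedKrein.monicEll (hK : StrengthenedKrein n k ℓ)
    (he : ∀ i ≤ k, 0 < (monicEll hn ℓ i).eval 1) {i j : ℕ} (hi : i ≤ k) (hj : j ≤ k)
    (hij : ¬(i = k ∧ j = k)) :
    PosDef n (fun t => ((X - C ℓ) * (SphericalLP.monicEll hn ℓ i *
      SphericalLP.monicEll hn ℓ j)).eval t) ∧
    0 < mean hn ((X - C ℓ) * (SphericalLP.monicEll hn ℓ i * SphericalLP.monicEll hn ℓ j)) := by
  have h := hK i hi j hj hij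
  have e : (X - C ℓ) * (SphericalLP.monicEll hn ℓ i * SphericalLP.monicEll hn ℓ j)
      = C ((SphericalLP.monicEll hn ℓ i).eval 1 * (SphericalLP.monicEll hn ℓ j).eval 1)
        * ((X - C ℓ) * ellPoly n ℓ i * ellPoly n ℓ j) := by
    have h1 : ∀ i ≤ k, SphericalLP.monicEll hn ℓ i
        = C ((SphericalLP.monicEll hn ℓ i).eval 1) * ellPoly n ℓ i := fun i hi => by
      rw [ellPoly_eq hn, ← mul_assoc, ← C_mul, mul_inv_cancel₀ (he i hi).ne', C_1, one_mul]
    conv_lhs => rw [h1 i hi, h1 j hj]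
    rw [C_mul]; ring
  have hpos := mul_pos (he i hi) (he j hj)
  refine ⟨?_, ?_⟩
  · rw [e]; exact PosDef.C_mul hn h.1 hpos.le
  · rw [e, ← smul_eq_C_mul, map_smul, smul_eq_mul, ← gegenbauerCoeff_zero hn]
    exact mul_pos hpos (h.2 0 (Nat.zero_le _))

lemma ellKernel_eq (he : ∀ i < k, (monicEll hn ℓ i).eval 1 ≠ 0) : ellKernel n k ℓ s
    = ∑ j ∈ Finset.range k, C ((monicEll hn ℓ j).eval s /
        nuFunctional hn ℓ (monicEll hn ℓ j * monicEll hn ℓ j)) * monicEll hn ℓ j := by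
  rw [ellKernel]
  refine Finset.sum_congr rfl fun j hj => ?_
  have h := he j (Finset.mem_range.1 hj)
  have hν : ∀ (a : ℝ) (p : ℝ[X]), nuFunctional hn ℓ (C a * p) = a * nuFunctional hn ℓ p :=
    fun a p => by rw [← smul_eq_C_mul, map_smul, smul_eq_mul]
  rw [nuIntegral_eq hn, ellPoly_eq hn, pow_two, mul_mul_mul_comm, ← C_mul, hν, eval_mul, eval_C,
    ← mul_assoc, ← C_mul, mul_inv, mul_inv, inv_inv]
  congr 2
  field_simp

namespace IsGaussRule

/-- The kernel reproduces the values at `s` of polynomials of degree less than `k`. -/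
lemma nuFunctional_ellKernel_mul (G : IsGaussRule hn k T w) (hℓ : ∀ t ∈ T, ℓ < t) {q : ℝ[X]}
    (hq : q.degree < k) : nuFunctional hn ℓ (ellKernel n k ℓ s * q) = q.eval s := by
  have he : ∀ i < k, (monicEll hn ℓ i).eval 1 ≠ 0 := fun i hi =>
    (G.monicEll_eval_pos hℓ (fun t ht => (G.mem t ht).2) hi).ne'
  have key := eq_zero_of_monic_basis
    ((nuFunctional hn ℓ).comp (LinearMap.mulLeft ℝ (ellKernel n k ℓ s)) - leval s)
    (monicEll hn ℓ) (fun i => ⟨monicEll_monic hn ℓ i, monicEll_degree hn ℓ i⟩) k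
    (fun j hj => by
      rw [LinearMap.sub_apply, LinearMap.comp_apply, LinearMap.mulLeft_apply, leval_apply,
        ellKernel_eq he, Finset.sum_mul, map_sum, Finset.sum_eq_single j]
      · rw [mul_assoc, ← smul_eq_C_mul, map_smul, smul_eq_mul,
          div_mul_cancel₀ _ (G.monicEll_sq_pos hℓ hj).ne', sub_self]
      · intro i hi hij
        have hi := Finset.mem_range.1 hi
        rw [mul_assoc, ← smul_eq_C_mul, map_smul]
        rcases lt_or_gt_of_ne hij with h | h
        · rw [mul_comm (monicEll hn ℓ i) (monicEll hn ℓ j), G.monicEll_orthogonal hℓ hj.le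
            (by rw [monicEll_degree]; exact Nat.cast_lt.2 h), smul_zero]
        · rw [G.monicEll_orthogonal hℓ hi.le (q := monicEll hn ℓ j)
            (by rw [monicEll_degree]; exact Nat.cast_lt.2 h), smul_zero]
      · exact fun h => absurd (Finset.mem_range.2 hj) h) q hq
  exact sub_eq_zero.1 key

/-- The kernel is a positive multiple of `∏ (X - z)` over `k - 1` points `z` between `ℓ` and `s`. -/
lemma ellKernel_eq_prod (G : IsGaussRule hn k T w) (hk : 1 ≤ k) (hℓ : ∀ t ∈ T, ℓ < t)
    (hs : ∀ t ∈ T, t < s) :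
    ∃ (Z : Finset ℝ) (c : ℝ), Z.card = k - 1 ∧ (∀ z ∈ Z, z ∈ Set.Ioo ℓ s) ∧ 0 < c ∧
      ellKernel n k ℓ s = C c * ∏ z ∈ Z, (X - C z) := by
  have he : ∀ i < k, (monicEll hn ℓ i).eval 1 ≠ 0 := fun i hi =>
    (G.monicEll_eval_pos hℓ (fun t ht => (G.mem t ht).2) hi).ne'
  set c := (monicEll hn ℓ (k - 1)).eval s /
    nuFunctional hn ℓ (monicEll hn ℓ (k - 1) * monicEll hn ℓ (k - 1)) with hc
  have hcpos : 0 < c :=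
    div_pos (G.monicEll_eval_pos hℓ hs (by omega)) (G.monicEll_sq_pos hℓ (by omega))
  have hdeg : (ellKernel n k ℓ s).natDegree ≤ k - 1 := by
    rw [ellKernel_eq he]
    refine natDegree_sum_le_of_forall_le _ _ fun j hj => (natDegree_C_mul_le _ _).trans ?_
    rw [monicEll_natDegree]
    have := Finset.mem_range.1 hj
    omega
  have hcoeff : (ellKernel n k ℓ s).coeff (k - 1) = c := by
    rw [ellKernel_eq he, finsetSum_coeff, Finset.sum_eq_single (k - 1)]
    · have := (monicEll_monic hn ℓ (k - 1)).coeff_natDegree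
      rw [monicEll_natDegree] at this
      rw [coeff_C_mul, this, mul_one]
    · intro j hj hne
      have := Finset.mem_range.1 hj
      rw [coeff_C_mul, coeff_eq_zero_of_natDegree_lt (by rw [monicEll_natDegree]; omega), mul_zero]
    · exact fun h => absurd (Finset.mem_range.2 (by omega)) h
  have hK0 : ellKernel n k ℓ s ≠ 0 := fun h => by
    rw [h, coeff_zero] at hcoeff
    exact hcpos.ne hcoeff
  have hdegK : (ellKernel n k ℓ s).degree ≤ (k - 1 : ℕ) := degree_le_of_natDegree_le hdeg
  obtain ⟨Z, hcard, hZ⟩ := G.exists_zeros (fun t ht => ⟨hℓ t ht, hs t ht⟩)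
    (u := (X - C ℓ) * (C s - X)) (P := ellKernel n k ℓ s) (m := k - 1)
    (fun t ht => by
      have h1 := hℓ t ht
      have h2 := hs t ht
      simp only [eval_mul, eval_sub, eval_X, eval_C]
      exact mul_pos (by linarith) (by linarith))
    (G.exists_eval_ne_zero hK0 (hdegK.trans_lt (Nat.cast_lt.2 (by omega))))
    (fun q hq => by
      rw [mul_assoc]
      refine degree_mul_lt_of_le_of_lt (b := 2 * k - 1) (degree_X_sub_C_le' ℓ)
        (degree_mul_lt_of_le_of_lt (a := 1) (b := 2 * k - 2) ?_
          (degree_mul_lt_of_le_of_lt hdegK hq (by omega)) (by omega)) (by omega)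
      rw [← neg_sub, degree_neg]
      exact degree_X_sub_C_le' s)
    (fun q hq => by
      have h := G.nuFunctional_ellKernel_mul (s := s) hℓ (q := (C s - X) * q)
        (degree_mul_lt_of_le_of_lt (a := 1) (by
          rw [← neg_sub, degree_neg]; exact degree_X_sub_C_le' s) hq (by omega))
      rw [nuFunctional_apply] at h
      simp only [eval_mul, eval_sub, eval_X, eval_C, sub_self, zero_mul] at h
      rw [← h]
      congr 1
      ring)
  refine ⟨Z, c, hcard, fun z hz => (hZ z hz).1, hcpos, ?_⟩
  obtain ⟨q, hq⟩ : ∏ z ∈ Z, (X - C z) ∣ ellKernel n k ℓ s := by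
    refine (Multiset.prod_X_sub_C_dvd_iff_le_roots hK0 Z.val).2 ?_
    exact (Multiset.le_iff_subset Z.nodup).2 fun z hz => (mem_roots hK0).2 (hZ z hz).2
  have hprod : (∏ z ∈ Z, (X - C z)).Monic := monic_prod_of_monic _ _ fun z _ => monic_X_sub_C z
  have hpd : (∏ z ∈ Z, (X - C z)).natDegree = k - 1 := by
    rw [natDegree_prod _ _ fun z _ => X_sub_C_ne_zero z]
    simp [hcard]
  have hq0 : q ≠ 0 := fun h => hK0 (by rw [hq, h, mul_zero])
  have hqd : q.natDegree = 0 := by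
    rw [hq, hprod.natDegree_mul' hq0, hpd] at hdeg
    omega
  rw [eq_C_of_natDegree_eq_zero hqd, mul_comm] at hq
  rw [hq, coeff_C_mul] at hcoeff
  have h1 := hprod.coeff_natDegree
  rw [hpd] at h1
  rw [h1, mul_one] at hcoeff
  rw [hq, hcoeff]

end IsGaussRule

/-- The product `∏_{1 ≤ i ≤ m} (X - β_i)`. -/
def nodeProd (β : ℕ → ℝ) (m : ℕ) : ℝ[X] := ∏ i ∈ Finset.range m, (X - C (β (i + 1)))

lemma nodeProd_succ (β : ℕ → ℝ) (m : ℕ) :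
    nodeProd β (m + 1) = nodeProd β m * (X - C (β (m + 1))) :=
  Finset.prod_range_succ _ _

lemma nodeProd_monic (β : ℕ → ℝ) (m : ℕ) : (nodeProd β m).Monic :=
  monic_prod_of_monic _ _ fun _ _ => monic_X_sub_C _

lemma nodeProd_degree (β : ℕ → ℝ) (m : ℕ) : (nodeProd β m).degree = m := by
  rw [nodeProd, degree_prod]
  simp

lemma nodeProd_eval_eq_zero (β : ℕ → ℝ) {m i : ℕ} (hi : 1 ≤ i) (him : i ≤ m) :
    (nodeProd β m).eval (β i) = 0 := by
  rw [nodeProd, eval_prod]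
  refine Finset.prod_eq_zero (Finset.mem_range.2 (by omega : i - 1 < m)) ?_
  rw [Nat.sub_add_cancel hi]
  simp

lemma exists_nodes (hk : 1 ≤ k) {Z : Finset ℝ} (hcard : Z.card = k - 1)
    (hZ : ∀ z ∈ Z, z ∈ Set.Ioo ℓ s) (hℓs : ℓ < s) (hs1 : s < 1) :
    ∃ β : ℕ → ℝ, StrictMonoOn β (Set.Iic (k + 1)) ∧ β 0 = ℓ ∧ β k = s ∧ β (k + 1) = 1 ∧
      (∀ x, x ∈ Z ↔ ∃ i, 1 ≤ i ∧ i ≤ k - 1 ∧ β i = x) ∧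
      ∏ z ∈ Z, (X - C z) = nodeProd β (k - 1) := by
  set b := Z.orderEmbOfFin hcard with hb
  have hbmem : ∀ j, b j ∈ Z := fun j => Z.orderEmbOfFin_mem hcard j
  set β : ℕ → ℝ := fun i => if i = 0 then ℓ else
    if h : i - 1 < k - 1 then b ⟨i - 1, h⟩ else if i = k then s else 1 with hβ
  have h0 : β 0 = ℓ := by simp [hβ]
  have hin : ∀ i (h : i < k - 1), β (i + 1) = b ⟨i, h⟩ := fun i h => by
    simp [hβ, h]
  have hks : β k = s := by
    simp only [hβ]
    rw [if_neg (by omega), dif_neg (by omega), if_true]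
  have hk1 : β (k + 1) = 1 := by
    simp only [hβ]
    rw [if_neg (by omega), dif_neg (by omega), if_neg (by omega)]
  refine ⟨β, ?_, h0, hks, hk1, fun x => ⟨fun hx => ?_, ?_⟩, ?_⟩
  · refine strictMonoOn_of_lt_succ Set.ordConnected_Iic fun i _ hi hi1 => ?_
    simp only [Nat.succ_eq_succ, Nat.succ_eq_add_one, Set.mem_Iic] at hi hi1 ⊢
    rcases Nat.eq_zero_or_pos i with rfl | hpos
    · rw [h0]
      by_cases h : 0 < k - 1
      · rw [hin 0 h]; exact (hZ _ (hbmem _)).1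
      · obtain rfl : k = 1 := by omega
        rw [hks]; exact hℓs
    · obtain ⟨i, rfl⟩ := Nat.exists_eq_add_of_le' hpos
      rcases lt_trichotomy (i + 1) k with h | h | h
      · rw [hin i (by omega)]
        by_cases h' : i + 1 < k - 1
        · rw [hin (i + 1) h']
          exact b.strictMono (by simp)
        · rw [show i + 1 + 1 = k by omega, hks]
          exact (hZ _ (hbmem _)).2
      · rw [h, hks, hk1]; exact hs1
      · omega
  · have : x ∈ Set.range b := by rw [hb, Finset.range_orderEmbOfFin]; exact hx
    obtain ⟨j, rfl⟩ := this
    exact ⟨j + 1, by omega, by have := j.isLt; omega, hin j j.isLt⟩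
  · rintro ⟨i, h1, h2, rfl⟩
    obtain ⟨i, rfl⟩ := Nat.exists_eq_add_of_le' h1
    rw [hin i (by omega)]
    exact hbmem _
  · rw [nodeProd, Finset.prod_range]
    have hmap : Z = Finset.univ.map b.toEmbedding := (Z.map_orderEmbOfFin_univ hcard).symm
    conv_lhs => rw [hmap]
    rw [Finset.prod_map]
    refine Finset.prod_congr rfl fun j _ => ?_
    rw [hin j j.isLt]
    rfl

namespace IsGaussRule

/-- Quasi-orthogonality: `∏_{1 ≤ i ≤ k} (X - β_i)` is a positive combination of `P_k^{1,ℓ}` and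
`P_{k-1}^{1,ℓ}`, up to normalization. -/
lemma nodeProd_last (G : IsGaussRule hn k T w) (hk : 1 ≤ k) (hℓ : ∀ t ∈ T, ℓ < t)
    (hs : ∀ t ∈ T, t < s) (hneg : (monicEll hn ℓ k).eval s < 0) {β : ℕ → ℝ} (hβs : β k = s)
    {c : ℝ} (hc : 0 < c) (hK : ellKernel n k ℓ s = C c * nodeProd β (k - 1)) :
    (∀ q : ℝ[X], q.degree < (k - 1 : ℕ) → nuFunctional hn ℓ (nodeProd β k * q) = 0) ∧
    ∃ b : ℝ, 0 < b ∧ nodeProd β k = monicEll hn ℓ k + C b * monicEll hn ℓ (k - 1) := by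
  have hstep : nodeProd β k = nodeProd β (k - 1) * (X - C s) := by
    obtain ⟨k, rfl⟩ := Nat.exists_eq_add_of_le' hk
    rw [nodeProd_succ, hβs, Nat.add_sub_cancel]
  have horth : ∀ q : ℝ[X], q.degree < (k - 1 : ℕ) →
      nuFunctional hn ℓ (nodeProd β k * q) = 0 := by
    intro q hq
    have h := G.nuFunctional_ellKernel_mul (s := s) hℓ (q := (X - C s) * q)
      (degree_mul_lt_of_le_of_lt (degree_X_sub_C_le' s) hq (by omega))
    rw [hK, mul_assoc, ← mul_assoc (nodeProd β (k - 1)), ← hstep, ← smul_eq_C_mul, map_smul,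
      eval_mul, eval_sub, eval_X, eval_C, sub_self, zero_mul, smul_eq_mul] at h
    exact (mul_eq_zero.1 h).resolve_left hc.ne'
  refine ⟨horth, ?_⟩
  have hd : (nodeProd β k - monicEll hn ℓ k).degree < (k - 1 + 1 : ℕ) := by
    rw [Nat.sub_add_cancel hk, ← nodeProd_degree β k]
    refine degree_sub_lt_left ?_ (nodeProd_monic β k).ne_zero ?_
    · rw [nodeProd_degree, monicEll_degree]
    · rw [(nodeProd_monic β k).leadingCoeff, (monicEll_monic hn ℓ k).leadingCoeff]
  have h := eq_C_mul_of_orthogonal (nuFunctional hn ℓ) (monicEll_monic hn ℓ (k - 1))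
    (monicEll_degree hn ℓ (k - 1)) (fun q hq => G.monicEll_orthogonal hℓ (by omega) hq) hd
    (fun q hq => by
      rw [sub_mul, map_sub, horth q hq, G.monicEll_orthogonal hℓ le_rfl
        (hq.trans_le (Nat.cast_le.2 (by omega))), sub_zero])
    (fun e he0 he => G.nuFunctional_pos hℓ he0 (he.trans_le (Nat.cast_le.2 (by omega))))
  refine ⟨_, ?_, (sub_eq_iff_eq_add'.1 h)⟩
  -- both sides vanish at `s`, where `P_k^{1,ℓ}` and `P_{k-1}^{1,ℓ}` have opposite signs
  have hev := congrArg (eval s) h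
  rw [eval_sub, eval_mul, eval_C, ← hβs, nodeProd_eval_eq_zero β hk le_rfl, hβs, zero_sub] at hev
  have hp := G.monicEll_eval_pos hℓ hs (i := k - 1) (by omega)
  exact (pos_iff_pos_of_mul_pos (by rw [← hev]; linarith)).2 hp

end IsGaussRule

/-- A quadrature weight is positive as soon as some polynomial with positive mean vanishes at the
other nodes and is nonnegative at the given one. -/
lemma weight_pos_of_test {N : ℕ} {β ρ : ℕ → ℝ} {i : ℕ} (hi : i < N) {p : ℝ[X]} {I : ℝ}
    (hI : 0 < I) (hquad : I = ∑ j ∈ Finset.range N, ρ j * p.eval (β j))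
    (h0 : ∀ j < N, j ≠ i → p.eval (β j) = 0) (hpos : 0 ≤ p.eval (β i)) : 0 < ρ i := by
  rw [Finset.sum_eq_single i (fun j hj hne => by rw [h0 j (Finset.mem_range.1 hj) hne, mul_zero])
    (fun h => absurd (Finset.mem_range.2 hi) h)] at hquad
  rw [hquad] at hI
  by_contra! h
  exact absurd hI (not_lt.2 (mul_nonpos_of_nonpos_of_nonneg h hpos))

lemma natDegree_le_of_degree_lt_succ {p : ℝ[X]} {m : ℕ} (h : p.degree < (m + 1 : ℕ)) :
    p.natDegree ≤ m := by
  refine natDegree_le_of_degree_le ?_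
  by_cases h0 : p = 0
  · simp [h0]
  rw [degree_eq_natDegree h0] at h ⊢
  norm_cast at h ⊢
  omega

/-- The Radau quadrature, with what its nodes say about `P_{k-1}^{1,ℓ,s}` and the `P_i^{1,ℓ}`. -/
lemma IsGaussRule.exists_radau (G : IsGaussRule hn k T w) (hk : 1 ≤ k) (hℓ : ∀ t ∈ T, ℓ < t)
    (hs : ∀ t ∈ T, t < s) (hs' : s < largestZero (ellPoly n ℓ k))
    (hKrein : StrengthenedKrein n k ℓ) :
    ∃ β ρ : ℕ → ℝ, IsRadauQuadrature n k ℓ s β ρ ∧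
      (∃ c : ℝ, 0 < c ∧ ellSPoly n k ℓ s = C c * nodeProd β (k - 1)) ∧
      (∃ b : ℝ, 0 < b ∧ nodeProd β k = monicEll hn ℓ k + C b * monicEll hn ℓ (k - 1)) ∧
      0 < mean hn (levPoly n k ℓ s) := by
  classical
  obtain ⟨hs1, he1, hneg⟩ := G.monicEll_last hk hℓ hs hs' hKrein
  have he : ∀ i ≤ k, 0 < (monicEll hn ℓ i).eval 1 := fun i hi => by
    rcases hi.eq_or_lt with rfl | hi
    · exact he1
    · exact G.monicEll_eval_pos hℓ (fun t ht => (G.mem t ht).2) hi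
  have hℓs : ℓ < s := by
    obtain ⟨t, ht⟩ : T.Nonempty := by rw [← Finset.card_pos, G.card]; omega
    exact (hℓ t ht).trans (hs t ht)
  obtain ⟨Z, c, hcard, hZ, hc, hK⟩ := G.ellKernel_eq_prod hk hℓ hs
  obtain ⟨β, hmono, hβ0, hβk, hβ1, hβZ, hprod⟩ := exists_nodes hk hcard hZ hℓs hs1
  rw [hprod] at hK
  obtain ⟨horth, b, hb, hlast⟩ := G.nodeProd_last hk hℓ hs hneg hβk hc hK
  have hstep : nodeProd β k = nodeProd β (k - 1) * (X - C s) := by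
    obtain ⟨k, rfl⟩ := Nat.exists_eq_add_of_le' hk
    rw [nodeProd_succ, hβk, Nat.add_sub_cancel]
  have hlt : ∀ i j, i < j → j ≤ k + 1 → β i < β j := fun i j hij hj =>
    hmono (Set.mem_Iic.2 (by omega)) (Set.mem_Iic.2 hj) hij
  -- the normalizing factor
  have hAone : 0 < (nodeProd β (k - 1)).eval 1 := by
    rw [nodeProd, eval_prod]
    refine Finset.prod_pos fun i hi => ?_
    have := hlt (i + 1) (k + 1) (by have := Finset.mem_range.1 hi; omega) le_rfl
    simp only [eval_sub, eval_X, eval_C]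
    linarith
  have hS : ellSPoly n k ℓ s
      = C ((nodeProd β (k - 1)).eval 1)⁻¹ * nodeProd β (k - 1) := by
    rw [ellSPoly, normalizeAtOne, hK, ← mul_assoc, ← C_mul, eval_mul, eval_C]
    congr 2
    field_simp
  set c' := ((nodeProd β (k - 1)).eval 1)⁻¹ with hc'
  have hc'pos : 0 < c' := inv_pos.2 hAone
  -- positivity of the mean of the test polynomial, from the Krein condition
  have hmean : 0 < mean hn ((X - C ℓ) * (nodeProd β (k - 1) * nodeProd β k)) := by
    have hA : nodeProd β (k - 1) = ∑ j ∈ Finset.range k, C (c⁻¹ * ((monicEll hn ℓ j).eval s /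
        nuFunctional hn ℓ (monicEll hn ℓ j * monicEll hn ℓ j))) * monicEll hn ℓ j := by
      simp only [C_mul, mul_assoc]
      rw [← Finset.mul_sum]
      have := ellKernel_eq (s := s) (hn := hn) (ℓ := ℓ) (k := k) fun i hi => (he i hi.le).ne'
      simp only [← this, hK]
      rw [← mul_assoc, ← C_mul, inv_mul_cancel₀ hc.ne', C_1, one_mul]
    rw [hA, hlast, Finset.sum_mul, Finset.mul_sum, map_sum]
    refine Finset.sum_pos (fun j hj => ?_) ⟨0, Finset.mem_range.2 (by omega)⟩
    have hj := Finset.mem_range.1 hj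
    have h1 := (hKrein.monicEll (hn := hn) he hj.le le_rfl (by omega)).2
    have h2 := (hKrein.monicEll (hn := hn) he hj.le (by omega : k - 1 ≤ k) (by omega)).2
    have h3 : 0 < c⁻¹ * ((monicEll hn ℓ j).eval s /
        nuFunctional hn ℓ (monicEll hn ℓ j * monicEll hn ℓ j)) :=
      mul_pos (inv_pos.2 hc) (div_pos (G.monicEll_eval_pos hℓ hs hj) (G.monicEll_sq_pos hℓ hj))
    generalize c⁻¹ * ((monicEll hn ℓ j).eval s /
        nuFunctional hn ℓ (monicEll hn ℓ j * monicEll hn ℓ j)) = a at h3 ⊢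
    have h4 : (X - C ℓ) * (C a * monicEll hn ℓ j *
        (monicEll hn ℓ k + C b * monicEll hn ℓ (k - 1)))
        = a • ((X - C ℓ) * (monicEll hn ℓ j * monicEll hn ℓ k))
          + (a * b) • ((X - C ℓ) * (monicEll hn ℓ j * monicEll hn ℓ (k - 1))) := by
      rw [smul_eq_C_mul, smul_eq_C_mul, C_mul]; ring
    rw [h4, map_add, map_smul, map_smul, smul_eq_mul, smul_eq_mul]
    positivity
  have hlev : levPoly n k ℓ s
      = (c' ^ 2) • ((X - C ℓ) * (nodeProd β (k - 1) * nodeProd β k)) := by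
    rw [levPoly, hS, hstep, smul_eq_C_mul, C_pow]
    ring
  -- the quadrature
  set ρ : ℕ → ℝ := fun i => mean hn (Lagrange.basis (Finset.range (k + 2)) β i) with hρ
  have hinj : Set.InjOn β (Finset.range (k + 2) : Set ℕ) := fun i hi j hj hij => by
    simp only [Finset.coe_range, Set.mem_Iio] at hi hj
    exact hmono.injOn (Set.mem_Iic.2 (by omega)) (Set.mem_Iic.2 (by omega)) hij
  have hnodal : Lagrange.nodal (Finset.range (k + 2)) β
      = (X - C ℓ) * nodeProd β k * (X - 1) := by
    rw [Lagrange.nodal, Finset.prod_range_succ, hβ1, C_1, Finset.prod_range_succ', hβ0,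
      mul_comm (∏ i ∈ Finset.range k, (X - C (β (i + 1))))]
    rfl
  have hexact : ∀ p : ℝ[X], p.natDegree ≤ 2 * k →
      mean hn p = ∑ i ∈ Finset.range (k + 2), ρ i * p.eval (β i) := by
    intro p hp
    refine quadrature_of_nodal_orthogonal (mean hn) (Finset.range (k + 2)) β hinj (d := k - 1)
      (fun q hq => ?_) ?_
    · have h := horth q hq
      rw [nuFunctional_apply] at h
      rw [hnodal, ← neg_eq_zero, ← map_neg, ← h]
      congr 1
      ring
    · refine (degree_le_of_natDegree_le hp).trans_lt (Nat.cast_lt.2 ?_)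
      rw [Finset.card_range]
      omega
  have hS1 : ∀ x : ℝ, (C s - X : ℝ[X]).eval x = s - x := fun x => by simp
  have hSd : (C s - X : ℝ[X]).degree ≤ (1 : ℕ) := by
    rw [← neg_sub, degree_neg]; exact degree_X_sub_C_le' s
  have h1d : (1 - X : ℝ[X]).degree ≤ (1 : ℕ) := by
    rw [← neg_sub, degree_neg, ← C_1]; exact degree_X_sub_C_le' 1
  have hAd := nodeProd_degree β (k - 1)
  have hAne := (nodeProd_monic β (k - 1)).ne_zero
  have hAlt : (nodeProd β (k - 1)).degree < k := by rw [hAd]; exact Nat.cast_lt.2 (by omega)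
  have hA2 : (nodeProd β (k - 1) * nodeProd β (k - 1)).degree < (2 * k - 1 : ℕ) :=
    degree_mul_lt_of_le_of_lt hAd.le hAlt (by omega)
  have hmid : ∀ i, 1 ≤ i → i < k → (nodeProd β (k - 1)).eval (β i) = 0 := fun i h1 h2 =>
    nodeProd_eval_eq_zero β h1 (by omega)
  have hpos : ∀ i ≤ k + 1, 0 < ρ i := by
    intro i hi
    rcases Nat.eq_zero_or_pos i with rfl | hi0
    · -- test polynomial `(1 - t) (s - t) A(t)²`
      have hd : ((C s - X) * (nodeProd β (k - 1) * nodeProd β (k - 1))).degree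
            < ((2 * k : ℕ) : WithBot ℕ) :=
        degree_mul_lt_of_le_of_lt hSd hA2 (by omega)
      refine weight_pos_of_test (N := k + 2) (by omega)
        (G.mean_pos (u := C s - X) (fun t ht => by rw [hS1]; linarith [hs t ht]) hAne hAlt hd)
        (hexact _ (natDegree_le_of_degree_lt_succ
          (degree_mul_lt_of_le_of_lt h1d hd (by omega)))) (fun j hj hne => ?_) ?_
      · rcases lt_trichotomy j k with h | h | h
        · rw [eval_mul, eval_mul, eval_mul, hmid j (by omega) h]; ring
        · rw [eval_mul, eval_mul, h, hβk, hS1]; ring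
        · rw [show j = k + 1 by omega, hβ1]; simp
      · simp only [eval_mul, hβ0, eval_sub, eval_one, eval_X, eval_C]
        exact mul_nonneg (by linarith) (mul_nonneg (by linarith) (mul_self_nonneg _))
    · rcases lt_trichotomy i k with hik | rfl | hik
      · -- test polynomial `(1 - t) (t - ℓ) (s - t) (A(t) / (t - β_i))²`
        have hmem : i - 1 ∈ Finset.range (k - 1) := Finset.mem_range.2 (by omega)
        set q : ℝ[X] := ∏ j ∈ (Finset.range (k - 1)).erase (i - 1), (X - C (β (j + 1))) with hq
        have hqm : q.Monic := monic_prod_of_monic _ _ fun _ _ => monic_X_sub_C _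
        have hqd : q.degree = (k - 2 : ℕ) := by
          rw [hq, degree_prod]
          simp only [degree_X_sub_C, Finset.sum_const, Finset.card_erase_of_mem hmem,
            Finset.card_range, nsmul_eq_mul, mul_one]
          rfl
        have hqlt : q.degree < (k - 1 : ℕ) := by rw [hqd]; exact Nat.cast_lt.2 (by omega)
        have hd : ((X - C ℓ) * (C s - X) * (q * q)).degree
            < ((2 * k : ℕ) : WithBot ℕ) := by
          rw [mul_assoc]
          exact degree_mul_lt_of_le_of_lt (b := 2 * k - 2) (degree_X_sub_C_le' ℓ)
            (degree_mul_lt_of_le_of_lt (b := 2 * k - 3) hSd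
              (degree_mul_lt_of_le_of_lt hqd.le hqlt (by omega)) (by omega)) (by omega)
        refine weight_pos_of_test (N := k + 2) (by omega)
          (G.mean_pos (u := (X - C ℓ) * (C s - X)) (fun t ht => by
            rw [eval_mul, hS1, eval_sub, eval_X, eval_C]
            exact mul_pos (by linarith [hℓ t ht]) (by linarith [hs t ht])) hqm.ne_zero
            (hqlt.trans_le (Nat.cast_le.2 (by omega))) hd)
          (hexact _ (natDegree_le_of_degree_lt_succ
            (degree_mul_lt_of_le_of_lt h1d hd (by omega)))) (fun j hj hne => ?_) ?_
        · rcases Nat.eq_zero_or_pos j with rfl | hj0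
          · simp [hβ0]
          rcases lt_trichotomy j k with h | h | h
          · have : q.eval (β j) = 0 := by
              rw [hq, eval_prod]
              refine Finset.prod_eq_zero (Finset.mem_erase.2
                ⟨(by omega : j - 1 ≠ i - 1), Finset.mem_range.2 (by omega)⟩) ?_
              rw [Nat.sub_add_cancel hj0]
              simp
            simp only [eval_mul, this]; ring
          · simp [h, hβk]
          · rw [show j = k + 1 by omega, hβ1]; simp
        · have h1 := hlt 0 i hi0 (by omega)
          have h2 := hlt i k hik (by omega)
          rw [hβ0] at h1
          rw [hβk] at h2
          simp only [eval_mul, eval_sub, eval_one, eval_X, eval_C]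
          exact mul_nonneg (by linarith) (mul_nonneg (mul_nonneg (by linarith) (by linarith))
            (mul_self_nonneg _))
      · -- test polynomial `(1 - t) (t - ℓ) A(t)²`
        have hd : ((X - C ℓ) * (nodeProd β (i - 1) * nodeProd β (i - 1))).degree
            < ((2 * i : ℕ) : WithBot ℕ) :=
          degree_mul_lt_of_le_of_lt (degree_X_sub_C_le' ℓ) hA2 (by omega)
        refine weight_pos_of_test (N := i + 2) (by omega)
          (G.mean_pos (u := X - C ℓ) (fun t ht => by
            rw [eval_sub, eval_X, eval_C]; linarith [hℓ t ht]) hAne hAlt hd)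
          (hexact _ (natDegree_le_of_degree_lt_succ
            (degree_mul_lt_of_le_of_lt h1d hd (by omega)))) (fun j hj hne => ?_) ?_
        · rcases Nat.eq_zero_or_pos j with rfl | hj0
          · simp [hβ0]
          rcases lt_trichotomy j i with h | h | h
          · rw [eval_mul, eval_mul, eval_mul, hmid j hj0 h]; ring
          · exact absurd h hne
          · rw [show j = i + 1 by omega, hβ1]; simp
        · simp only [eval_mul, hβk, eval_sub, eval_one, eval_X, eval_C]
          exact mul_nonneg (by linarith) (mul_nonneg (by linarith) (mul_self_nonneg _))
      · obtain rfl : i = k + 1 := by omega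
        have hkd : (nodeProd β k).degree < (k + 1 : ℕ) := by
          rw [nodeProd_degree]; exact Nat.cast_lt.2 (by omega)
        refine weight_pos_of_test (N := k + 2) (by omega) hmean
          (hexact _ (natDegree_le_of_degree_lt_succ (degree_mul_lt_of_le_of_lt (b := 2 * k)
            (degree_X_sub_C_le' ℓ) (degree_mul_lt_of_le_of_lt hAd.le hkd (by omega)) (by omega))))
          (fun j hj hne => ?_) ?_
        · rcases Nat.eq_zero_or_pos j with rfl | hj0
          · simp [hβ0]
          · simp only [eval_mul, nodeProd_eval_eq_zero β hj0 (by omega : j ≤ k), mul_zero]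
        · rw [hstep, hβ1]
          simp only [eval_mul, eval_sub, eval_X, eval_C]
          exact mul_nonneg (by linarith) (mul_nonneg hAone.le (mul_nonneg hAone.le (by linarith)))
  refine ⟨β, ρ, ⟨hmono, hβ0, hβk, hβ1, fun x => ?_, hpos, hexact⟩, ⟨c', hc'pos, hS⟩,
    ⟨b, hb, hlast⟩, ?_⟩
  · rw [← hβZ, hS, ← hprod, IsRoot.def, eval_mul, eval_C, mul_eq_zero, or_iff_right hc'pos.ne',
      eval_prod, Finset.prod_eq_zero_iff]
    simp only [eval_sub, eval_X, eval_C, sub_eq_zero]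
    exact ⟨fun ⟨z, hz, h⟩ => h ▸ hz, fun h => ⟨x, h, rfl⟩⟩
  · rw [hlev, map_smul, smul_eq_mul]
    exact mul_pos (pow_pos hc'pos 2) hmean

end

/-! ### Positivity of products over the first nodes -/

/-- Let `P` be the monic orthogonal polynomial of some degree for a positive measure on the nodes
`β_0 < ⋯ < β_{N-1}`. Then `P` has nonnegative integral against `∏_{i < m} (X - β_i)`. Passing to
the positive measure `(t - β_0) dτ` on the other nodes, `P` becomes a nonnegative combination of
two consecutive orthogonal polynomials, and `m` decreases by one. -/
lemma discreteFunctional_mul_prod_nonneg (m : ℕ) : ∀ (N : ℕ) (β w : ℕ → ℝ),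
    StrictMonoOn β (Set.Iio N) → (∀ i < N, 0 < w i) → ∀ (j : ℕ) (P : ℝ[X]), P.Monic →
    P.degree = j → (∀ q : ℝ[X], q.degree < j →
      discreteFunctional (Finset.range N) β w (P * q) = 0) →
    0 ≤ discreteFunctional (Finset.range N) β w
      (P * ∏ i ∈ Finset.range m, (X - C (β i))) := by
  induction m with
  | zero =>
    intro N β w _ hw j P hP hPd horth
    rcases Nat.eq_zero_or_pos j with rfl | hj
    · have : P = 1 := by
        rw [eq_C_of_degree_eq_zero hPd, ← C_1]
        have := hP.coeff_natDegree
        rw [natDegree_eq_of_degree_eq_some hPd] at this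
        rw [this]
      rw [this, discreteFunctional_apply]
      refine Finset.sum_nonneg fun i hi => ?_
      simpa using (hw i (Finset.mem_range.1 hi)).le
    · rw [Finset.prod_range_zero, horth 1 (by rw [degree_one]; exact Nat.cast_pos.2 hj)]
  | succ m ih =>
    intro N β w hβ hw j P hP hPd horth
    have hinj : Set.InjOn β (Finset.range N : Set ℕ) := fun a ha b hb h =>
      hβ.injOn (by simpa using ha) (by simpa using hb) h
    -- an orthogonal polynomial of degree at least `N` vanishes at all nodes
    by_cases hjN : N ≤ j
    · have hzero : ∀ i ∈ Finset.range N, P.eval (β i) = 0 := by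
        intro i hi
        have hi' := Finset.mem_range.1 hi
        have h := horth (Lagrange.basis (Finset.range N) β i) (by
          rw [Lagrange.degree_basis hinj hi, Finset.card_range]
          exact Nat.cast_lt.2 (by omega))
        rw [discreteFunctional_apply, Finset.sum_eq_single i] at h
        · rw [eval_mul, Lagrange.eval_basis_self hinj hi, mul_one] at h
          exact (mul_eq_zero.1 h).resolve_left (hw i hi').ne'
        · intro i' hi' hne
          rw [eval_mul, Lagrange.eval_basis_of_ne hne.symm hi', mul_zero, mul_zero]
        · exact fun h' => absurd hi h'
      rw [discreteFunctional_apply, Finset.sum_eq_zero]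
      intro i hi
      rw [eval_mul, hzero i hi]; ring
    obtain ⟨N, rfl⟩ : ∃ N', N = N' + 1 := ⟨N - 1, by omega⟩
    set τ := discreteFunctional (Finset.range (N + 1)) β w with hτ
    set β' : ℕ → ℝ := fun i => β (i + 1) with hβ'
    set w' : ℕ → ℝ := fun i => w (i + 1) * (β (i + 1) - β 0) with hw'
    set τ' := discreteFunctional (Finset.range N) β' w' with hτ'
    have hτ'eq : ∀ q, τ' q = τ ((X - C (β 0)) * q) := by
      intro q
      rw [hτ, hτ', discreteFunctional_apply, discreteFunctional_apply, Finset.sum_range_succ']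
      simp only [eval_mul, eval_sub, eval_X, eval_C, sub_self, zero_mul, mul_zero, add_zero,
        hw', hβ', mul_assoc]
    have hβ'mono : StrictMonoOn β' (Set.Iio N) := fun a ha b hb hab =>
      hβ (Set.mem_Iio.2 (by have := Set.mem_Iio.1 ha; omega))
        (Set.mem_Iio.2 (by have := Set.mem_Iio.1 hb; omega)) (by omega)
    have hw'pos : ∀ i < N, 0 < w' i := fun i hi =>
      mul_pos (hw _ (by omega)) (sub_pos.2 (hβ (Set.mem_Iio.2 (by omega))
        (Set.mem_Iio.2 (by omega)) (by omega)))
    have hβ'inj : Set.InjOn β' (Finset.range N : Set ℕ) := fun a ha b hb h =>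
      hβ'mono.injOn (by simpa using ha) (by simpa using hb) h
    have hdef : ∀ e : ℝ[X], e ≠ 0 → e.degree < N → 0 < τ' (e * e) := fun e he0 he =>
      discreteFunctional_mul_self_pos hβ'inj (fun i hi => hw'pos i (Finset.mem_range.1 hi)) he0
        (by rwa [Finset.card_range])
    have hmo := monicOrthogonal_degree τ'
    have hmopos : ∀ i < N, 0 < τ' (monicOrthogonal τ' i * monicOrthogonal τ' i) := fun i hi =>
      hdef _ (hmo i).1.ne_zero (by rw [(hmo i).2]; exact Nat.cast_lt.2 hi)
    have hmoorth : ∀ i ≤ N, ∀ q : ℝ[X], q.degree < i → τ' (monicOrthogonal τ' i * q) = 0 :=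
      fun i hi q hq => monicOrthogonal_orthogonal τ' (fun j hj => (hmopos j (by omega)).ne') hq
    have hprod : P * ∏ i ∈ Finset.range (m + 1), (X - C (β i))
        = (X - C (β 0)) * (P * ∏ i ∈ Finset.range m, (X - C (β' i))) := by
      rw [Finset.prod_range_succ']; ring
    rw [hprod, ← hτ'eq]
    have hfirst := ih N β' w' hβ'mono hw'pos j (monicOrthogonal τ' j) (hmo j).1 (hmo j).2
      (hmoorth j (by omega))
    rcases Nat.eq_zero_or_pos j with rfl | hj
    · have h1 : P = monicOrthogonal τ' 0 := by
        rw [monicOrthogonal_eq, eq_C_of_degree_eq_zero hPd]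
        have := hP.coeff_natDegree
        rw [natDegree_eq_of_degree_eq_some hPd] at this
        rw [this]; simp
      rw [h1]; exact hfirst
    obtain ⟨j, rfl⟩ := Nat.exists_eq_add_of_le' hj
    have hd : (P - monicOrthogonal τ' (j + 1)).degree < (j + 1 : ℕ) := by
      rw [← hPd]
      exact degree_sub_lt_left (by rw [hPd, (hmo _).2]) hP.ne_zero
        (by rw [hP.leadingCoeff, (hmo _).1.leadingCoeff])
    have hPorth : ∀ q : ℝ[X], q.degree < j → τ' (P * q) = 0 := by
      intro q hq
      rw [hτ'eq, mul_left_comm]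
      exact horth _ (degree_mul_lt_of_le_of_lt (degree_X_sub_C_le' _) hq (by omega))
    have h := eq_C_mul_of_orthogonal τ' (hmo j).1 (hmo j).2 (hmoorth j (by omega)) hd
      (fun q hq => by
        rw [sub_mul, map_sub, hPorth q hq, hmoorth (j + 1) (by omega) q
          (hq.trans_le (Nat.cast_le.2 (by omega))), sub_zero])
      (fun e he0 he => hdef e he0 (he.trans_le (Nat.cast_le.2 (by omega))))
    set c := (P - monicOrthogonal τ' (j + 1)).coeff j with hc
    have hcnn : 0 ≤ c := by
      have h1 : c * τ' (monicOrthogonal τ' j * monicOrthogonal τ' j) = τ (P * P) := by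
        have h2 : τ' ((P - monicOrthogonal τ' (j + 1)) * monicOrthogonal τ' j)
            = τ' (P * monicOrthogonal τ' j) := by
          rw [sub_mul, map_sub, hmoorth (j + 1) (by omega) _
            (by rw [(hmo j).2]; exact Nat.cast_lt.2 (by omega)), sub_zero]
        rw [h, mul_assoc, ← smul_eq_C_mul, map_smul, smul_eq_mul, hτ'eq (P * _)] at h2
        rw [h2, ← sub_eq_zero, ← map_sub]
        have h3 : (X - C (β 0)) * (P * monicOrthogonal τ' j) - P * P
            = P * ((X - C (β 0)) * monicOrthogonal τ' j - P) := by ring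
        rw [h3]
        refine horth _ ?_
        have h4 : ((X - C (β 0)) * monicOrthogonal τ' j).degree
            = ((j + 1 : ℕ) : WithBot ℕ) := by
          rw [degree_mul, degree_X_sub_C, (hmo j).2]; push_cast; ring
        rw [← h4]
        refine degree_sub_lt_left (by rw [h4, hPd]) ?_ ?_
        · exact ((monic_X_sub_C _).mul (hmo j).1).ne_zero
        · rw [((monic_X_sub_C _).mul (hmo j).1).leadingCoeff, hP.leadingCoeff]
      have h5 : 0 ≤ τ (P * P) := by
        rw [hτ, discreteFunctional_apply]
        refine Finset.sum_nonneg fun i hi => ?_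
        rw [eval_mul]
        exact mul_nonneg (hw i (Finset.mem_range.1 hi)).le (mul_self_nonneg _)
      rw [← h1] at h5
      exact nonneg_of_mul_nonneg_left h5 (hmopos j (by omega))
    have hsecond := ih N β' w' hβ'mono hw'pos j (monicOrthogonal τ' j) (hmo j).1 (hmo j).2
      (hmoorth j (by omega))
    rw [← sub_add_cancel P (monicOrthogonal τ' (j + 1)), h, add_mul, map_add, mul_assoc,
      ← smul_eq_C_mul, map_smul, smul_eq_mul]
    exact add_nonneg (mul_nonneg hcnn hsecond) hfirst

section

variable {n : ℕ} {hn : 2 ≤ n} {k : ℕ} {T : Finset ℝ} {w : ℝ → ℝ} {ℓ s : ℝ}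

/-- The partial products of the nodes are nonnegative combinations of the `P_j^{1,ℓ}`. -/
lemma IsGaussRule.nodeProd_eq_sum (G : IsGaussRule hn k T w) (hℓ : ∀ t ∈ T, ℓ < t)
    {β ρ : ℕ → ℝ} (hR : IsRadauQuadrature n k ℓ s β ρ) {m : ℕ} (hm : m < k) :
    ∃ c : ℕ → ℝ, (∀ j, 0 ≤ c j) ∧
      nodeProd β m = ∑ j ∈ Finset.range k, C (c j) * monicEll hn ℓ j := by
  classical
  set ν := nuFunctional hn ℓ with hν
  have hlt : ∀ i j, i < j → j ≤ k + 1 → β i < β j := fun i j hij hj =>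
    hR.strictMono (Set.mem_Iic.2 (by omega)) (Set.mem_Iic.2 hj) hij
  have hdisc : ∀ q : ℝ[X], q.degree < (2 * k - 1 : ℕ) →
      ν q = discreteFunctional (Finset.range k) (fun i => β (i + 1))
        (fun i => ρ (i + 1) * ((1 - β (i + 1)) * (β (i + 1) - ℓ))) q := by
    intro q hq
    have h := hR.exact_of_degree ((1 - X) * ((X - C ℓ) * q)) (natDegree_le_of_degree_lt_succ
      (degree_mul_lt_of_le_of_lt (a := 1) (b := 2 * k) (by
        rw [← neg_sub, degree_neg, ← C_1]; exact degree_X_sub_C_le' 1)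
        (degree_mul_lt_of_le_of_lt (degree_X_sub_C_le' ℓ) hq (by omega)) (by omega)))
    rw [hν, nuFunctional_apply, mean_apply, h, Finset.sum_range_succ, Finset.sum_range_succ',
      hR.first, hR.last, discreteFunctional_apply]
    simp only [eval_mul, eval_sub, eval_one, eval_X, eval_C, sub_self, zero_mul, mul_zero,
      add_zero, mul_assoc]
  have hnn : ∀ j < k, 0 ≤ ν (monicEll hn ℓ j * nodeProd β m) := by
    intro j hj
    have hmd := monicEll_degree hn ℓ j
    rw [hdisc _ (degree_mul_lt_of_le_of_lt (b := k) hmd.le (by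
      rw [nodeProd_degree]; exact Nat.cast_lt.2 hm) (by omega))]
    refine discreteFunctional_mul_prod_nonneg m k (fun i => β (i + 1)) _
      (fun a ha b hb hab => hlt _ _ (by omega) (by have := Set.mem_Iio.1 hb; omega))
      (fun i hi => ?_) j _ (monicEll_monic hn ℓ j) hmd (fun q hq => ?_)
    · have h1 := hlt 0 (i + 1) (by omega) (by omega)
      have h2 := hlt (i + 1) (k + 1) (by omega) le_rfl
      rw [hR.first] at h1
      rw [hR.last] at h2
      exact mul_pos (hR.pos _ (by omega)) (mul_pos (by linarith) (by linarith))
    · rw [← hdisc _ (degree_mul_lt_of_le_of_lt hmd.le hq (by omega))]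
      exact G.monicEll_orthogonal hℓ hj.le hq
  refine ⟨fun j => if j < k then ν (monicEll hn ℓ j * nodeProd β m) /
    ν (monicEll hn ℓ j * monicEll hn ℓ j) else 0, fun j => ?_, ?_⟩
  · dsimp only
    split_ifs with hj
    · exact div_nonneg (hnn j hj) (G.monicEll_sq_pos hℓ hj).le
    · exact le_rfl
  · -- the difference is orthogonal to itself
    set S := ∑ j ∈ Finset.range k, C (if j < k then ν (monicEll hn ℓ j * nodeProd β m) /
      ν (monicEll hn ℓ j * monicEll hn ℓ j) else 0) * monicEll hn ℓ j with hS
    have hSdeg : (nodeProd β m - S).degree < k := by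
      refine (degree_sub_le _ _).trans_lt (max_lt ?_ ?_)
      · rw [nodeProd_degree]; exact Nat.cast_lt.2 hm
      · refine (degree_sum_le _ _).trans_lt ((Finset.sup_lt_iff (WithBot.bot_lt_coe k)).2 ?_)
        intro j hj
        rw [← smul_eq_C_mul]
        refine (degree_smul_le _ _).trans_lt ?_
        rw [monicEll_degree]
        exact Nat.cast_lt.2 (Finset.mem_range.1 hj)
    have horth : ∀ q : ℝ[X], q.degree < k → ν ((nodeProd β m - S) * q) = 0 := by
      refine eq_zero_of_monic_basis (ν.comp (LinearMap.mulLeft ℝ (nodeProd β m - S)))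
        (monicEll hn ℓ) (fun i => ⟨monicEll_monic hn ℓ i, monicEll_degree hn ℓ i⟩) k
        fun j hj => ?_
      rw [LinearMap.comp_apply, LinearMap.mulLeft_apply, sub_mul, map_sub, hS, Finset.sum_mul,
        map_sum, Finset.sum_eq_single j]
      · rw [if_pos hj, mul_assoc, ← smul_eq_C_mul, map_smul, smul_eq_mul,
          div_mul_cancel₀ _ (G.monicEll_sq_pos hℓ hj).ne', mul_comm (nodeProd β m), sub_self]
      · intro i hi hij
        have hi := Finset.mem_range.1 hi
        rw [mul_assoc, ← smul_eq_C_mul, map_smul]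
        rcases lt_or_gt_of_ne hij with h | h
        · rw [mul_comm (monicEll hn ℓ i) (monicEll hn ℓ j), hν, G.monicEll_orthogonal hℓ hj.le
            (by rw [monicEll_degree]; exact Nat.cast_lt.2 h), smul_zero]
        · rw [hν, G.monicEll_orthogonal hℓ hi.le (q := monicEll hn ℓ j)
            (by rw [monicEll_degree]; exact Nat.cast_lt.2 h), smul_zero]
      · exact fun h => absurd (Finset.mem_range.2 hj) h
    by_contra hne
    have := G.nuFunctional_pos hℓ (sub_ne_zero.2 hne) hSdeg
    rw [← hν, horth _ hSdeg] at this
    exact lt_irrefl _ this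

/-- The Krein condition turns the partial products of the Newton interpolation into functions of
the class `F_≥`. -/
lemma IsGaussRule.posDef_nodeProd_mul (G : IsGaussRule hn k T w) (hk : 1 ≤ k)
    (hℓ : ∀ t ∈ T, ℓ < t) (hKrein : StrengthenedKrein n k ℓ)
    (he : ∀ i ≤ k, 0 < (monicEll hn ℓ i).eval 1) {β ρ : ℕ → ℝ}
    (hR : IsRadauQuadrature n k ℓ s β ρ) {b : ℝ} (hb : 0 < b)
    (hlast : nodeProd β k = monicEll hn ℓ k + C b * monicEll hn ℓ (k - 1))
    {m m' : ℕ} (hm : m < k) (hm' : m' ≤ k) :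
    PosDef n fun t => ((X - C ℓ) * (nodeProd β m * nodeProd β m')).eval t := by
  obtain ⟨c, hc, hcm⟩ := G.nodeProd_eq_sum hℓ hR hm
  have hprod : ∀ q : ℝ[X], (X - C ℓ) * (nodeProd β m * q)
      = ∑ i ∈ Finset.range k, C (c i) * ((X - C ℓ) * (monicEll hn ℓ i * q)) := by
    intro q
    rw [hcm, Finset.sum_mul, Finset.mul_sum]
    exact Finset.sum_congr rfl fun i _ => by ring
  have hbasis : ∀ j ≤ k, PosDef n fun t =>
      ((X - C ℓ) * (nodeProd β m * monicEll hn ℓ j)).eval t := by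
    intro j hj
    rw [hprod]
    refine PosDef.sum hn _ fun i hi => PosDef.C_mul hn ?_ (hc i)
    have := Finset.mem_range.1 hi
    exact (hKrein.monicEll he (by omega) hj (by omega)).1
  rcases hm'.lt_or_eq with hlt | rfl
  · obtain ⟨c', hc', hcm'⟩ := G.nodeProd_eq_sum hℓ hR hlt
    have : (X - C ℓ) * (nodeProd β m * nodeProd β m') = ∑ j ∈ Finset.range k,
        C (c' j) * ((X - C ℓ) * (nodeProd β m * monicEll hn ℓ j)) := by
      conv_lhs => rw [hcm']
      rw [Finset.mul_sum, Finset.mul_sum]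
      exact Finset.sum_congr rfl fun i _ => by ring
    rw [this]
    exact PosDef.sum hn _ fun j hj => PosDef.C_mul hn
      (hbasis j (Finset.mem_range.1 hj).le) (hc' j)
  · have : (X - C ℓ) * (nodeProd β m * nodeProd β m')
        = (X - C ℓ) * (nodeProd β m * monicEll hn ℓ m')
          + C b * ((X - C ℓ) * (nodeProd β m * monicEll hn ℓ (m' - 1))) := by
      rw [hlast]; ring
    rw [this]
    exact PosDef.add hn (hbasis _ le_rfl) (PosDef.C_mul hn (hbasis _ (by omega)) hb.le)

end

/-! ### Absolutely monotone functions -/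

/-- The remainder at order `N` of the Taylor expansion at `-1` of the `j`-th derivative, for a
sequence `H` of functions each of which is the derivative of the preceding one. -/
def taylorRem (H : ℕ → ℝ → ℝ) (N j : ℕ) (x : ℝ) : ℝ :=
  H j x - ∑ i ∈ Finset.range N, H (j + i) (-1) / i.factorial * (x + 1) ^ i

lemma taylorRem_hasDerivWithinAt {H : ℕ → ℝ → ℝ}
    (hH : ∀ j, ∀ x ∈ Set.Ico (-1 : ℝ) 1, HasDerivWithinAt (H j) (H (j + 1) x) (Set.Ico (-1) 1) x)
    (N j : ℕ) {x : ℝ} (hx : x ∈ Set.Ico (-1 : ℝ) 1) :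
    HasDerivWithinAt (taylorRem H (N + 1) j) (taylorRem H N (j + 1) x) (Set.Ico (-1) 1) x := by
  have hs : HasDerivAt (fun x : ℝ => ∑ i ∈ Finset.range (N + 1),
      H (j + i) (-1) / i.factorial * (x + 1) ^ i)
      (∑ i ∈ Finset.range N, H (j + 1 + i) (-1) / i.factorial * (x + 1) ^ i) x := by
    have h1 : ∀ i ∈ Finset.range (N + 1), HasDerivAt
        (fun x : ℝ => H (j + i) (-1) / i.factorial * (x + 1) ^ i)
        (H (j + i) (-1) / i.factorial * (i * (x + 1) ^ (i - 1))) x := fun i _ => by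
      have := ((hasDerivAt_id x).add_const 1).pow i
      simpa using this.const_mul (H (j + i) (-1) / i.factorial)
    have h2 := HasDerivAt.fun_sum h1
    rw [Finset.sum_range_succ'] at h2
    simp only [Nat.cast_zero, zero_mul, mul_zero, add_zero] at h2
    refine h2.congr_deriv (Finset.sum_congr rfl fun i _ => ?_)
    have := i.factorial_ne_zero
    rw [Nat.factorial_succ, Nat.add_sub_cancel, show j + (i + 1) = j + 1 + i by ring]
    push_cast
    field_simp
  exact (hH j x hx).sub hs.hasDerivWithinAt

lemma taylorRem_neg_one (H : ℕ → ℝ → ℝ) (N j : ℕ) : taylorRem H (N + 1) j (-1) = 0 := by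
  rw [taylorRem, Finset.sum_range_succ']
  simp

lemma monotoneOn_Ico_of_hasDerivWithinAt {f f' : ℝ → ℝ}
    (hf : ∀ x ∈ Set.Ico (-1 : ℝ) 1, HasDerivWithinAt f (f' x) (Set.Ico (-1) 1) x)
    (hf' : ∀ x ∈ Set.Ico (-1 : ℝ) 1, 0 ≤ f' x) : MonotoneOn f (Set.Ico (-1) 1) := by
  refine monotoneOn_of_hasDerivWithinAt_nonneg (convex_Ico _ _)
    (fun x hx => (hf x hx).continuousWithinAt)
    (fun x hx => (hf x (interior_subset hx)).mono interior_subset)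
    (fun x hx => hf' x (interior_subset hx))

/-- Taylor remainders of absolutely monotone functions are nonnegative, and `R_N(x) / (x + 1)^N` is
nondecreasing. -/
lemma taylorRem_bounds {H : ℕ → ℝ → ℝ}
    (hH : ∀ j, ∀ x ∈ Set.Ico (-1 : ℝ) 1, HasDerivWithinAt (H j) (H (j + 1) x) (Set.Ico (-1) 1) x)
    (hnn : ∀ j, ∀ x ∈ Set.Ico (-1 : ℝ) 1, 0 ≤ H j x) {c : ℝ} (hc : c ∈ Set.Icc (0 : ℝ) 1) (N : ℕ) :
    ∀ j, ∀ x ∈ Set.Ico (-1 : ℝ) 1, 0 ≤ taylorRem H N j x ∧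
      taylorRem H N j (-1 + c * (x + 1)) ≤ c ^ N * taylorRem H N j x := by
  have hmaps : Set.MapsTo (fun x : ℝ => -1 + c * (x + 1)) (Set.Ico (-1) 1) (Set.Ico (-1) 1) := by
    intro x hx
    have h1 : 0 ≤ x + 1 := by linarith [hx.1]
    exact ⟨by nlinarith [hc.1], by nlinarith [hc.2, hx.2]⟩
  have hm1 : (-1 : ℝ) ∈ Set.Ico (-1 : ℝ) 1 := by norm_num
  induction N with
  | zero =>
    intro j x hx
    have h0 : ∀ y, taylorRem H 0 j y = H j y := fun y => by simp [taylorRem]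
    rw [h0, h0, pow_zero, one_mul]
    refine ⟨hnn j x hx, monotoneOn_Ico_of_hasDerivWithinAt (hH j) (hnn (j + 1)) (hmaps hx) hx ?_⟩
    nlinarith [hc.2, hx.1]
  | succ N ih =>
    intro j x hx
    constructor
    · have := monotoneOn_Ico_of_hasDerivWithinAt
        (fun x hx => taylorRem_hasDerivWithinAt hH N j hx) (fun x hx => (ih (j + 1) x hx).1)
        hm1 hx hx.1
      rwa [taylorRem_neg_one] at this
    · have hφ : ∀ x ∈ Set.Ico (-1 : ℝ) 1, HasDerivWithinAt
          (fun x => c ^ (N + 1) * taylorRem H (N + 1) j x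
            - taylorRem H (N + 1) j (-1 + c * (x + 1)))
          (c ^ (N + 1) * taylorRem H N (j + 1) x
            - taylorRem H N (j + 1) (-1 + c * (x + 1)) * c) (Set.Ico (-1) 1) x := by
        intro x hx
        have hlin : HasDerivWithinAt (fun x : ℝ => -1 + c * (x + 1)) c (Set.Ico (-1) 1) x := by
          simpa using ((((hasDerivAt_id x).add_const 1).const_mul c).const_add
            (-1)).hasDerivWithinAt
        have hcomp : HasDerivWithinAt (taylorRem H (N + 1) j ∘ fun x : ℝ => -1 + c * (x + 1))
            (taylorRem H N (j + 1) (-1 + c * (x + 1)) * c) (Set.Ico (-1) 1) x :=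
          HasDerivWithinAt.comp x (taylorRem_hasDerivWithinAt hH N j (hmaps hx)) hlin hmaps
        exact ((taylorRem_hasDerivWithinAt hH N j hx).const_mul _).sub hcomp
      have := monotoneOn_Ico_of_hasDerivWithinAt hφ (fun x hx => by
        have := mul_le_mul_of_nonneg_left (ih (j + 1) x hx).2 hc.1
        rw [pow_succ]
        linarith) hm1 hx hx.1
      simp only [neg_add_cancel, mul_zero, add_zero, taylorRem_neg_one, sub_zero] at this
      linarith

/-- The function is the sum on `[-1, 1)` of a power series in `t + 1` with nonnegative
coefficients. -/
def HasNonnegSeries (h : ℝ → ℝ) : Prop :=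
  ∃ a : ℕ → ℝ, (∀ i, 0 ≤ a i) ∧ ∀ t ∈ Set.Ico (-1 : ℝ) 1, HasSum (fun i => a i * (t + 1) ^ i) (h t)

/-- **Bernstein's theorem**: absolutely monotone functions have nonnegative power series. -/
lemma hasNonnegSeries_of_absolutelyMonotoneOn {h : ℝ → ℝ}
    (hh : AbsolutelyMonotoneOn h (Set.Ico (-1) 1)) : HasNonnegSeries h := by
  have hu : UniqueDiffOn ℝ (Set.Ico (-1 : ℝ) 1) := uniqueDiffOn_Ico _ _
  set H : ℕ → ℝ → ℝ := fun j => iteratedDerivWithin j h (Set.Ico (-1) 1) with hHdef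
  have hm1 : (-1 : ℝ) ∈ Set.Ico (-1 : ℝ) 1 := by norm_num
  have hnn : ∀ j, ∀ x ∈ Set.Ico (-1 : ℝ) 1, 0 ≤ H j x := fun j x hx =>
    hh.iteratedDerivWithin_nonneg hu j hx
  have hH : ∀ j, ∀ x ∈ Set.Ico (-1 : ℝ) 1,
      HasDerivWithinAt (H j) (H (j + 1) x) (Set.Ico (-1) 1) x := by
    intro j x hx
    have hd : DifferentiableWithinAt ℝ (H j) (Set.Ico (-1) 1) x :=
      (hh.contDiffOn.differentiableOn_iteratedDerivWithin (m := j)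
        (by exact_mod_cast WithTop.coe_lt_top _) hu) x hx
    have := hd.hasDerivWithinAt
    rwa [← iteratedDerivWithin_succ] at this
  refine ⟨fun i => H i (-1) / i.factorial, fun i => div_nonneg (hnn i _ hm1) (Nat.cast_nonneg _),
    fun t ht => ?_⟩
  have hterm : ∀ i, 0 ≤ H i (-1) / i.factorial * (t + 1) ^ i := fun i =>
    mul_nonneg (div_nonneg (hnn i _ hm1) (Nat.cast_nonneg _))
      (pow_nonneg (by linarith [ht.1]) i)
  rw [hasSum_iff_tendsto_nat_of_nonneg hterm]
  -- compare the remainder at `t` with the one at the midpoint of `t` and `1`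
  set y := (t + 1) / 2 with hy
  have hy1 : y ∈ Set.Ico (-1 : ℝ) 1 := ⟨by rw [hy]; linarith [ht.1], by rw [hy]; linarith [ht.2]⟩
  have hyp : 0 < y + 1 := by rw [hy]; linarith [ht.1]
  set c := (t + 1) / (y + 1) with hc
  have hc0 : 0 ≤ c := div_nonneg (by linarith [ht.1]) hyp.le
  have hc1 : c < 1 := by rw [hc, div_lt_one hyp, hy]; linarith [ht.2]
  have hcy : -1 + c * (y + 1) = t := by rw [hc, div_mul_cancel₀ _ hyp.ne']; ring
  have hbound : ∀ N, 0 ≤ taylorRem H N 0 t ∧ taylorRem H N 0 t ≤ c ^ N * h y := by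
    intro N
    have h1 := taylorRem_bounds hH hnn ⟨hc0, hc1.le⟩ N 0
    refine ⟨(h1 t ht).1, ?_⟩
    have h2 := (h1 y hy1).2
    rw [hcy] at h2
    refine h2.trans (mul_le_mul_of_nonneg_left ?_ (pow_nonneg hc0 N))
    have h3 : taylorRem H N 0 y ≤ H 0 y := by
      rw [taylorRem, sub_le_self_iff]
      exact Finset.sum_nonneg fun i _ => mul_nonneg
        (div_nonneg (hnn _ _ hm1) (Nat.cast_nonneg _)) (pow_nonneg hyp.le i)
    simpa [hHdef] using h3
  have hlim : Filter.Tendsto (fun N => taylorRem H N 0 t) Filter.atTop (nhds 0) := by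
    refine squeeze_zero (fun N => (hbound N).1) (fun N => (hbound N).2) ?_
    simpa using (tendsto_pow_atTop_nhds_zero_of_lt_one hc0 hc1).mul_const (h y)
  have hlim2 : Filter.Tendsto (fun N => h t - taylorRem H N 0 t) Filter.atTop (nhds (h t)) := by
    simpa using hlim.const_sub (h t)
  refine hlim2.congr fun N => ?_
  simp [taylorRem, hHdef]

namespace HasNonnegSeries

variable {h : ℝ → ℝ}

lemma nonneg (hh : HasNonnegSeries h) {t : ℝ} (ht : t ∈ Set.Ico (-1 : ℝ) 1) : 0 ≤ h t := by
  obtain ⟨a, ha, hs⟩ := hh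
  exact (hs t ht).nonneg fun i => mul_nonneg (ha i) (pow_nonneg (by linarith [ht.1]) i)

lemma monotoneOn (hh : HasNonnegSeries h) : MonotoneOn h (Set.Ico (-1) 1) := by
  obtain ⟨a, ha, hs⟩ := hh
  intro t ht u hu htu
  refine hasSum_le (fun i => ?_) (hs t ht) (hs u hu)
  have : 0 ≤ t + 1 := by linarith [ht.1]
  have := ha i
  gcongr

lemma eq_zero_of_eq_zero (hh : HasNonnegSeries h) {s : ℝ} (hs : s ∈ Set.Ioo (-1 : ℝ) 1)
    (h0 : h s = 0) : ∀ t ∈ Set.Ico (-1 : ℝ) 1, h t = 0 := by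
  obtain ⟨a, ha, hsum⟩ := hh
  have hs' : 0 < s + 1 := by linarith [hs.1]
  have hz := hsum s ⟨hs.1.le, hs.2⟩
  rw [h0, hasSum_zero_iff_of_nonneg fun i => mul_nonneg (ha i) (pow_nonneg hs'.le i)] at hz
  have ha0 : ∀ i, a i = 0 := fun i => by
    have := congrFun hz i
    exact (mul_eq_zero.1 this).resolve_right (pow_pos hs' i).ne'
  intro t ht
  have := hsum t ht
  simp only [ha0, zero_mul] at this
  exact this.unique hasSum_zero

/-- A Cauchy estimate for the coefficients. -/
lemma exists_coeff_bound {a : ℕ → ℝ} (ha : ∀ i, 0 ≤ a i)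
    (hs : ∀ t ∈ Set.Ico (-1 : ℝ) 1, HasSum (fun i => a i * (t + 1) ^ i) (h t))
    {z : ℝ} (hz0 : 0 ≤ z) (hz : z < 2) :
    ∃ K r : ℝ, z < r ∧ 0 < r ∧ ∀ m, a m ≤ K / r ^ m := by
  obtain ⟨r, hr1, hr2⟩ := exists_between hz
  have hr0 : 0 < r := hz0.trans_lt hr1
  refine ⟨h (r - 1), r, hr1, hr0, fun m => ?_⟩
  have h1 := hs (r - 1) ⟨by linarith, by linarith⟩
  rw [sub_add_cancel] at h1
  rw [le_div_iff₀ (pow_pos hr0 m)]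
  exact le_hasSum h1 m fun i _ => mul_nonneg (ha i) (pow_nonneg hr0.le i)

lemma summable_tail_of_bound {a : ℕ → ℝ} (ha : ∀ i, 0 ≤ a i) {K r y : ℝ} (hy : 0 ≤ y) (hyr : y < r)
    (hK : ∀ m, a m ≤ K / r ^ m) (i : ℕ) :
    Summable (fun j => a (i + 1 + j) * y ^ j) ∧
      ∑' j, a (i + 1 + j) * y ^ j ≤ K / r ^ (i + 1) * ∑' j, (y / r) ^ j := by
  have hr0 : 0 < r := hy.trans_lt hyr
  have hle : ∀ j, a (i + 1 + j) * y ^ j ≤ K / r ^ (i + 1) * (y / r) ^ j := by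
    intro j
    refine (mul_le_mul_of_nonneg_right (hK (i + 1 + j)) (pow_nonneg hy j)).trans (le_of_eq ?_)
    rw [pow_add r (i + 1) j, div_pow, div_mul_eq_mul_div, div_mul_div_comm]
  have hgeo : Summable fun j => K / r ^ (i + 1) * (y / r) ^ j :=
    (summable_geometric_of_lt_one (div_nonneg hy hr0.le) ((div_lt_one hr0).2 hyr)).mul_left _
  have hsum : Summable (fun j => a (i + 1 + j) * y ^ j) :=
    Summable.of_nonneg_of_le (fun j => mul_nonneg (ha _) (pow_nonneg hy j)) hle hgeo
  refine ⟨hsum, ?_⟩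
  rw [← tsum_mul_left]
  exact hsum.tsum_le_tsum hle hgeo

/-- The difference quotient of a nonnegative power series is again a nonnegative power series. -/
lemma exists_dslope (hh : HasNonnegSeries h) {x : ℝ} (hx : x ∈ Set.Ico (-1 : ℝ) 1) :
    ∃ h₁ : ℝ → ℝ, HasNonnegSeries h₁ ∧
      ∀ t ∈ Set.Ico (-1 : ℝ) 1, h t = h x + (t - x) * h₁ t := by
  obtain ⟨a, ha, hs⟩ := hh
  obtain ⟨y, hy⟩ : ∃ y, y = x + 1 := ⟨_, rfl⟩
  have hy0 : 0 ≤ y := by rw [hy]; linarith [hx.1]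
  have hy2 : y < 2 := by rw [hy]; linarith [hx.2]
  -- in powers of `t + 1`, the difference quotient has coefficients `b_i = ∑_j a_{i+1+j} y^j`
  obtain ⟨b, hb⟩ : ∃ b : ℕ → ℝ, ∀ i, b i = ∑' j, a (i + 1 + j) * y ^ j := ⟨_, fun _ => rfl⟩
  have hbsum : ∀ i, Summable fun j => a (i + 1 + j) * y ^ j := by
    intro i
    obtain ⟨K, r, hyr, -, hK⟩ := exists_coeff_bound ha hs hy0 hy2
    exact (summable_tail_of_bound ha hy0 hyr hK i).1
  have hb0 : ∀ i, 0 ≤ b i := fun i => by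
    rw [hb]
    exact tsum_nonneg fun j => mul_nonneg (ha _) (pow_nonneg hy0 j)
  have hbrec : ∀ i, b i = a (i + 1) + y * b (i + 1) := by
    intro i
    rw [hb, hb, (hbsum i).tsum_eq_zero_add, ← tsum_mul_left]
    congr 1
    · simp
    · refine tsum_congr fun j => ?_
      rw [show i + 1 + (j + 1) = i + 1 + 1 + j by ring, pow_succ]
      ring
  have hsum : ∀ t ∈ Set.Ico (-1 : ℝ) 1, Summable fun i => b i * (t + 1) ^ i := by
    intro t ht
    have ht0 : 0 ≤ t + 1 := by linarith [ht.1]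
    obtain ⟨K, r, hr, hr0, hK⟩ := exists_coeff_bound ha hs (hy0.trans (le_max_left y (t + 1)))
      (max_lt hy2 (by linarith [ht.2]))
    obtain ⟨hyr, htr⟩ := max_lt_iff.1 hr
    have hle : ∀ i, b i * (t + 1) ^ i ≤ K / r * (∑' j, (y / r) ^ j) * ((t + 1) / r) ^ i := by
      intro i
      have h1 := (summable_tail_of_bound ha hy0 hyr hK i).2
      rw [← hb] at h1
      refine (mul_le_mul_of_nonneg_right h1 (pow_nonneg ht0 i)).trans (le_of_eq ?_)
      generalize ∑' j, (y / r) ^ j = G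
      rw [div_pow, pow_succ]
      field_simp
    exact Summable.of_nonneg_of_le (fun i => mul_nonneg (hb0 i) (pow_nonneg ht0 i)) hle
      ((summable_geometric_of_lt_one (div_nonneg ht0 hr0.le) ((div_lt_one hr0).2 htr)).mul_left _)
  refine ⟨fun t => ∑' i, b i * (t + 1) ^ i, ⟨b, hb0, fun t ht => (hsum t ht).hasSum⟩,
    fun t ht => ?_⟩
  have hyb : y * b 0 = h x - a 0 := by
    have h1 := (hs x hx).tsum_eq
    rw [(hs x hx).summable.tsum_eq_zero_add] at h1
    rw [← h1, hb, ← hy, ← tsum_mul_left, pow_zero, mul_one, add_sub_cancel_left]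
    refine tsum_congr fun j => ?_
    rw [show 0 + 1 + j = j + 1 by ring, pow_succ]
    ring
  have hta : h t - a 0 = ∑' i, a (i + 1) * (t + 1) ^ (i + 1) := by
    have h1 := (hs t ht).tsum_eq
    rw [(hs t ht).summable.tsum_eq_zero_add] at h1
    rw [← h1]; ring
  have hsumb := hsum t ht
  have hshift : Summable fun i => b (i + 1) * (t + 1) ^ (i + 1) :=
    (summable_nat_add_iff 1).2 hsumb
  have htel : ∑' i, a (i + 1) * (t + 1) ^ (i + 1)
      = (t + 1) * (∑' i, b i * (t + 1) ^ i) - y * ∑' i, b (i + 1) * (t + 1) ^ (i + 1) := by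
    rw [← tsum_mul_left, ← tsum_mul_left, ← (hsumb.mul_left _).tsum_sub (hshift.mul_left _)]
    refine tsum_congr fun i => ?_
    rw [hbrec i, pow_succ]
    ring
  have hzero := hsumb.tsum_eq_zero_add
  rw [pow_zero, mul_one] at hzero
  dsimp only
  rw [← hta] at htel
  have hyz : y * ∑' i, b i * (t + 1) ^ i
      = y * b 0 + y * ∑' i, b (i + 1) * (t + 1) ^ (i + 1) := by rw [hzero]; ring
  rw [hyb] at hyz
  rw [show t - x = (t + 1) - y by rw [hy]; ring, sub_mul]
  linarith

/-- Newton interpolation: all coefficients and the error are nonnegative. -/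
lemma exists_newton (hh : HasNonnegSeries h) {x : ℕ → ℝ} {N : ℕ}
    (hx : ∀ i < N, x i ∈ Set.Ico (-1 : ℝ) 1) :
    ∃ (c : ℕ → ℝ) (v : ℝ → ℝ), (∀ i, 0 ≤ c i) ∧ HasNonnegSeries v ∧
      ∀ t ∈ Set.Ico (-1 : ℝ) 1,
        h t = ∑ m ∈ Finset.range N, c m * ∏ i ∈ Finset.range m, (t - x i)
          + (∏ i ∈ Finset.range N, (t - x i)) * v t := by
  induction N with
  | zero => exact ⟨0, h, fun _ => le_rfl, hh, fun t _ => by simp⟩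
  | succ N ih =>
    obtain ⟨c, v, hc, hv, heq⟩ := ih fun i hi => hx i (by omega)
    obtain ⟨v', hv', hvv'⟩ := hv.exists_dslope (hx N (by omega))
    refine ⟨Function.update c N (v (x N)), v', fun i => ?_, hv', fun t ht => ?_⟩
    · rcases eq_or_ne i N with rfl | hi
      · rw [Function.update_self]; exact hv.nonneg (hx _ (by omega))
      · rw [Function.update_of_ne hi]; exact hc i
    · have hsum : ∑ m ∈ Finset.range N, Function.update c N (v (x N)) m
            * ∏ i ∈ Finset.range m, (t - x i)
          = ∑ m ∈ Finset.range N, c m * ∏ i ∈ Finset.range m, (t - x i) :=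
        Finset.sum_congr rfl fun m hm => by
          rw [Function.update_of_ne (Finset.mem_range.1 hm).ne]
      rw [heq t ht, hvv' t ht, Finset.sum_range_succ, Finset.prod_range_succ,
        Function.update_self, hsum]
      ring

/-- A double zero of the error term does not contribute to the derivative. -/
lemma hasDerivWithinAt_of_sq_mul {v : ℝ → ℝ} (hv : HasNonnegSeries v) {g q : ℝ[X]} {x : ℝ}
    (hx : x ∈ Set.Ico (-1 : ℝ) 1) (heq : ∀ t ∈ Set.Ico (-1 : ℝ) 1,
      h t = g.eval t + (t - x) ^ 2 * q.eval t * v t) :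
    HasDerivWithinAt h ((derivative g).eval x) (Set.Ico (-1) 1) x := by
  set E : ℝ → ℝ := fun t => (t - x) ^ 2 * q.eval t * v t with hE
  have hE0 : HasDerivWithinAt E 0 (Set.Ico (-1) 1) x := by
    rw [hasDerivWithinAt_iff_isLittleO]
    have h1 : (fun t => q.eval t * v t) =O[nhdsWithin x (Set.Ico (-1) 1)] fun _ => (1 : ℝ) := by
      refine Asymptotics.IsBigO.mul (f₁ := fun t => q.eval t) (g₁ := fun _ => (1 : ℝ))
        (g₂ := fun _ => (1 : ℝ)) ?_ ?_ |>.trans (by simp [Asymptotics.isBigO_refl])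
      · exact (q.continuous.continuousWithinAt (s := Set.Ico (-1) 1)).isBigO_one ℝ
      · -- `v` is monotone, hence bounded near `x`
        have hmid : (x + 1) / 2 ∈ Set.Ico (-1 : ℝ) 1 :=
          ⟨by linarith [hx.1], by linarith [hx.2]⟩
        refine Asymptotics.IsBigO.of_bound (v ((x + 1) / 2)) ?_
        have hlt : ∀ᶠ t in nhdsWithin x (Set.Ico (-1 : ℝ) 1), t < (x + 1) / 2 :=
          nhdsWithin_le_nhds (Iio_mem_nhds (by linarith [hx.2]))
        filter_upwards [hlt, self_mem_nhdsWithin] with t ht hts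
        rw [Real.norm_of_nonneg (hv.nonneg hts), norm_one, mul_one]
        exact hv.monotoneOn hts hmid ht.le
    have h2 : (fun t => (t - x) ^ 2) =o[nhdsWithin x (Set.Ico (-1) 1)] fun t => t - x := by
      have := Asymptotics.isLittleO_pow_sub_sub x (m := 2) (by norm_num)
      exact (this.mono nhdsWithin_le_nhds).congr_left fun t => by rw [Real.norm_eq_abs, sq_abs]
    have h3 := h2.mul_isBigO h1
    refine h3.congr (fun t => ?_) (fun t => by simp)
    simp [hE]
    ring
  have hg : HasDerivWithinAt (fun t => g.eval t + E t) ((derivative g).eval x + 0)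
      (Set.Ico (-1) 1) x := (g.hasDerivAt x).hasDerivWithinAt.add hE0
  rw [add_zero] at hg
  exact hg.congr heq (heq x hx)

end HasNonnegSeries

/-! ### Hermite interpolation -/

lemma IsHermiteInterpolant.unique {F : ℝ[X]} (hF : F.Splits) {h : ℝ → ℝ} {g₁ g₂ : ℝ[X]}
    (h₁ : IsHermiteInterpolant F h g₁) (h₂ : IsHermiteInterpolant F h g₂) : g₁ = g₂ := by
  by_contra hne
  have hd0 : g₁ - g₂ ≠ 0 := sub_ne_zero.2 hne
  have hdeg : (g₁ - g₂).degree < F.degree :=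
    (degree_sub_le _ _).trans_lt (max_lt h₁.1 h₂.1)
  have hF0 : F ≠ 0 := by
    rintro rfl
    simp at hdeg
  have hle : F.roots ≤ (g₁ - g₂).roots := by
    rw [Multiset.le_iff_count]
    intro x
    rw [count_roots, count_roots]
    by_contra! hlt
    have hall : ∀ m ≤ (g₁ - g₂).rootMultiplicity x, (derivative^[m] (g₁ - g₂)).IsRoot x := by
      intro m hm
      rw [IsRoot.def, iterate_derivative_sub, eval_sub, h₁.2 x m (by omega), h₂.2 x m (by omega),
        sub_self]
    exact lt_irrefl _ ((lt_rootMultiplicity_iff_isRoot_iterate_derivative hd0).2 hall)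
  have h3 := Multiset.card_le_card hle
  rw [← hF.natDegree_eq_card_roots] at h3
  have h4 := card_roots' (g₁ - g₂)
  have h5 := natDegree_lt_natDegree hd0 hdeg
  omega

lemma isHermiteInterpolant_of_error {F g : ℝ[X]} {h v : ℝ → ℝ} (hv : HasNonnegSeries v)
    (hdeg : g.degree < F.degree) (hmult : ∀ x, F.rootMultiplicity x ≤ 2)
    (hroots : ∀ x, F.IsRoot x → x ∈ Set.Ico (-1 : ℝ) 1)
    (heq : ∀ t ∈ Set.Ico (-1 : ℝ) 1, h t = g.eval t + F.eval t * v t) :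
    IsHermiteInterpolant F h g := by
  have hF0 : F ≠ 0 := by
    rintro rfl
    simp at hdeg
  refine ⟨hdeg, fun x j hj => ?_⟩
  have hx : F.IsRoot x := (rootMultiplicity_pos hF0).1 (by omega)
  have hxI := hroots x hx
  have hj2 : j < 2 := hj.trans_le (hmult x)
  interval_cases j
  · rw [Function.iterate_zero, id, iteratedDerivWithin_zero, heq x hxI, hx.eq_zero, zero_mul,
      add_zero]
  · obtain ⟨q, hq⟩ : (X - C x) ^ 2 ∣ F := (le_rootMultiplicity_iff hF0).1 hj
    rw [Function.iterate_one, iteratedDerivWithin_one]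
    refine (HasDerivWithinAt.derivWithin (hv.hasDerivWithinAt_of_sq_mul (q := q) hxI
      fun t ht => ?_) (uniqueDiffOn_Ico _ _ x hxI)).symm
    rw [heq t ht, hq]
    simp

/-! ### Linear programming bounds -/

variable {n k : ℕ} {ℓ s : ℝ}

lemma inner_mem_Icc {x y : EuclideanSpace ℝ (Fin n)} (hx : ‖x‖ = 1) (hy : ‖y‖ = 1) :
    (inner ℝ x y : ℝ) ∈ Set.Icc (-1 : ℝ) 1 := by
  have := abs_real_inner_le_norm x y
  rw [hx, hy, one_mul] at this
  exact abs_le.1 this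

/-- Averaging a function of the class `F_≥` over a code gives at least its mean over the sphere. -/
lemma PosDef.card_sq_mul_mean_le (hn : 2 ≤ n) {g : ℝ[X]} (hg : PosDef n fun t => g.eval t)
    {D : Finset (EuclideanSpace ℝ (Fin n))} (hD : ∀ x ∈ D, ‖x‖ = 1) :
    (D.card : ℝ) ^ 2 * mean hn g ≤ ∑ x ∈ D, ∑ y ∈ D, g.eval (inner ℝ x y) := by
  have hsum : HasSum (fun i => ∑ x ∈ D, ∑ y ∈ D, gegenbauerCoeff n (fun t => g.eval t) i
      * (gegenbauer n i).eval (inner ℝ x y)) (∑ x ∈ D, ∑ y ∈ D, g.eval (inner ℝ x y)) :=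
    hasSum_sum fun x hx => hasSum_sum fun y hy => hg.2.2 _ (inner_mem_Icc (hD x hx) (hD y hy))
  have h0 := le_hasSum hsum 0 fun i _ => by
    simp_rw [← Finset.mul_sum]
    exact mul_nonneg (hg.1 i) (gegenbauer_sum_nonneg hn i hD)
  rw [gegenbauerCoeff_zero hn] at h0
  simp only [gegenbauer_zero, eval_one, mul_one, Finset.sum_const, nsmul_eq_mul] at h0
  linarith

lemma sum_sum_inner_eq {D : Finset (EuclideanSpace ℝ (Fin n))} (hD : ∀ x ∈ D, ‖x‖ = 1)
    (u : ℝ → ℝ) :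
    ∑ x ∈ D, ∑ y ∈ D, u (inner ℝ x y) = energy D u + D.card * u 1 := by
  classical
  rw [energy, ← nsmul_eq_mul, ← Finset.sum_const, ← Finset.sum_add_distrib]
  refine Finset.sum_congr rfl fun x hx => ?_
  rw [← Finset.sum_filter_add_sum_filter_not D (fun y => x ≠ y)]
  congr 1
  have : (D.filter fun y => ¬ x ≠ y) = {x} := by
    ext y
    simp only [Finset.mem_filter, not_not, Finset.mem_singleton]
    exact ⟨fun h => h.2.symm, fun h => ⟨h ▸ hx, h.symm⟩⟩
  rw [this, Finset.sum_singleton, real_inner_self_eq_norm_sq, hD x hx, one_pow]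

/-- The Delsarte linear programming bound for the cardinality of codes. -/
lemma maxCodeSize_le (hn : 2 ≤ n) {f : ℝ[X]} (hf : PosDef n fun t => f.eval t)
    (h0 : 0 < mean hn f) (hle : ∀ t ∈ Set.Icc ℓ s, f.eval t ≤ 0) :
    (maxCodeSize n ℓ s : ℝ≥0∞) ≤ ENNReal.ofReal (f.eval 1 / mean hn f) := by
  have hq : 0 ≤ f.eval 1 / mean hn f := div_nonneg (hf.eval_one_nonneg hn) h0.le
  have hmax : maxCodeSize n ℓ s ≤ (⌊f.eval 1 / mean hn f⌋₊ : ℕ∞) := by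
    refine iSup₂_le fun D hD => ?_
    obtain ⟨hne, hunit, hin⟩ := hD
    have hc : (0 : ℝ) < D.card := Nat.cast_pos.2 hne.card_pos
    have h1 := hf.card_sq_mul_mean_le hn hunit
    rw [sum_sum_inner_eq hunit fun t => f.eval t] at h1
    have h2 : energy D (fun t => f.eval t) ≤ 0 :=
      Finset.sum_nonpos fun x hx => Finset.sum_nonpos fun y hy => by
        obtain ⟨hy, hxy⟩ := Finset.mem_filter.1 hy
        exact hle _ (hin x hx y hy hxy)
    have h3 : (D.card : ℝ) * mean hn f ≤ f.eval 1 := by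
      refine le_of_mul_le_mul_left ?_ hc
      nlinarith
    have h4 : D.card ≤ ⌊f.eval 1 / mean hn f⌋₊ :=
      Nat.le_floor ((le_div_iff₀ h0).2 h3)
    exact_mod_cast h4
  calc (maxCodeSize n ℓ s : ℝ≥0∞)
      ≤ ((⌊f.eval 1 / mean hn f⌋₊ : ℕ∞) : ℝ≥0∞) := ENat.toENNReal_le.2 hmax
    _ = ENNReal.ofReal (⌊f.eval 1 / mean hn f⌋₊ : ℝ) := by
        rw [ENNReal.ofReal_natCast, ENat.toENNReal_coe]
    _ ≤ ENNReal.ofReal (f.eval 1 / mean hn f) := ENNReal.ofReal_le_ofReal (Nat.floor_le hq)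

/-- The Yudin linear programming bound for the energy of codes. -/
lemma le_minEnergy (hn : 2 ≤ n) {g : ℝ[X]} (hg : PosDef n fun t => g.eval t) {h : ℝ → ℝ}
    (hle : ∀ t ∈ Set.Ico ℓ 1, g.eval t ≤ h t) (M : ℝ) :
    ((M * (M * mean hn g - g.eval 1) : ℝ) : EReal) ≤ minEnergy n M ℓ h := by
  refine le_iInf₂ fun D hD => ?_
  obtain ⟨⟨-, hunit, hin⟩, rfl⟩ := hD
  have h1 := hg.card_sq_mul_mean_le hn hunit
  rw [sum_sum_inner_eq hunit fun t => g.eval t] at h1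
  have h2 : energy D (fun t => g.eval t) ≤ energy D h :=
    Finset.sum_le_sum fun x hx => Finset.sum_le_sum fun y hy => by
      obtain ⟨hy, hxy⟩ := Finset.mem_filter.1 hy
      exact hle _ ⟨(hin x hx y hy hxy).1,
        (inner_lt_one_iff_real_of_norm_eq_one (hunit x hx) (hunit y hy)).2 hxy⟩
  rw [EReal.coe_le_coe_iff]
  nlinarith

/-! ### The interpolation nodes -/

lemma HasNonnegSeries.const_mul {h : ℝ → ℝ} (hh : HasNonnegSeries h) {c : ℝ} (hc : 0 ≤ c) :
    HasNonnegSeries fun t => c * h t := by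
  obtain ⟨a, ha, hs⟩ := hh
  refine ⟨fun i => c * a i, fun i => mul_nonneg hc (ha i), fun t ht => ?_⟩
  simpa only [mul_assoc] using (hs t ht).mul_left c

/-- The Newton product of degree `m` for the sequence of nodes `β₀, β₁, β₁, β₂, β₂, …`. -/
def newtonProd (β : ℕ → ℝ) (m : ℕ) : ℝ[X] := ∏ i ∈ Finset.range m, (X - C (β ((i + 1) / 2)))

lemma newtonProd_degree (β : ℕ → ℝ) (m : ℕ) : (newtonProd β m).degree = m := by
  rw [newtonProd, degree_prod]
  simp

lemma newtonProd_odd (β : ℕ → ℝ) (r : ℕ) :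
    newtonProd β (2 * r + 1) = (X - C (β 0)) * (nodeProd β r * nodeProd β r) := by
  induction r with
  | zero => simp [newtonProd, nodeProd]
  | succ r ih =>
    rw [newtonProd, show 2 * (r + 1) + 1 = 2 * r + 1 + 1 + 1 by ring, Finset.prod_range_succ,
      Finset.prod_range_succ, ← newtonProd, ih, nodeProd_succ,
      show (2 * r + 1 + 1) / 2 = r + 1 by omega, show (2 * r + 1 + 1 + 1) / 2 = r + 1 by omega]
    ring

lemma newtonProd_even (β : ℕ → ℝ) (r : ℕ) :
    newtonProd β (2 * r + 2) = (X - C (β 0)) * (nodeProd β r * nodeProd β (r + 1)) := by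
  rw [newtonProd, show 2 * r + 2 = 2 * r + 1 + 1 by ring, Finset.prod_range_succ, ← newtonProd,
    newtonProd_odd, nodeProd_succ, show (2 * r + 1 + 1) / 2 = r + 1 by omega]
  ring

lemma splits_newtonProd (β : ℕ → ℝ) (m : ℕ) : (newtonProd β m).Splits :=
  Splits.prod fun _ _ => Splits.X_sub_C _

lemma isRoot_newtonProd {β : ℕ → ℝ} {m : ℕ} {x : ℝ} (h : (newtonProd β m).IsRoot x) :
    ∃ i < m, β ((i + 1) / 2) = x := by
  rw [IsRoot.def, newtonProd, eval_prod, Finset.prod_eq_zero_iff] at h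
  obtain ⟨i, hi, h0⟩ := h
  rw [eval_sub, eval_X, eval_C, sub_eq_zero] at h0
  exact ⟨i, Finset.mem_range.1 hi, h0.symm⟩

lemma rootMultiplicity_nodeProd_le {β : ℕ → ℝ} {m : ℕ} (hβ : StrictMonoOn β (Set.Iic (m + 1)))
    (x : ℝ) : (nodeProd β m).rootMultiplicity x ≤ 1 := by
  refine rootMultiplicity_le_one_of_separable ?_ x
  rw [nodeProd, separable_prod_X_sub_C_iff']
  intro i hi j hj hij
  have hi' := Finset.mem_range.1 hi
  have hj' := Finset.mem_range.1 hj
  have := hβ.injOn (Set.mem_Iic.2 (by omega : i + 1 ≤ m + 1))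
    (Set.mem_Iic.2 (by omega : j + 1 ≤ m + 1)) hij
  omega

lemma rootMultiplicity_newtonProd_le {β : ℕ → ℝ} {m : ℕ} (hβ : StrictMonoOn β (Set.Iic (m + 1)))
    (x : ℝ) : (newtonProd β (2 * m + 1)).rootMultiplicity x ≤ 2 := by
  have hA : nodeProd β m ≠ 0 := (nodeProd_monic β m).ne_zero
  have hX : (X - C (β 0) : ℝ[X]) ≠ 0 := X_sub_C_ne_zero _
  have h1 := rootMultiplicity_nodeProd_le hβ x
  rw [newtonProd_odd, rootMultiplicity_mul (mul_ne_zero hX (mul_ne_zero hA hA)),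
    rootMultiplicity_mul (mul_ne_zero hA hA)]
  rcases eq_or_ne x (β 0) with rfl | hx
  · have h0 : (nodeProd β m).rootMultiplicity (β 0) = 0 := by
      refine rootMultiplicity_eq_zero fun h => ?_
      rw [IsRoot.def, nodeProd, eval_prod, Finset.prod_eq_zero_iff] at h
      obtain ⟨i, hi, h0⟩ := h
      rw [eval_sub, eval_X, eval_C, sub_eq_zero] at h0
      have := Finset.mem_range.1 hi
      exact (hβ (Set.mem_Iic.2 (by omega)) (Set.mem_Iic.2 (by omega)) i.succ_pos).ne h0
    rw [h0, rootMultiplicity_X_sub_C_self]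
    omega
  · rw [rootMultiplicity_X_sub_C, if_neg hx]
    omega

/-- A nonnegative power series differs from its Hermite interpolant at `β₀, β₁, β₁, …, β_k, β_k` by
the nodal polynomial times a function of the same kind, and the interpolant is a nonnegative
combination of Newton products. -/
lemma exists_hermite {β : ℕ → ℝ} (hβ : StrictMonoOn β (Set.Iic (k + 1)))
    (hβI : ∀ i ≤ k, β i ∈ Set.Ico (-1 : ℝ) 1) {a : ℝ} (ha : 0 < a) {h : ℝ → ℝ}
    (hh : HasNonnegSeries h) :
    ∃ (c : ℕ → ℝ) (v : ℝ → ℝ), (∀ i, 0 ≤ c i) ∧ HasNonnegSeries v ∧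
      (∀ t ∈ Set.Ico (-1 : ℝ) 1, h t
        = (∑ m ∈ Finset.range (2 * k + 1), C (c m) * newtonProd β m).eval t
          + (C a * newtonProd β (2 * k + 1)).eval t * v t) ∧
      IsHermiteInterpolant (C a * newtonProd β (2 * k + 1)) h
        (∑ m ∈ Finset.range (2 * k + 1), C (c m) * newtonProd β m) := by
  obtain ⟨c, v, hc, hv, heq⟩ := hh.exists_newton (N := 2 * k + 1)
    (x := fun i => β ((i + 1) / 2)) fun i hi => hβI _ (by omega)
  have hprod : ∀ (m : ℕ) (t : ℝ),
      ∏ i ∈ Finset.range m, (t - β ((i + 1) / 2)) = (newtonProd β m).eval t := fun m t => by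
    simp [newtonProd, eval_prod]
  have heq' : ∀ t ∈ Set.Ico (-1 : ℝ) 1, h t
      = (∑ m ∈ Finset.range (2 * k + 1), C (c m) * newtonProd β m).eval t
        + (C a * newtonProd β (2 * k + 1)).eval t * (a⁻¹ * v t) := by
    intro t ht
    rw [heq t ht, hprod, eval_finsetSum]
    simp only [hprod, eval_mul, eval_C]
    field_simp
  have hv' := hv.const_mul (inv_pos.2 ha).le
  have hN0 : newtonProd β (2 * k + 1) ≠ 0 := fun h0 => by
    have := newtonProd_degree β (2 * k + 1)
    rw [h0, degree_zero] at this
    exact WithBot.bot_ne_coe this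
  refine ⟨c, fun t => a⁻¹ * v t, hc, hv', heq', isHermiteInterpolant_of_error hv' ?_ ?_ ?_ heq'⟩
  · rw [degree_C_mul ha.ne', newtonProd_degree]
    refine (degree_sum_le _ _).trans_lt
      ((Finset.sup_lt_iff (WithBot.bot_lt_coe _)).2 fun m hm => ?_)
    rw [← smul_eq_C_mul]
    refine (degree_smul_le _ _).trans_lt ?_
    rw [newtonProd_degree]
    exact_mod_cast Finset.mem_range.1 hm
  · intro x
    rw [rootMultiplicity_mul (mul_ne_zero (C_ne_zero.2 ha.ne') hN0), rootMultiplicity_C, zero_add]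
    exact rootMultiplicity_newtonProd_le hβ x
  · intro x hx
    rw [IsRoot.def, eval_mul, eval_C, mul_eq_zero] at hx
    obtain ⟨i, hi, rfl⟩ := isRoot_newtonProd (hx.resolve_left ha.ne')
    exact hβI _ (by omega)

lemma IsRadauQuadrature.mean_eq (hn : 2 ≤ n) {β ρ : ℕ → ℝ} (hR : IsRadauQuadrature n k ℓ s β ρ)
    {p : ℝ[X]} (hp : p.natDegree ≤ 2 * k) :
    mean hn p = ∑ i ∈ Finset.range (k + 1), ρ i * p.eval (β i) + ρ (k + 1) * p.eval 1 := by
  rw [mean_apply, hR.exact_of_degree p hp, Finset.sum_range_succ, hR.last]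

lemma lt_of_lt_smallestZero {p : ℝ[X]} {T : Finset ℝ} (hT : ∀ t, p.IsRoot t ↔ t ∈ T) {x : ℝ}
    (hx : x < smallestZero p) : ∀ t ∈ T, x < t := fun t ht => by
  have hset : {x : ℝ | p.IsRoot x} = T := Set.ext hT
  rw [smallestZero, hset] at hx
  exact hx.trans_le (csInf_le T.bddBelow ht)

lemma lt_of_largestZero_lt {p : ℝ[X]} {T : Finset ℝ} (hT : ∀ t, p.IsRoot t ↔ t ∈ T) {x : ℝ}
    (hx : largestZero p < x) : ∀ t ∈ T, t < x := fun t ht => by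
  have hset : {x : ℝ | p.IsRoot x} = T := Set.ext hT
  rw [largestZero, hset] at hx
  exact (le_csSup T.bddAbove ht).trans_lt hx

end SphericalLP

end

open SphericalLP

theorem mainTheorem1 (n k : ℕ) (hn : 2 ≤ n) (hk : 1 ≤ k) (ℓ s : ℝ)
    (hℓ : ℓ ∈ Set.Ico (-1) (SphericalLP.smallestZero (SphericalLP.adjacent n k)))
    (hs : s ∈ Set.Ioo (SphericalLP.largestZero (SphericalLP.adjacent n k))
      (SphericalLP.largestZero (SphericalLP.ellPoly n ℓ k)))
    (hKrein : SphericalLP.StrengthenedKrein n k ℓ)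
    (f : ℝ[X]) (hf : f = SphericalLP.levPoly n k ℓ s)
    (f₀ : ℝ) (hf₀ : f₀ = SphericalLP.gegenbauerCoeff n (fun t => f.eval t) 0) :
    ∃ β ρ : ℕ → ℝ, SphericalLP.IsRadauQuadrature n k ℓ s β ρ ∧
      (SphericalLP.maxCodeSize n ℓ s : ℝ≥0∞) ≤ ENNReal.ofReal (f.eval 1 / f₀) ∧
      f.eval 1 / f₀ = 1 / ρ (k + 1) ∧
      ∀ h : ℝ → ℝ, AbsolutelyMonotoneOn h (Set.Ico (-1) 1) →
        (∃! g : ℝ[X], SphericalLP.IsHermiteInterpolant ((X - C s) * f) h g) ∧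
        ∀ g : ℝ[X], SphericalLP.IsHermiteInterpolant ((X - C s) * f) h g →
          ((∃ t ∈ Set.Ico (-1 : ℝ) 1, h t ≠ 0) →
            (fun t => g.eval t) ∈ SphericalLP.yudinClass n ℓ h) ∧
          ∀ M : ℝ, f.eval 1 = M * f₀ → ∀ g₀ : ℝ,
            g₀ = SphericalLP.gegenbauerCoeff n (fun t => g.eval t) 0 →
            ((M * (M * g₀ - g.eval 1) : ℝ) : EReal) ≤ SphericalLP.minEnergy n M ℓ h ∧
            M * (M * g₀ - g.eval 1)
              = M ^ 2 * ∑ i ∈ Finset.range (k + 1), ρ i * h (β i) := by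
  obtain ⟨T, w, G, hT⟩ := exists_isGaussRule hn hk
  have hℓT := lt_of_lt_smallestZero hT hℓ.2
  have hsT := lt_of_largestZero_lt hT hs.1
  obtain ⟨hs1, he1, -⟩ := G.monicEll_last hk hℓT hsT hs.2 hKrein
  have he : ∀ i ≤ k, 0 < (monicEll hn ℓ i).eval 1 := fun i hi => by
    rcases hi.eq_or_lt with rfl | hi
    · exact he1
    · exact G.monicEll_eval_pos hℓT (fun t ht => (G.mem t ht).2) hi
  obtain ⟨β, ρ, hR, ⟨c, hc, hSPoly⟩, ⟨b, hb, hlast⟩, hpos⟩ :=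
    G.exists_radau hk hℓT hsT hs.2 hKrein
  rw [← hf] at hpos
  rw [gegenbauerCoeff_zero hn] at hf₀
  have hPD : ∀ m m' : ℕ, m < k → m' ≤ k → PosDef n fun t =>
      ((X - C ℓ) * (nodeProd β m * nodeProd β m')).eval t := fun m m' hm hm' =>
    G.posDef_nodeProd_mul hk hℓT hKrein he hR hb hlast hm hm'
  have hc2 : 0 < c ^ 2 := by positivity
  have hAk : nodeProd β k = nodeProd β (k - 1) * (X - C s) := by
    obtain ⟨r, rfl⟩ : ∃ r, k = r + 1 := ⟨k - 1, by omega⟩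
    rw [nodeProd_succ, hR.node_s, Nat.add_sub_cancel]
  have hfeq : f = C (c ^ 2) * ((X - C ℓ) * (nodeProd β (k - 1) * nodeProd β k)) := by
    rw [hf, levPoly, hSPoly, hAk, C_pow]; ring
  have hFeq : (X - C s) * f = C (c ^ 2) * newtonProd β (2 * k + 1) := by
    rw [newtonProd_odd, hR.first, hf, levPoly, hSPoly, hAk, C_pow]; ring
  have hfPD : PosDef n fun t => f.eval t := by
    rw [hfeq]
    exact PosDef.C_mul hn (hPD (k - 1) k (by omega) le_rfl) hc2.le
  have hfeval : ∀ t, f.eval t = (t - ℓ) * (t - s) * (ellSPoly n k ℓ s).eval t ^ 2 := fun t => by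
    simp [hf, levPoly]
  have hfneg : ∀ t ∈ Set.Icc ℓ s, f.eval t ≤ 0 := fun t ht => by
    rw [hfeval]
    exact mul_nonpos_of_nonpos_of_nonneg
      (mul_nonpos_of_nonneg_of_nonpos (sub_nonneg.2 ht.1) (sub_nonpos.2 ht.2)) (sq_nonneg _)
  have hfdeg : f.natDegree ≤ 2 * k := by
    rw [hfeq]
    refine natDegree_le_of_degree_le ?_
    rw [degree_C_mul hc2.ne', degree_mul, degree_mul, degree_X_sub_C, nodeProd_degree,
      nodeProd_degree]
    norm_cast
    omega
  have hfzero : ∀ i ≤ k, f.eval (β i) = 0 := by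
    intro i hi
    rw [hfeq, eval_mul, eval_mul, eval_mul]
    rcases Nat.eq_zero_or_pos i with rfl | hi0
    · rw [hR.first]; simp
    · rw [nodeProd_eval_eq_zero β hi0 hi]; simp
  -- the quadrature sees only the node `1` of `f`
  have hf₀ρ : f₀ = ρ (k + 1) * f.eval 1 := by
    rw [hf₀, hR.mean_eq hn hfdeg, Finset.sum_eq_zero fun i hi => by
      rw [hfzero i (by have := Finset.mem_range.1 hi; omega), mul_zero], zero_add]
  have hρ : 0 < ρ (k + 1) := hR.pos _ le_rfl
  have hf₀pos : 0 < f₀ := hf₀ ▸ hpos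
  have hf1 : f.eval 1 ≠ 0 := fun h0 => by
    rw [h0, mul_zero] at hf₀ρ
    exact hf₀pos.ne' hf₀ρ
  have hβI : ∀ i ≤ k, β i ∈ Set.Ico (-1 : ℝ) 1 := fun i hi => by
    constructor
    · refine hℓ.1.trans (hR.first.symm.le.trans (hR.strictMono.monotoneOn ?_ ?_ i.zero_le))
      · exact Set.mem_Iic.2 (Nat.zero_le _)
      · exact Set.mem_Iic.2 (by omega)
    · rw [← hR.last]
      exact hR.strictMono (Set.mem_Iic.2 (by omega)) (Set.mem_Iic.2 le_rfl) (by omega)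
  refine ⟨β, ρ, hR, ?_, ?_, fun h hh => ?_⟩
  · rw [hf₀]
    exact maxCodeSize_le hn hfPD hpos hfneg
  · rw [hf₀ρ, div_mul_cancel_right₀ hf1, one_div]
  have hser := hasNonnegSeries_of_absolutelyMonotoneOn hh
  obtain ⟨d, v, hd, hv, herr, hH⟩ := exists_hermite hR.strictMono hβI hc2 hser
  rw [hFeq]
  have hsplit : (C (c ^ 2) * newtonProd β (2 * k + 1)).Splits := (splits_newtonProd _ _).C_mul _
  refine ⟨⟨_, hH, fun g hg => hg.unique hsplit hH⟩, fun g hg => ?_⟩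
  obtain rfl := hg.unique hsplit hH
  set g := ∑ m ∈ Finset.range (2 * k + 1), C (d m) * newtonProd β m with hgdef
  have hgPD : PosDef n fun t => g.eval t := by
    refine PosDef.sum hn _ fun m hm => PosDef.C_mul hn ?_ (hd m)
    have hm' := Finset.mem_range.1 hm
    obtain ⟨r, hr⟩ | ⟨r, hr⟩ := m.even_or_odd
    · rcases Nat.eq_zero_or_pos r with rfl | hr0
      · rw [hr, newtonProd]
        exact PosDef.one hn
      · obtain ⟨q, rfl⟩ : ∃ q, r = q + 1 := ⟨r - 1, by omega⟩
        rw [show m = 2 * q + 2 by omega, newtonProd_even, hR.first]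
        exact hPD q (q + 1) (by omega) (by omega)
    · rw [hr, newtonProd_odd, hR.first]
      exact hPD r r (by omega) (by omega)
  have hFnn : ∀ t, ℓ ≤ t → 0 ≤ (C (c ^ 2) * newtonProd β (2 * k + 1)).eval t := fun t ht => by
    rw [newtonProd_odd, hR.first]
    simp only [eval_mul, eval_C, eval_sub, eval_X]
    exact mul_nonneg hc2.le (mul_nonneg (sub_nonneg.2 ht) (mul_self_nonneg _))
  have hgle : ∀ t ∈ Set.Ico ℓ 1, g.eval t ≤ h t := fun t ht => by
    have htI : t ∈ Set.Ico (-1 : ℝ) 1 := ⟨hℓ.1.trans ht.1, ht.2⟩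
    rw [herr t htI]
    exact le_add_of_nonneg_right (mul_nonneg (hFnn t ht.1) (hv.nonneg htI))
  have hgdeg : g.natDegree ≤ 2 * k := by
    refine natDegree_le_of_degree_lt_succ (hg.1.trans_eq ?_)
    rw [degree_C_mul hc2.ne', newtonProd_degree]
  have hgβ : ∀ i ≤ k, g.eval (β i) = h (β i) := fun i hi => by
    rw [herr _ (hβI i hi), ← hFeq, eval_mul, hfzero i hi, mul_zero, zero_mul, add_zero]
  have hmean : mean hn g = ∑ i ∈ Finset.range (k + 1), ρ i * h (β i) + ρ (k + 1) * g.eval 1 := by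
    rw [hR.mean_eq hn hgdeg, Finset.sum_congr rfl fun i hi => by
      rw [hgβ i (by have := Finset.mem_range.1 hi; omega)]]
  refine ⟨fun hne => ⟨hgPD, hgle, ?_⟩, fun M hM g₀ hg₀ => ?_⟩
  · rw [gegenbauerCoeff_zero hn, hmean]
    refine add_pos_of_pos_of_nonneg ?_ (mul_nonneg hρ.le (hgPD.eval_one_nonneg hn))
    refine Finset.sum_pos' (fun i hi => ?_) ⟨k, Finset.self_mem_range_succ k, ?_⟩
    · have hi' : i ≤ k := by have := Finset.mem_range.1 hi; omega
      exact mul_nonneg (hR.pos i (by omega)).le (hser.nonneg (hβI i hi'))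
    · refine mul_pos (hR.pos k (by omega)) ((hser.nonneg (hβI k le_rfl)).lt_of_ne' fun h0 => ?_)
      obtain ⟨t, ht, hne⟩ := hne
      rw [hR.node_s] at h0
      refine hne (hser.eq_zero_of_eq_zero ⟨?_, hs1⟩ h0 t ht)
      obtain ⟨u, hu⟩ : T.Nonempty := by rw [← Finset.card_pos, G.card]; omega
      exact (G.mem u hu).1.trans (hsT u hu)
  · rw [gegenbauerCoeff_zero hn] at hg₀
    refine ⟨hg₀ ▸ le_minEnergy hn hgPD hgle M, ?_⟩
    have hMρ : M * ρ (k + 1) = 1 := by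
      rw [hf₀ρ, ← mul_assoc] at hM
      exact (mul_right_cancel₀ hf1 (by rw [one_mul]; exact hM)).symm
    rw [hg₀, hmean]
    linear_combination M * g.eval 1 * hMρ
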